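/- Let $K$ be a field of characteristic zero with algebraic closure $\overline K$. Let $U=U(sl_2)$ be the universal enveloping algebra of the Lie algebra $sl_2$ over $K$, with generators $X,Y,H$ such that $[H,X]=X$, $[H,Y]=-Y$, $[X,Y]=2H$, and let $C=YX+H(H+1)$ be its Casimir element. **Definitions.** For a $K$-algebra $A$ and $a\in A$, put $\mathrm{ad}\,a(b)=ab-ba$; let $Z(A)$ be the centre of $A$, $C(a)=\ker(\mathrm{ad}\,a)$ the centralizer of $a$, $N(a)=\bigcup_{i\ge 0}\ker(\mathrm{ad}\,a)^{i+1}$, $D(a)$ the set of $b\in A$ such that $1\otimes b$ is a sum of eigenvectors of the inner derivation $\mathrm{ad}(1\otimes a)$ of $\overline K\otimes_K A$, and $F(a)$ the set of $b\in A$ such that the elements $(\mathrm{ad}\,a)^n(b)$, $n\ge 0$, span a finite-dimensional $K$-space. A noncentral element $a$ is *strongly nilpotent* ($a\in\Delta_1(A)$) if $N(a)=A$, $D(a)=C(a)$; *weakly nilpotent* ($\Delta_2(A)$) if $C(a)\ne N(a)\ne A$, $D(a)=C(a)$; *strongly semi-simple* ($\Delta_3(A)$) if $N(a)=C(a)$,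 $D(a)=A$; *weakly semi-simple* ($\Delta_4(A)$) if $N(a)=C(a)$, $C(a)\neq D(a)=F(a)\ne A$; *generic* ($\Delta_5(A)$) if $N(a)=D(a)=C(a)$. * $A$ *admits the Dixmier partition* if $A\setminus Z(A)=\Delta_1(A)\cup\dots\cup\Delta_5(A)$. * A noncommutative algebra $A$ satisfies the *ccc* (commutative centralizer condition) if $C(a)$ is commutative for every $a\in A\setminus Z(A)$. * A noncommutative algebra $A$ admitting the Dixmier partition satisfies the *hcc* (homogeneous centralizer condition) if for every $a\in A\setminus Z(A)$ exactly one of the following holds for the elements of $C(a)\setminus Z(A)$: (1) all are strongly nilpotent; (2) all are weakly nilpotent; (3) for some $b\in\Delta_3(A)$, $K^*b+Z(A)$ is a subset of $C(a)\setminus Z(A)$ consisting of strongly semi-simple elements, and all the other elements are generic; (4) the same with $\Delta_4(A)$ and weakly semi-simple elements; (5) all are generic. * $\mathrm{GK}(A)=\sup_V\limsup_{n\to\infty}\log\dim_K\big((K+V)^n\big)/\log n$ is the Gelfand-Kirillov dimension, $V$ running over the finite-dimensional subspaces of $A$. **Proposition.** The algebra $U$ has a (two-sided) division ring of quotients $Q(U)$,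 and: 1. $U$ and $Q(U)$ satisfy the ccc, the element $C$ is transcendental over $K$, and the centre of $Q(U)$ is the subfield $K(C)$ generated by $K$ and $C$ (so it is a field of rational functions in $C$). 2. The algebra $U$, and every noncommutative $K$-subalgebra $A$ of $Q(U)$ with $\mathrm{GK}(A)<4$ and $A\cap K(C)\ne K$, admits the Dixmier partition and satisfies both the hcc and the ccc. -/

import Mathlib

open scoped TensorProduct

universe u v

noncomputable section

namespace DixmierTypes

section Derivations

variable {K : Type*} [Field K] {A : Type*} [Ring A] [Algebra K A]

/-- The inner derivation `ad a : b ↦ ab - ba`, as a `K`-linear map. -/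
def ad (K : Type*) [Field K] {A : Type*} [Ring A] [Algebra K A] (a : A) : A →ₗ[K] A :=
  LinearMap.mulLeft K a - LinearMap.mulRight K a

/-- The kernel `C(δ)`. -/
def kerAlg (δ : A →ₗ[K] A) : Submodule K A := LinearMap.ker δ

/-- The nil-algebra `N(δ)`, the union over `i ≥ 0` of the kernels of `δ ^ (i + 1)`
(an increasing chain, so that the supremum is the union). -/
def nilAlg (δ : A →ₗ[K] A) : Submodule K A := ⨆ i : ℕ, LinearMap.ker (δ ^ (i + 1))

/-- The eigenvalue algebra over the algebraic closure `L` of `K`: the (automatically direct) sum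
of the eigenspaces of the extension of `δ` to `L ⊗ A`. -/
def eigAlgClosure (δ : A →ₗ[K] A) :
    Submodule (AlgebraicClosure K) (AlgebraicClosure K ⊗[K] A) :=
  ⨆ μ : AlgebraicClosure K,
    Module.End.eigenspace
      (δ.baseChange (AlgebraicClosure K) : Module.End (AlgebraicClosure K) _) μ

/-- The eigenvalue algebra `D(δ)`: the elements `a` of `A` such that `1 ⊗ a` is a sum of
eigenvectors in `L ⊗ A`, where `L` is the algebraic closure of `K`. -/
def eigAlg (δ : A →ₗ[K] A) : Submodule K A :=
  ((eigAlgClosure δ).restrictScalars K).comap (TensorProduct.mk K (AlgebraicClosure K) A 1)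

/-- The torsion algebra `F(δ)`, as a set: the elements `a` such that `K[δ]a`, the span of all
`δ ^ n a`, is finite-dimensional. -/
def torsionSet (δ : A →ₗ[K] A) : Set A :=
  {a | FiniteDimensional K (Submodule.span K (Set.range fun n : ℕ => (δ ^ n) a))}

/-- `δ` is strongly nilpotent. -/
def StronglyNilpotent (δ : A →ₗ[K] A) : Prop :=
  nilAlg δ = ⊤ ∧ eigAlg δ = kerAlg δ

/-- `δ` is weakly nilpotent. -/
def WeaklyNilpotent (δ : A →ₗ[K] A) : Prop :=
  kerAlg δ ≠ nilAlg δ ∧ nilAlg δ ≠ ⊤ ∧ eigAlg δ = kerAlg δ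

/-- `δ` is strongly semi-simple. -/
def StronglySemisimple (δ : A →ₗ[K] A) : Prop :=
  nilAlg δ = kerAlg δ ∧ eigAlg δ = ⊤

/-- `δ` is weakly semi-simple. -/
def WeaklySemisimple (δ : A →ₗ[K] A) : Prop :=
  nilAlg δ = kerAlg δ ∧ kerAlg δ ≠ eigAlg δ ∧ (eigAlg δ : Set A) = torsionSet δ ∧
    torsionSet δ ≠ Set.univ

/-- `δ` is generic. -/
def Generic (δ : A →ₗ[K] A) : Prop :=
  nilAlg δ = eigAlg δ ∧ eigAlg δ = kerAlg δ

end Derivations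

section Algebras

variable (K : Type*) [Field K] (A : Type*) [Ring A] [Algebra K A]

/-- The set of noncentral elements. -/
def nonCentral : Set A := {a | a ∉ Subalgebra.center K A}

/-- Strongly nilpotent elements. -/
def Delta1 : Set A := {a | a ∈ nonCentral K A ∧ StronglyNilpotent (ad K a)}

/-- Weakly nilpotent elements. -/
def Delta2 : Set A := {a | a ∈ nonCentral K A ∧ WeaklyNilpotent (ad K a)}

/-- Strongly semi-simple elements. -/
def Delta3 : Set A := {a | a ∈ nonCentral K A ∧ StronglySemisimple (ad K a)}

/-- Weakly semi-simple elements. -/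
def Delta4 : Set A := {a | a ∈ nonCentral K A ∧ WeaklySemisimple (ad K a)}

/-- Generic elements. -/
def Delta5 : Set A := {a | a ∈ nonCentral K A ∧ Generic (ad K a)}

/-- `A` admits the Dixmier partition. -/
def AdmitsDixmierPartition : Prop :=
  nonCentral K A = Delta1 K A ∪ Delta2 K A ∪ Delta3 K A ∪ Delta4 K A ∪ Delta5 K A

/-- `A` is noncommutative. -/
def Noncommutative (A : Type*) [Ring A] : Prop := ∃ x y : A, x * y ≠ y * x

/-- The set `C(a) \ Z(A)`. -/
def noncentralCentralizer (a : A) : Set A := {b | b ∈ nonCentral K A ∧ a * b = b * a}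

/-- The subset `K^* b + Z(A)`. -/
def scaledCoset (b : A) : Set A :=
  {x | ∃ c : K, c ≠ 0 ∧ ∃ z ∈ Subalgebra.center K A, x = c • b + z}

/-- The five possible types of a set `S` of elements in the homogeneous centralizer condition:
strongly nilpotent; weakly nilpotent; generic except for a subset `K^* b + Z(A)` of strongly
semi-simple elements; generic except for a subset `K^* b + Z(A)` of weakly semi-simple elements;
generic. -/
def HasHomogeneousType (S : Set A) : Fin 5 → Prop
  | 0 => S ⊆ Delta1 K A
  | 1 => S ⊆ Delta2 K A
  | 2 => ∃ b ∈ Delta3 K A, scaledCoset K A b ⊆ S ∧ scaledCoset K A b ⊆ Delta3 K A ∧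
      S \ scaledCoset K A b ⊆ Delta5 K A
  | 3 => ∃ b ∈ Delta4 K A, scaledCoset K A b ⊆ S ∧ scaledCoset K A b ⊆ Delta4 K A ∧
      S \ scaledCoset K A b ⊆ Delta5 K A
  | 4 => S ⊆ Delta5 K A

/-- The homogeneous centralizer condition (for noncommutative algebras that admit the Dixmier
partition). -/
def SatisfiesHCC : Prop :=
  Noncommutative A ∧ AdmitsDixmierPartition K A ∧
    ∀ a ∈ nonCentral K A, ∃! i : Fin 5, HasHomogeneousType K A (noncentralCentralizer K A a) i

/-- The commutative centralizer condition (for noncommutative algebras). -/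
def SatisfiesCCC : Prop :=
  Noncommutative A ∧
    ∀ a ∈ nonCentral K A, ∀ x ∈ Subalgebra.centralizer K {a},
      ∀ y ∈ Subalgebra.centralizer K {a}, x * y = y * x

/-- The Gelfand-Kirillov dimension: the supremum, over the finite-dimensional subspaces `V`,
of the upper limit of `log (dim (K + V) ^ n) / log n`; here `(K + V) ^ n` is the sum of the
`V ^ i` with `i ≤ n`. -/
def gkDim : EReal :=
  ⨆ V : {V : Submodule K A // V.FG},
    Filter.limsup
      (fun n : ℕ =>
        ((Real.log (Module.finrank K ((1 ⊔ V.1) ^ n : Submodule K A)) / Real.log n : ℝ) : EReal))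
      Filter.atTop

end Algebras

section Quotients

variable {K : Type*} [Field K]

/-- The map `ι : B → Q` presents the division ring `Q` as the (two-sided) division ring of
quotients of `B`: it is injective and every element of `Q` is both a left and a right fraction
of elements of `B`. -/
structure IsDivisionRingOfQuotients {B Q : Type*} [Ring B] [Algebra K B] [DivisionRing Q]
    [Algebra K Q] (ι : B →ₐ[K] Q) : Prop where
  injective : Function.Injective ι
  left_fraction : ∀ q : Q, ∃ s b : B, s ≠ 0 ∧ q = (ι s)⁻¹ * ι b
  right_fraction : ∀ q : Q, ∃ s b : B, s ≠ 0 ∧ q = ι b * (ι s)⁻¹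

/-- The division `K`-subalgebra `K(c)` of a division algebra generated by `c`. -/
def generatedField (K : Type*) [Field K] {Q : Type*} [DivisionRing Q] [Algebra K Q] (c : Q) :
    Subalgebra K Q :=
  { (Subfield.closure (Set.range (algebraMap K Q) ∪ {c})).toSubring.toSubsemiring with
    algebraMap_mem' := fun r =>
      Subfield.subset_closure (Set.mem_union_left _ (Set.mem_range_self r)) }

end Quotients

section Sl2

variable (K : Type*) [Field K]

/-- The universal enveloping algebra of `sl(2)`, the Lie algebra of traceless 2 by 2 matrices. -/
abbrev Usl2 : Type _ :=
  UniversalEnvelopingAlgebra K (LieAlgebra.SpecialLinear.sl (Fin 2) K)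

/-- The generator `X`, the image of the elementary matrix with index `(0, 1)`. -/
def genX : Usl2 K :=
  UniversalEnvelopingAlgebra.ι K
    (LieAlgebra.SpecialLinear.single (0 : Fin 2) (1 : Fin 2) (by decide) (1 : K))

/-- The generator `Y`, the image of the elementary matrix with index `(1, 0)`. -/
def genY : Usl2 K :=
  UniversalEnvelopingAlgebra.ι K
    (LieAlgebra.SpecialLinear.single (1 : Fin 2) (0 : Fin 2) (by decide) (1 : K))

/-- The generator `H`, the image of the diagonal matrix with entries `1/2` and `-1/2`; so
`[H, X] = X`, `[H, Y] = -Y` and `[X, Y] = 2 H`. -/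
def genH : Usl2 K :=
  UniversalEnvelopingAlgebra.ι K
    (LieAlgebra.SpecialLinear.singleSubSingle (0 : Fin 2) (1 : Fin 2) (1 / 2 : K))

/-- The Casimir element `C = Y X + H (H + 1)`. -/
def casimir : Usl2 K := genY K * genX K + genH K * (genH K + 1)

end Sl2

end DixmierTypes

end

/-! The algebra `U` embeds in a division ring `alg σ` of skew Laurent series `∑ aₙ Xⁿ`, whose
coefficients lie in a field of rational functions in `c` and `h`, with `X h = (h - 1) X`: send `H`
to `h` and `Y` to `(c - h (h + 1)) X⁻¹`, so that `C` goes to `c` (`skewRep`). Comparing leading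
terms of series shows that a noncentral element has a commutative centralizer (`commute_of_commute`)
and is transcendental over the centre (`transcendental_of_not_central`). The growth of `U` is at
most cubic. This bounds its Gelfand-Kirillov dimension and also gives both Ore conditions, because
two injective maps of bounded degree cannot have ranges that meet only in zero. The division ring of
quotients then embeds in `alg σ` too, and the ccc, the centre and the transcendence of `C` are read
off there.

For the partition and the hcc, let `A` have dimension less than four and contain a nonscalar element
`z` that is central in the division ring, and extend scalars to the algebraic closure. The powers of
`z` are independent over the scalars. So no three elements `a`, `y`, `x` can have all `aⁱ yʲ xˡ`
independent over the centre, since otherwise four independent exponents would force dimension at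
least four (`not_indep`). This has two consequences.

(1) `not_height_one`: `ad a` cannot have both an eigenvector with nonzero eigenvalue and a Jordan
block of size two. If `N(a) ≠ C(a)`, then `D(a) = C(a)`; if `N(a) = C(a)`, then `ad a` is semisimple
on torsion elements and `D(a) = F(a)`. The partition follows.

(2) `exists_sub_smul_mem_center`: commuting `b`, `c` with nonzero eigenvalues are proportional
modulo the centre. Their eigenvectors `x`, `x'` act by conjugation on the field `C(b)`. By
Dedekind's argument some `xᵐ` and `x'ⁿ` act alike there, and then a combination `c - η b` commutes
with `xᵐ` and is forced to be central.

By the ccc, `C` and `N` are constant on the noncentral part of a centralizer; with (2) this gives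
the hcc. -/

noncomputable section

/-! ### The division ring of skew Laurent series. -/

namespace SkewLaurent

section Construction

variable {E F : Type*} [Field E] [Field F] [Algebra E F] (σ : F ≃ₐ[E] F)

/-- The endomorphism `b ↦ a * σ ^ n b`. -/
def twist (n : ℤ) (a : F) : Module.End E F :=
  LinearMap.mulLeft E a * (σ ^ n).toLinearMap

@[simp] lemma twist_apply (n : ℤ) (a b : F) : twist σ n a b = a * (σ ^ n) b := rfl

lemma twist_mul (m n : ℤ) (a b : F) :
    twist σ m a * twist σ n b = twist σ (m + n) (a * (σ ^ m) b) := by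
  ext x
  simp [zpow_add, mul_assoc]

lemma twist_add (n : ℤ) (a b : F) : twist σ n (a + b) = twist σ n a + twist σ n b := by
  ext x; simp [add_mul]

lemma twist_zero_right (n : ℤ) : twist σ n 0 = 0 := by
  ext x; simp

lemma twist_zero_one : twist σ 0 1 = 1 := by
  ext x; simp

lemma twist_sum {ι : Type*} (s : Finset ι) (n : ℤ) (a : ι → F) :
    twist σ n (∑ i ∈ s, a i) = ∑ i ∈ s, twist σ n (a i) := by
  ext x; simp [Finset.sum_mul]

/-- The `n`-th coefficient of the series `f`. -/
def rawCoeff (f : HahnSeries ℤ (Module.End E F)) (n : ℤ) : F := f.coeff n 1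

/-- The algebra of skew Laurent series `∑ aₙ Xⁿ` with coefficients in `F`, where
`X a = σ(a) X`, as a subalgebra of the Laurent series over the endomorphisms of `F`. -/
def subalg : Subalgebra E (HahnSeries ℤ (Module.End E F)) where
  -- `twist σ n a` sends `1` to `a`, so evaluation at `1` recovers the coefficient. Associativity
  -- and distributivity come from series over the endomorphism ring; only closure needs a proof.
  carrier := {f | ∀ n, f.coeff n = twist σ n (rawCoeff f n)}
  mul_mem' := by
    intro f g hf hg n
    have key : ∀ f g : HahnSeries ℤ (Module.End E F), (∀ n, f.coeff n = twist σ n (rawCoeff f n)) →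
        (∀ n, g.coeff n = twist σ n (rawCoeff g n)) → ∀ n, ∃ a, (f * g).coeff n = twist σ n a := by
      intro f g hf hg n
      rw [HahnSeries.coeff_mul]
      refine ⟨∑ ij ∈ Finset.antidiagonal f.isPWO_support g.isPWO_support n,
        rawCoeff f ij.1 * (σ ^ ij.1) (rawCoeff g ij.2), ?_⟩
      rw [twist_sum]
      refine Finset.sum_congr rfl fun ij hij => ?_
      rw [hf, hg, twist_mul, (Finset.mem_antidiagonal.1 hij).2.2]
    obtain ⟨a, ha⟩ := key f g hf hg n
    rw [rawCoeff, ha]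
    congr 1
    simp
  add_mem' := by
    intro f g hf hg n
    rw [HahnSeries.coeff_add, hf, hg, ← twist_add]
    simp [rawCoeff]
  algebraMap_mem' := by
    intro r n
    rw [rawCoeff, HahnSeries.algebraMap_apply, HahnSeries.C_apply]
    by_cases h : n = 0
    · subst h
      ext x
      simp [Algebra.algebraMap_eq_smul_one]
    · simp [HahnSeries.coeff_single_of_ne h, twist_zero_right]

instance : Ring (subalg σ) :=
  @Subalgebra.toRing E (HahnSeries ℤ (Module.End E F)) _ _ _ (subalg σ)

/-- The type of skew Laurent series. -/
def alg : Type _ := subalg σ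

variable {σ}

instance : Ring (alg σ) := inferInstanceAs (Ring (subalg σ))

instance : Algebra E (alg σ) := inferInstanceAs (Algebra E (subalg σ))

/-- The underlying series of endomorphisms. -/
def val (f : alg σ) : HahnSeries ℤ (Module.End E F) := Subtype.val f

lemma val_injective : Function.Injective (val : alg σ → _) := Subtype.val_injective

lemma val_add (f g : alg σ) : val (f + g) = val f + val g := rfl

lemma val_mul (f g : alg σ) : val (f * g) = val f * val g := rfl

lemma val_smul (r : E) (f : alg σ) : val (r • f) = r • val f := rfl

/-- The `n`-th coefficient of a skew Laurent series, as a linear map. -/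
def coeff (n : ℤ) : alg σ →ₗ[E] F where
  toFun f := rawCoeff (val f) n
  map_add' f g := by simp [rawCoeff, val_add]
  map_smul' r f := by simp [rawCoeff, val_smul]

lemma coeff_def (f : alg σ) (n : ℤ) : (val f).coeff n = twist σ n (coeff n f) := f.2 n

@[ext] lemma ext {f g : alg σ} (h : ∀ n, coeff n f = coeff n g) : f = g := by
  apply val_injective
  ext1
  funext n
  rw [coeff_def, coeff_def, h]

/-- The monomial `a Xⁿ`. -/
def mono (σ : F ≃ₐ[E] F) (n : ℤ) (a : F) : alg σ :=
  ⟨HahnSeries.single n (twist σ n a), by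
    intro m
    rw [rawCoeff]
    by_cases h : m = n
    · subst h
      simp
    · simp [HahnSeries.coeff_single_of_ne h, twist_zero_right]⟩

lemma val_mono (n : ℤ) (a : F) : val (mono σ n a) = HahnSeries.single n (twist σ n a) := rfl

lemma coeff_mono_same (n : ℤ) (a : F) : coeff n (mono σ n a) = a := by
  simp [coeff, rawCoeff, val_mono]

lemma coeff_mono_of_ne {m n : ℤ} (h : m ≠ n) (a : F) : coeff m (mono σ n a) = 0 := by
  simp [coeff, rawCoeff, val_mono, HahnSeries.coeff_single_of_ne h]

lemma coeff_mono (m n : ℤ) (a : F) : coeff m (mono σ n a) = if m = n then a else 0 := by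
  split_ifs with h
  · subst h; exact coeff_mono_same _ _
  · exact coeff_mono_of_ne h _

lemma mono_mul_mono (m n : ℤ) (a b : F) :
    mono σ m a * mono σ n b = mono σ (m + n) (a * (σ ^ m) b) := by
  apply val_injective
  simp only [val_mul, val_mono, HahnSeries.single_mul_single, twist_mul]

lemma mono_zero_one : mono σ 0 1 = 1 := by
  apply val_injective
  rw [val_mono, twist_zero_one]
  rfl

lemma coeff_mono_mul (m n : ℤ) (a : F) (f : alg σ) :
    coeff n (mono σ m a * f) = a * (σ ^ m) (coeff (n - m) f) := by
  have h : (val (mono σ m a * f)).coeff n = twist σ m a * (val f).coeff (n - m) := by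
    have := HahnSeries.coeff_single_mul_add (r := twist σ m a) (x := (val f)) (a := n - m) (b := m)
    rw [sub_add_cancel] at this
    exact this
  change (val (mono σ m a * f)).coeff n 1 = _
  rw [h, coeff_def]
  simp

lemma coeff_mul_mono (m n : ℤ) (a : F) (f : alg σ) :
    coeff n (f * mono σ m a) = coeff (n - m) f * (σ ^ (n - m)) a := by
  have h : (val (f * mono σ m a)).coeff n = (val f).coeff (n - m) * twist σ m a := by
    have := HahnSeries.coeff_mul_single_add (r := twist σ m a) (x := (val f)) (a := n - m) (b := m)
    rw [sub_add_cancel] at this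
    exact this
  change (val (f * mono σ m a)).coeff n 1 = _
  rw [h, coeff_def]
  simp

/-- The coefficients of `f` of index below `n` vanish. -/
def VanishesBelow (f : alg σ) (n : ℤ) : Prop := ∀ i < n, coeff i f = 0

lemma VanishesBelow.sub {f g : alg σ} {n : ℤ} (hf : VanishesBelow f n) (hg : VanishesBelow g n) :
    VanishesBelow (f - g) n := fun i hi => by simp [hf i hi, hg i hi]

lemma vanishesBelow_mono (n : ℤ) (a : F) : VanishesBelow (SkewLaurent.mono σ n a) n :=
  fun _ hi => coeff_mono_of_ne hi.ne a

/-- In degree `m + n` only the pair `(m, n)` contributes, since the supports start at `m` and `n`.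
All later arguments on leading terms rest on this. -/
lemma coeff_mul {f g : alg σ} {m n : ℤ} (hf : VanishesBelow f m) (hg : VanishesBelow g n) :
    VanishesBelow (f * g) (m + n) ∧
      coeff (m + n) (f * g) = coeff m f * (σ ^ m) (coeff n g) := by
  have hf' : ∀ i < m, (val f).coeff i = 0 := fun i hi => by
    rw [coeff_def, hf i hi, twist_zero_right]
  have hg' : ∀ i < n, (val g).coeff i = 0 := fun i hi => by
    rw [coeff_def, hg i hi, twist_zero_right]
  have key : ∀ k, (val (f * g)).coeff k = ∑ ij ∈ Finset.antidiagonal (val f).isPWO_support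
      (val g).isPWO_support k, (val f).coeff ij.1 * (val g).coeff ij.2 := fun k => HahnSeries.coeff_mul
  have hsupp : ∀ k, ∀ ij ∈ Finset.antidiagonal (val f).isPWO_support (val g).isPWO_support k,
      m ≤ ij.1 ∧ n ≤ ij.2 ∧ ij.1 + ij.2 = k := by
    intro k ij hij
    obtain ⟨h1, h2, h3⟩ := Finset.mem_antidiagonal.1 hij
    refine ⟨not_lt.1 fun h => h1 (hf' _ h), not_lt.1 fun h => h2 (hg' _ h), h3⟩
  refine ⟨fun k hk => ?_, ?_⟩
  · change (val (f * g)).coeff k 1 = 0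
    rw [key, Finset.sum_eq_zero]
    · rfl
    · intro ij hij
      have := hsupp k ij hij
      omega
  · change (val (f * g)).coeff (m + n) 1 = _
    rw [key, Finset.sum_eq_single (m, n)]
    · simp [coeff_def]
    · intro ij hij hne
      have := hsupp _ ij hij
      exact absurd (Prod.ext (by dsimp only; omega) (by dsimp only; omega)) hne
    · intro h
      by_cases h1 : (val f).coeff m = 0
      · simp [h1]
      by_cases h2 : (val g).coeff n = 0
      · simp [h2]
      exact absurd (Finset.mem_antidiagonal.2 ⟨h1, h2, rfl⟩) h

lemma exists_order {f : alg σ} (hf : f ≠ 0) : ∃ n, VanishesBelow f n ∧ coeff n f ≠ 0 := by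
  have hf1 : (val f) ≠ 0 := fun h => hf (val_injective h)
  refine ⟨(val f).order, fun i hi => ?_, fun h => ?_⟩
  · change (val f).coeff i 1 = 0
    rw [HahnSeries.coeff_eq_zero_of_lt_order hi]
    rfl
  · have : (val f).coeff (val f).order = 0 := by rw [coeff_def, h, twist_zero_right]
    exact HahnSeries.coeff_order_eq_zero.not.2 hf1 this

lemma exists_vanishesBelow (f : alg σ) : ∃ n, VanishesBelow f n := by
  by_cases hf : f = 0
  · exact ⟨0, fun i _ => by simp [hf]⟩
  · obtain ⟨n, hn, -⟩ := exists_order hf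
    exact ⟨n, hn⟩

lemma eq_zero_of_forall_vanishesBelow {f : alg σ} (m : ℤ)
    (h : ∀ t : ℕ, VanishesBelow f (m + t)) : f = 0 := by
  ext n
  rw [h (n + 1 - m).toNat n (by omega)]
  simp

/-- The inverse is formed as a power series over the endomorphism ring. The recursion for its
coefficients keeps them of the shape `a σⁿ`, so the inverse stays in the subalgebra. -/
lemma isUnit_of_coeff_zero_eq_one {f : alg σ} (h0 : VanishesBelow f 0) (h1 : coeff 0 f = 1) :
    IsUnit f := by
  set p : PowerSeries (Module.End E F) := PowerSeries.mk fun n => (val f).coeff n with hp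
  have hfp : (val f) = HahnSeries.ofPowerSeries ℤ _ p := by
    ext1
    funext n
    obtain ⟨k, rfl | rfl⟩ := n.eq_nat_or_neg
    · rw [HahnSeries.ofPowerSeries_apply_coeff]
      simp [hp]
    · by_cases hk : k = 0
      · subst hk
        have := HahnSeries.ofPowerSeries_apply_coeff (Γ := ℤ) p 0
        simp only [Nat.cast_zero, neg_zero] at this ⊢
        rw [this]
        simp [hp]
      · rw [HahnSeries.ofPowerSeries_apply, HahnSeries.embDomain_of_notMem_range, coeff_def,
          h0 _ (by omega), twist_zero_right]
        rintro ⟨j, hj⟩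
        simp at hj
        omega
  have hc : PowerSeries.constantCoeff p = ((1 : (Module.End E F)ˣ) : Module.End E F) := by
    rw [← PowerSeries.coeff_zero_eq_constantCoeff_apply]
    simp only [hp, PowerSeries.coeff_mk, Nat.cast_zero, Units.val_one]
    rw [coeff_def, h1, twist_zero_one]
  set q := PowerSeries.invOfUnit p 1 with hq
  have hq1 : p * q = 1 := PowerSeries.mul_invOfUnit p 1 hc
  have hq2 : q * p = 1 := PowerSeries.invOfUnit_mul p 1 hc
  have hpc : ∀ n, PowerSeries.coeff n p = twist σ n (coeff n f) := fun n => by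
    simp [hp, coeff_def]
  have hqc : ∀ n : ℕ, ∃ a, PowerSeries.coeff n q = twist σ n a := by
    intro n
    induction n using Nat.strong_induction_on with
    | _ n ih =>
      by_cases hn : n = 0
      · subst hn
        refine ⟨1, ?_⟩
        rw [hq, PowerSeries.coeff_invOfUnit]
        simp [twist_zero_one]
      · choose! b hb using ih
        rw [hq, PowerSeries.coeff_invOfUnit, if_neg hn, ← hq]
        refine ⟨-∑ x ∈ Finset.HasAntidiagonal.antidiagonal n, if x.2 < n then
          coeff x.1 f * (σ ^ (x.1 : ℤ)) (b x.2) else 0, ?_⟩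
        have hneg : ∀ a, twist σ n (-a) = -twist σ n a := fun a => by ext; simp
        rw [hneg, twist_sum]
        have hs : ∀ x ∈ Finset.HasAntidiagonal.antidiagonal n,
            (if x.2 < n then PowerSeries.coeff x.1 p * PowerSeries.coeff x.2 q else 0) =
              twist σ n (if x.2 < n then coeff x.1 f * (σ ^ (x.1 : ℤ)) (b x.2) else 0) := by
          intro x hx
          split_ifs with hxn
          · rw [hpc, hb _ hxn, twist_mul]
            congr 1
            exact_mod_cast Finset.HasAntidiagonal.mem_antidiagonal.1 hx
          · rw [twist_zero_right]
        rw [Finset.sum_congr rfl hs, inv_one, Units.val_one]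
        ext y
        simp
  have hqmem : HahnSeries.ofPowerSeries ℤ _ q ∈ subalg σ := by
    intro n
    have : ∃ a, (HahnSeries.ofPowerSeries ℤ _ q).coeff n = twist σ n a := by
      by_cases hn : 0 ≤ n
      · lift n to ℕ using hn
        rw [HahnSeries.ofPowerSeries_apply_coeff]
        exact hqc n
      · refine ⟨0, ?_⟩
        rw [HahnSeries.ofPowerSeries_apply, HahnSeries.embDomain_of_notMem_range, twist_zero_right]
        rintro ⟨j, hj⟩
        simp at hj
        omega
    obtain ⟨a, ha⟩ := this
    rw [rawCoeff, ha]
    congr 1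
    simp
  refine ⟨⟨f, ⟨_, hqmem⟩, ?_, ?_⟩, rfl⟩
  · apply val_injective
    change (val f) * HahnSeries.ofPowerSeries ℤ _ q = 1
    rw [hfp, ← map_mul, hq1, map_one]
  · apply val_injective
    change HahnSeries.ofPowerSeries ℤ _ q * (val f) = 1
    rw [hfp, ← map_mul, hq2, map_one]

lemma isUnit_mono (n : ℤ) {a : F} (ha : a ≠ 0) : IsUnit (mono σ n a) := by
  have h (b : F) : (σ ^ n) ((σ ^ (-n)) b) = b := by
    rw [← AlgEquiv.mul_apply, ← zpow_add]; simp
  refine ⟨⟨mono σ n a, mono σ (-n) ((σ ^ (-n)) a⁻¹), ?_, ?_⟩, rfl⟩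
  · rw [mono_mul_mono, h, mul_inv_cancel₀ ha, add_neg_cancel, mono_zero_one]
  · rw [mono_mul_mono, ← map_mul, inv_mul_cancel₀ ha, neg_add_cancel, map_one, mono_zero_one]

/-- Dividing by the leading monomial, which is a unit, reduces to constant term one. -/
lemma isUnit_or_eq_zero (f : alg σ) : IsUnit f ∨ f = 0 := by
  by_cases hf : f = 0
  · exact Or.inr hf
  left
  obtain ⟨n, hn, hc⟩ := exists_order hf
  have hu := isUnit_mono (σ := σ) n hc
  obtain ⟨w, hw⟩ := hu
  have hw' : (w⁻¹ : (alg σ)ˣ).1 = mono σ (-n) ((σ ^ (-n)) (coeff n f)⁻¹) := by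
    rw [Units.inv_eq_of_mul_eq_one_left]
    rw [hw, mono_mul_mono, ← map_mul, inv_mul_cancel₀ hc, neg_add_cancel, map_one, mono_zero_one]
  have hv : VanishesBelow (w⁻¹.1 * f) 0 ∧ coeff 0 (w⁻¹.1 * f) = 1 := by
    have := coeff_mul (vanishesBelow_mono (σ := σ) (-n) ((σ ^ (-n)) (coeff n f)⁻¹)) hn
    rw [← hw', neg_add_cancel] at this
    refine ⟨this.1, ?_⟩
    rw [this.2, hw', coeff_mono_same, ← map_mul, inv_mul_cancel₀ hc, map_one]
  have := isUnit_of_coeff_zero_eq_one hv.1 hv.2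
  exact (Units.isUnit_units_mul _ _).1 this

instance : Nontrivial (alg σ) :=
  ⟨⟨mono σ 0 1, 0, fun h => by
    have := congrArg (coeff 0) h
    rw [coeff_mono_same] at this
    simp at this⟩⟩

instance : DivisionRing (alg σ) := DivisionRing.ofIsUnitOrEqZero isUnit_or_eq_zero

end Construction

end SkewLaurent

/-! ### Centralizers and transcendence in the skew Laurent series. -/

namespace SkewLaurent

section Centralizers

variable {E F : Type*} [Field E] [Field F] [Algebra E F] {σ : F ≃ₐ[E] F}

/-- `f` has order `n`. -/
def IsOrder (f : alg σ) (n : ℤ) : Prop := VanishesBelow f n ∧ coeff n f ≠ 0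

lemma IsOrder.ne_zero {f : alg σ} {n : ℤ} (h : IsOrder f n) : f ≠ 0 := by
  rintro rfl
  exact h.2 (map_zero _)

lemma IsOrder.unique {f : alg σ} {m n : ℤ} (h : IsOrder f m) (h' : IsOrder f n) : m = n :=
  le_antisymm (not_lt.1 fun hlt => h'.2 (h.1 _ hlt)) (not_lt.1 fun hlt => h.2 (h'.1 _ hlt))

lemma IsOrder.mul {f g : alg σ} {m n : ℤ} (hf : IsOrder f m) (hg : IsOrder g n) :
    IsOrder (f * g) (m + n) := by
  refine ⟨(coeff_mul hf.1 hg.1).1, ?_⟩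
  rw [(coeff_mul hf.1 hg.1).2]
  exact mul_ne_zero hf.2 (by simpa using hg.2)

lemma isOrder_mono (n : ℤ) {a : F} (ha : a ≠ 0) : IsOrder (mono σ n a) n :=
  ⟨vanishesBelow_mono n a, by rwa [coeff_mono_same]⟩

lemma isOrder_one : IsOrder (1 : alg σ) 0 := by
  rw [← mono_zero_one]
  exact isOrder_mono 0 one_ne_zero

lemma IsOrder.pow {f : alg σ} {n : ℤ} (hf : IsOrder f n) (k : ℕ) : IsOrder (f ^ k) (k * n) := by
  induction k with
  | zero => simpa using isOrder_one
  | succ k ih =>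
    rw [pow_succ]
    convert ih.mul hf using 1
    push_cast; ring

lemma IsOrder.inv {f : alg σ} {n : ℤ} (hf : IsOrder f n) : IsOrder f⁻¹ (-n) := by
  obtain ⟨m, hm⟩ := exists_order (inv_ne_zero hf.ne_zero)
  have h1 := hf.mul hm
  rw [mul_inv_cancel₀ hf.ne_zero] at h1
  have := h1.unique isOrder_one
  obtain rfl : m = -n := by omega
  exact hm

lemma IsOrder.zpow {f : alg σ} {n : ℤ} (hf : IsOrder f n) (k : ℤ) : IsOrder (f ^ k) (k * n) := by
  obtain ⟨j, rfl | rfl⟩ := k.eq_nat_or_neg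
  · simpa using hf.pow j
  · rw [zpow_neg, zpow_natCast]
    convert (hf.pow j).inv using 1
    ring

/-- The term of least order cannot be cancelled by the others. -/
lemma sum_ne_zero_of_isOrder {ι : Type*} {s : Finset ι} (hs : s.Nonempty) {f : ι → alg σ}
    {n : ι → ℤ} (hf : ∀ i ∈ s, IsOrder (f i) (n i)) (hn : Set.InjOn n s) :
    ∑ i ∈ s, f i ≠ 0 := by
  classical
  obtain ⟨i, hi, hmin⟩ := s.exists_min_image n hs
  intro h
  have := congrArg (coeff (n i)) h
  rw [map_sum, Finset.sum_eq_single_of_mem i hi, map_zero] at this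
  · exact (hf i hi).2 this
  · intro j hj hne
    exact (hf j hj).1 _ (lt_of_le_of_ne (hmin j hj) fun h => hne (hn hj hi h.symm))

lemma zpow_apply_of_fixed {a : F} (ha : σ a = a) (n : ℤ) : (σ ^ n) a = a :=
  (MulAction.stabilizer (F ≃ₐ[E] F) a).zpow_mem (x := σ) ha n

lemma commute_mono_zero {a : F} (ha : σ a = a) (f : alg σ) : Commute (mono σ 0 a) f := by
  ext n
  rw [coeff_mono_mul, coeff_mul_mono, sub_zero, zpow_apply_of_fixed ha, mul_comm]
  simp

/-- `σ` acts on `F` with all nontrivial powers having the same fixed field as `σ`. -/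
def FixedByPowers (σ : F ≃ₐ[E] F) : Prop :=
  ∀ (m : ℤ) (a : F), m ≠ 0 → (σ ^ m) a = a → σ a = a

/-- Comparing leading coefficients in `a e = e a` gives `aₙ σⁿ(e₀) = e₀ aₙ`, so `e₀` is fixed by
`σⁿ`, and hence by `σ`. -/
lemma fixed_of_commute (hσ : FixedByPowers σ) {a e : alg σ} {n : ℤ} (ha : IsOrder a n)
    (hn : n ≠ 0) (he : VanishesBelow e 0) (h : Commute a e) :
    σ (coeff 0 e) = coeff 0 e := by
  refine hσ n _ hn ?_
  have h1 := (coeff_mul ha.1 he).2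
  have h2 := (coeff_mul he ha.1).2
  rw [h.eq, add_zero] at h1
  rw [zero_add, h1, zpow_zero, AlgEquiv.one_apply, mul_comm] at h2
  exact mul_right_cancel₀ ha.2 h2

/-- Successive approximation: each step replaces `b` by `b - κ u ^ q`, which raises its order
without changing its commutator with `c`. That commutator therefore vanishes to every order. -/
lemma commute_of_approximation {a u c : alg σ}
    (happ : ∀ (n : ℤ) (b : alg σ), Commute a b → VanishesBelow b n →
      ∃ κ, σ κ = κ ∧ ∃ q : ℤ, VanishesBelow (b - mono σ 0 κ * u ^ q) (n + 1))
    (hau : Commute a u) (hcu : Commute c u) {b : alg σ} (hab : Commute a b) : Commute c b := by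
  obtain ⟨r, hr⟩ := exists_vanishesBelow c
  have key : ∀ (t : ℕ) (n : ℤ) (b : alg σ), Commute a b → VanishesBelow b n →
      VanishesBelow (c * b - b * c) (r + n + t) := by
    intro t
    induction t with
    | zero =>
      intro n b _ hb
      have h2 := (coeff_mul hb hr).1
      rw [add_comm] at h2
      simpa using (coeff_mul hr hb).1.sub h2
    | succ t ih =>
      intro n b hab hb
      obtain ⟨κ, hκ, q, hq⟩ := happ n b hab hb
      have hcomm : ∀ d, Commute d u → Commute d (mono σ 0 κ * u ^ q) := fun d hd =>
        (commute_mono_zero hκ d).symm.mul_right (hd.zpow_right₀ q)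
      have := ih (n + 1) _ (hab.sub_right (hcomm a hau)) hq
      rw [mul_sub, sub_mul, (hcomm c hcu).eq, sub_sub_sub_cancel_right] at this
      convert this using 1
      push_cast; ring
  obtain ⟨n, hn⟩ := exists_vanishesBelow b
  exact sub_eq_zero.1 (eq_zero_of_forall_vanishesBelow _ fun t => key t n b hab hn)

/-- Choose `u` in the centralizer of `a` of least positive order `d`. Division with remainder shows
that `d` divides every order in the centralizer, and the quotient by a power of `u` has a fixed
leading coefficient. The centralizer thus consists of series in `u` with central coefficients. -/
lemma commute_of_order_ne_zero (hσ : FixedByPowers σ) {a : alg σ} {n : ℤ} (ha : IsOrder a n)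
    (hn : n ≠ 0) {b c : alg σ} (hb : Commute a b) (hc : Commute a c) : Commute b c := by
  classical
  have hex : ∃ d : ℕ, 0 < d ∧ ∃ u, Commute a u ∧ IsOrder u d := by
    rcases hn.lt_or_gt with h | h
    · refine ⟨(-n).toNat, by omega, a⁻¹, (Commute.refl a).inv_right₀, ?_⟩
      convert ha.inv using 1
      omega
    · refine ⟨n.toNat, by omega, a, Commute.refl a, ?_⟩
      convert ha using 1
      omega
  obtain ⟨hd, u, hau, hu⟩ := Nat.find_spec hex
  set d := Nat.find hex with hddef
  have hmin : ∀ k : ℤ, 0 < k → k < d → ∀ v, Commute a v → ¬ IsOrder v k := by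
    intro k hk hkd v hv hvo
    refine Nat.find_min hex (m := k.toNat) (by omega) ⟨by omega, v, hv, ?_⟩
    convert hvo using 1
    omega
  have happ : ∀ (n : ℤ) (b : alg σ), Commute a b → VanishesBelow b n →
      ∃ κ, σ κ = κ ∧ ∃ q : ℤ, VanishesBelow (b - mono σ 0 κ * u ^ q) (n + 1) := by
    intro m b hab hb
    by_cases h0 : coeff m b = 0
    · refine ⟨0, map_zero σ, 0, ?_⟩
      have h00 : mono σ 0 0 = 0 := by ext k; simp [coeff_mono]
      rw [h00, zero_mul, sub_zero]
      intro i hi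
      rcases (Int.lt_add_one_iff.1 hi).lt_or_eq with h | rfl
      · exact hb i h
      · exact h0
    have hbo : IsOrder b m := ⟨hb, h0⟩
    set q := m / d with hq
    set e := b * u ^ (-q) with he
    have hae : Commute a e := hab.mul_right (hau.zpow_right₀ _)
    have heo : IsOrder e (m % d) := by
      convert hbo.mul (hu.zpow (-q)) using 1
      have := Int.emod_add_mul_ediv m d
      rw [← hq] at this
      linarith [mul_comm (d : ℤ) q]
    have hm0 : m % d = 0 := by
      by_contra hne
      have h1 := Int.emod_nonneg m (b := d) (by omega)
      exact hmin _ (by omega) (Int.emod_lt_of_pos m (by omega)) e hae heo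
    rw [hm0] at heo
    have hfix := fixed_of_commute hσ ha hn heo.1 hae
    refine ⟨coeff 0 e, hfix, q, ?_⟩
    have hbe : b - mono σ 0 (coeff 0 e) * u ^ q = (e - mono σ 0 (coeff 0 e)) * u ^ q := by
      rw [sub_mul, he, mul_assoc, ← zpow_add₀ hu.ne_zero, neg_add_cancel, zpow_zero, mul_one]
    have hve : VanishesBelow (e - mono σ 0 (coeff 0 e)) 1 := by
      intro i hi
      rw [map_sub, coeff_mono]
      split_ifs with h
      · rw [h, sub_self]
      · rw [heo.1 i (by omega), sub_zero]
    rw [hbe]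
    convert (coeff_mul hve (hu.zpow q).1).1 using 1
    have := Int.emod_add_mul_ediv m d
    rw [← hq, hm0] at this
    linarith [mul_comm (d : ℤ) q]
  -- The approximation is used twice: with `u` itself in the role of `c`, which shows that `u`
  -- commutes with the whole centralizer, and then with an arbitrary element of the centralizer.
  have huall : ∀ b, Commute a b → Commute u b := fun b hb =>
    commute_of_approximation happ hau (Commute.refl u) hb
  exact commute_of_approximation happ hau (huall b hb).symm hc

/-- Every noncentral element is, up to a central summand, of nonzero order or of order zero with
leading coefficient not fixed by `σ`. -/
lemma exists_normalization {a : alg σ} (ha : ¬ ∀ f, Commute a f) :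
    ∃ κ : F, σ κ = κ ∧ ∃ n, IsOrder (a - mono σ 0 κ) n ∧
      (n = 0 → σ (coeff 0 (a - mono σ 0 κ)) ≠ coeff 0 (a - mono σ 0 κ)) := by
  have h00 : mono σ 0 0 = 0 := by ext k; simp [coeff_mono]
  have hne : ∀ κ, σ κ = κ → a - mono σ 0 κ ≠ 0 := fun κ hκ h => ha fun f => by
    rw [sub_eq_zero.1 h]; exact commute_mono_zero hκ f
  obtain ⟨n, hn⟩ := exists_order (by simpa [h00] using hne 0 (map_zero σ))
  by_cases h : n = 0 ∧ σ (coeff 0 a) = coeff 0 a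
  · obtain ⟨rfl, h⟩ := h
    obtain ⟨m, hm⟩ := exists_order (hne _ h)
    refine ⟨_, h, m, hm, ?_⟩
    rintro rfl
    exact absurd (by rw [map_sub, coeff_mono_same, sub_self]) hm.2
  · refine ⟨0, map_zero σ, n, ?_, ?_⟩
    · rw [h00, sub_zero]; exact hn
    · rw [h00, sub_zero]
      exact fun h0 h1 => h ⟨h0, h1⟩

/-- Noncentral skew Laurent series have commutative centralizers. -/
theorem commute_of_commute (hσ : FixedByPowers σ) {a : alg σ} (ha : ¬ ∀ f, Commute a f)
    {b c : alg σ} (hb : Commute a b) (hc : Commute a c) : Commute b c := by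
  obtain ⟨κ, hκ, n, hn, h0⟩ := exists_normalization ha
  have hb' := hb.sub_left (commute_mono_zero hκ b)
  have hc' := hc.sub_left (commute_mono_zero hκ c)
  generalize a - mono σ 0 κ = a' at hn h0 hb' hc'
  by_cases hn0 : n = 0
  swap
  · exact commute_of_order_ne_zero hσ hn hn0 hb' hc'
  subst hn0
  -- Order zero with a leading coefficient not fixed by `σ`: everything that commutes with `a'` then
  -- has order zero. This applies to the commutator of `b` and `c`, whose constant coefficient
  -- vanishes because `F` is commutative.
  have hord : ∀ g, Commute a' g → ∀ m, IsOrder g m → m = 0 := by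
    intro g hg m hm
    by_contra hm0
    refine h0 rfl (hσ m _ hm0 ?_)
    have h1 := (coeff_mul hn.1 hm.1).2
    have h2 := (coeff_mul hm.1 hn.1).2
    rw [hg.eq, zero_add, zpow_zero, AlgEquiv.one_apply] at h1
    rw [add_zero, h1, mul_comm] at h2
    exact (mul_left_cancel₀ hm.2 h2).symm
  have hvan : ∀ g, Commute a' g → VanishesBelow g 0 := by
    intro g hg
    by_cases h : g = 0
    · subst h; intro i _; simp
    · obtain ⟨m, hm⟩ := exists_order h
      have := hord g hg m hm
      subst this
      exact hm.1
  have hcomm : Commute a' (b * c - c * b) :=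
    (hb'.mul_right hc').sub_right (hc'.mul_right hb')
  refine sub_eq_zero.1 (by_contra fun hne => ?_)
  obtain ⟨m, hm⟩ := exists_order hne
  have := hord _ hcomm m hm
  subst this
  apply hm.2
  have h1 := (coeff_mul (hvan b hb') (hvan c hc')).2
  have h2 := (coeff_mul (hvan c hc') (hvan b hb')).2
  rw [zero_add, zpow_zero, AlgEquiv.one_apply] at h1 h2
  rw [map_sub, h1, h2, mul_comm, sub_self]

/-- Commuting with `h` kills every coefficient of nonzero degree, as `σ ^ m` moves `h`; commuting
with `X` makes the remaining coefficient fixed. -/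
lemma eq_mono_zero_of_commute {h : F} (hh : ∀ m : ℤ, m ≠ 0 → (σ ^ m) h ≠ h) {z : alg σ}
    (hz : Commute z (mono σ 0 h)) (hz' : Commute z (mono σ 1 1)) :
    σ (coeff 0 z) = coeff 0 z ∧ z = mono σ 0 (coeff 0 z) := by
  constructor
  · have := congrArg (coeff 1) hz'.eq
    rw [coeff_mul_mono, coeff_mono_mul] at this
    simpa using this.symm
  · ext n
    rw [coeff_mono]
    split_ifs with hn
    · rw [hn]
    · have := congrArg (coeff n) hz.eq
      rw [coeff_mul_mono, coeff_mono_mul, sub_zero, zpow_zero, AlgEquiv.one_apply,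
        mul_comm] at this
      by_contra hne
      exact hh n hn (mul_right_cancel₀ hne this)

lemma central_eq_mono {h : F} (hh : ∀ m : ℤ, m ≠ 0 → (σ ^ m) h ≠ h)
    (z : Subring.center (alg σ)) :
    σ (coeff 0 z.1) = coeff 0 z.1 ∧ z.1 = mono σ 0 (coeff 0 z.1) :=
  eq_mono_zero_of_commute hh ((Subring.mem_center_iff.1 z.2 _).symm)
    ((Subring.mem_center_iff.1 z.2 _).symm)

/-- The map from the centre to the fixed elements of the coefficient field. -/
def centerCoeff {h : F} (hh : ∀ m : ℤ, m ≠ 0 → (σ ^ m) h ≠ h) :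
    Subring.center (alg σ) →+* F where
  toFun z := coeff 0 z.1
  map_one' := by
    change coeff 0 (1 : alg σ) = 1
    rw [← mono_zero_one, coeff_mono_same]
  map_zero' := map_zero _
  map_add' x y := map_add _ _ _
  map_mul' x y := by
    have hx := (central_eq_mono hh x).2
    change coeff 0 (x.1 * y.1) = _
    rw [hx, coeff_mono_mul, coeff_mono_same]
    simp

lemma centerCoeff_injective {h : F} (hh : ∀ m : ℤ, m ≠ 0 → (σ ^ m) h ≠ h) :
    Function.Injective (centerCoeff hh) := by
  intro x y hxy
  apply Subtype.ext
  rw [(central_eq_mono hh x).2, (central_eq_mono hh y).2]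
  exact congrArg _ hxy

open Polynomial in
/-- Noncentral skew Laurent series are transcendental over the centre. -/
theorem transcendental_of_not_central (hσ : FixedByPowers σ) {h : F}
    (hh : ∀ m : ℤ, m ≠ 0 → (σ ^ m) h ≠ h) {a : alg σ} (ha : ¬ ∀ f, Commute a f) :
    Transcendental (Subring.center (alg σ)) a := by
  obtain ⟨κ, hκ, n, hn, h0⟩ := exists_normalization ha
  have hκc : mono σ 0 κ ∈ Subring.center (alg σ) :=
    Subring.mem_center_iff.2 fun b => (commute_mono_zero hκ b).eq.symm
  rw [transcendental_iff]
  intro p hp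
  -- Passing from `a` to `a - κ` is a Taylor shift of the polynomial, which is injective.
  have hq : aeval (a - mono σ 0 κ) (taylor (⟨mono σ 0 κ, hκc⟩ : Subring.center (alg σ)) p)
      = 0 := by
    rw [taylor_apply, aeval_comp]
    have h1 : aeval (a - mono σ 0 κ) (X + C (⟨mono σ 0 κ, hκc⟩ : Subring.center (alg σ))) = a := by
      rw [map_add, aeval_X, aeval_C]
      exact sub_add_cancel _ _
    rw [h1, hp]
  refine taylor_injective (⟨mono σ 0 κ, hκc⟩ : Subring.center (alg σ)) ?_
  rw [map_zero]
  generalize taylor (⟨mono σ 0 κ, hκc⟩ : Subring.center (alg σ)) p = q at hq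
  generalize a - mono σ 0 κ = b at hn h0 hq
  rw [aeval_eq_sum_range' (n := q.natDegree + 1) (Nat.lt_succ_self _)] at hq
  by_cases hn0 : n = 0
  -- In order zero the leading coefficient of `b` is a root of `q`, read over the fixed elements. So
  -- are its translates under the powers of `σ`, which are infinitely many.
  · subst hn0
    have hpow : ∀ i : ℕ, coeff 0 (b ^ i) = coeff 0 b ^ i ∧ VanishesBelow (b ^ i) 0 := by
      intro i
      have hv : ∀ i : ℕ, VanishesBelow (b ^ i) 0 := fun i => by simpa using (hn.pow i).1
      refine ⟨?_, hv i⟩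
      induction i with
      | zero => rw [pow_zero, pow_zero, ← mono_zero_one, coeff_mono_same]
      | succ i ih =>
        have := (coeff_mul (hv i) hn.1).2
        rw [zero_add, zpow_zero, AlgEquiv.one_apply, ih] at this
        rw [pow_succ, pow_succ, this]
    have heval : (q.map (centerCoeff hh)).eval (coeff 0 b) = 0 := by
      rw [eval_map, eval₂_eq_sum_range, ← map_zero (coeff (σ := σ) 0), ← hq, map_sum]
      refine Finset.sum_congr rfl fun i _ => ?_
      rw [Subring.smul_def, smul_eq_mul, (central_eq_mono hh (q.coeff i)).2, coeff_mono_mul, sub_zero, (hpow i).1]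
      simp [centerCoeff]
    have hroot : ∀ m : ℕ, (q.map (centerCoeff hh)).IsRoot ((σ ^ (m : ℤ)) (coeff 0 b)) := by
      intro m
      have := congrArg (σ ^ (m : ℤ)) heval
      rw [map_zero, eval_map, eval₂_eq_sum_range, map_sum] at this
      rw [IsRoot, eval_map, eval₂_eq_sum_range, ← this]
      refine Finset.sum_congr rfl fun i _ => ?_
      rw [map_mul, map_pow]
      congr 1
      exact (zpow_apply_of_fixed (central_eq_mono hh _).1 _).symm
    have hinj : Function.Injective fun m : ℕ => (σ ^ (m : ℤ)) (coeff 0 b) := by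
      intro i j hij
      by_contra hne
      refine h0 rfl (hσ (i - j) _ (by omega) ?_)
      have := congrArg (σ ^ (-j : ℤ)) hij
      simp only [← AlgEquiv.mul_apply, ← zpow_add] at this
      rw [neg_add_cancel, zpow_zero, AlgEquiv.one_apply] at this
      rw [← this]
      congr 2
      ring
    have hz := eq_zero_of_infinite_isRoot _
      ((Set.infinite_range_of_injective hinj).mono (by rintro _ ⟨m, rfl⟩; exact hroot m))
    exact (Polynomial.map_eq_zero_iff (centerCoeff_injective hh)).1 hz
  -- In order `n ≠ 0` the terms of the relation have the distinct orders `i * n`.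
  · by_contra hq0
    have hsupp : ∑ i ∈ q.support, q.coeff i • b ^ i = 0 := by
      rw [← hq]
      refine Finset.sum_subset (fun i hi => Finset.mem_range.2
        (Nat.lt_succ_of_le (le_natDegree_of_mem_supp i hi))) fun i _ hi => ?_
      rw [notMem_support_iff.1 hi, zero_smul]
    refine sum_ne_zero_of_isOrder (σ := σ) (nonempty_support_iff.2 hq0) (n := fun i => i * n)
      (fun i hi => ?_) (fun i _ j _ hij => ?_) hsupp
    · rw [Subring.smul_def, smul_eq_mul, (central_eq_mono hh (q.coeff i)).2]
      have hc : coeff 0 (q.coeff i).1 ≠ 0 := fun hc =>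
        mem_support_iff.1 hi (centerCoeff_injective hh (by rw [map_zero]; exact hc))
      simpa using (isOrder_mono (σ := σ) 0 hc).mul (hn.pow i)
    · exact_mod_cast mul_right_cancel₀ hn0 hij

end Centralizers

end SkewLaurent

/-! ### Linear independence over subrings of a division ring. -/

namespace DixmierTypes

section Independence

variable {D : Type*} [DivisionRing D]

/-- The family `w` is left linearly independent over the subring `P`. -/
def Indep (P : Subring D) {ι : Type*} (w : ι → D) : Prop :=
  ∀ (s : Finset ι) (c : ι → D), (∀ i, c i ∈ P) → ∑ i ∈ s, c i * w i = 0 → ∀ i ∈ s, c i = 0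

/-- The tower law for bases, for noncommuting coefficients: the `u i` must lie in the larger ring
`Q`, so that they can be absorbed into the coefficients of the `w j`. -/
lemma Indep.mul {P Q : Subring D} (hPQ : P ≤ Q) {ι κ : Type*} {u : ι → D} {w : κ → D}
    (hu : ∀ i, u i ∈ Q) (hPu : Indep P u) (hQw : Indep Q w) :
    Indep P fun q : ι × κ => u q.1 * w q.2 := by
  classical
  intro s c hc hsum
  -- Extension by zero turns the sum over `s` into one over a full rectangle, which can be
  -- regrouped.
  set c' : ι × κ → D := fun q => if q ∈ s then c q else 0 with hc'
  have hc'P : ∀ q, c' q ∈ P := fun q => by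
    simp only [hc']; split_ifs
    · exact hc q
    · exact P.zero_mem
  have h1 : ∑ j ∈ s.image Prod.snd, (∑ i ∈ s.image Prod.fst, c' (i, j) * u i) * w j = 0 := by
    rw [← hsum]
    simp only [Finset.sum_mul]
    rw [Finset.sum_comm, ← Finset.sum_product']
    symm
    have hsub : s ⊆ s.image Prod.fst ×ˢ s.image Prod.snd := Finset.subset_product
    rw [← Finset.sum_subset hsub]
    · exact Finset.sum_congr rfl fun q hq => by simp [hc', hq, mul_assoc]
    · intro q _ hq
      simp [hc', hq]
  have h2 := hQw _ _ (fun j => Q.sum_mem fun i _ => Q.mul_mem (hPQ (hc'P (i, j))) (hu i)) h1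
  intro q hq
  have h3 := hPu _ (fun i => c' (i, q.2)) (fun i => hc'P _)
    (h2 q.2 (Finset.mem_image_of_mem _ hq)) q.1 (Finset.mem_image_of_mem _ hq)
  simpa [hc', hq] using h3

lemma indep_pow_of_transcendental {R : Type*} [CommRing R] [Algebra R D] {a : D}
    (ha : Transcendental R a) : Indep (algebraMap R D).range fun i : ℕ => a ^ i := by
  intro s c hc hsum
  choose r hr using hc
  rw [transcendental_iff] at ha
  have := ha (∑ i ∈ s, Polynomial.monomial i (r i)) (by
    rw [map_sum, ← hsum]
    exact Finset.sum_congr rfl fun i _ => by rw [Polynomial.aeval_monomial, hr])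
  intro i hi
  have h2 := congrArg (fun p => Polynomial.coeff p i) this
  simp only [Polynomial.finsetSum_coeff, Polynomial.coeff_monomial, Polynomial.coeff_zero] at h2
  rw [Finset.sum_ite_eq' s i, if_pos hi] at h2
  rw [← hr, h2, map_zero]

lemma range_algebraMap_center : (algebraMap (Subring.center D) D).range = Subring.center D := by
  ext x
  exact ⟨fun ⟨y, hy⟩ => hy ▸ y.2, fun hx => ⟨⟨x, hx⟩, rfl⟩⟩

section Operators

variable {E : Type*} [Field E] [Algebra E D]

-- Generalized eigenvectors of a `P`-linear operator are independent over `P` when their pairs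
-- (eigenvalue, exact height) differ. A polynomial in `T` isolates one term: it kills the other
-- eigenvalues completely and lowers the chosen one to height zero.
open Polynomial in
lemma indep_of_heights (T : Module.End E D) {P : Subring D}
    (hT : ∀ f ∈ P, ∀ x, T (f * x) = f * T x) {ι : Type*} {w : ι → D} {κ : ι → E} {h : ι → ℕ}
    (hinj : Function.Injective fun i => (κ i, h i))
    (hne : ∀ i, aeval T ((X - C (κ i)) ^ h i) (w i) ≠ 0)
    (hz : ∀ i, aeval T ((X - C (κ i)) ^ (h i + 1)) (w i) = 0) : Indep P w := by
  classical
  intro s c hc hsum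
  by_contra! hcon
  set s' := s.filter fun i => c i ≠ 0 with hs'
  have hs'ne : s'.Nonempty := by
    obtain ⟨i, hi, hci⟩ := hcon
    exact ⟨i, Finset.mem_filter.2 ⟨hi, hci⟩⟩
  have hsum' : ∑ i ∈ s', c i * w i = 0 := by
    rw [← hsum]
    refine Finset.sum_subset (Finset.filter_subset _ _) fun i hi hi' => ?_
    have : c i = 0 := by
      by_contra h0
      exact hi' (Finset.mem_filter.2 ⟨hi, h0⟩)
    rw [this, zero_mul]
  -- With `h i₀` maximal, the other terms with the same eigenvalue have strictly smaller height, so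
  -- the factor `(X - C (κ i₀)) ^ h i₀` kills them.
  obtain ⟨i₀, hi₀, hmax⟩ := s'.exists_max_image h hs'ne
  set r : E[X] := ∏ j ∈ s'.filter (fun j => κ j ≠ κ i₀), (X - C (κ j)) ^ (h j + 1) with hr
  set p : E[X] := r * (X - C (κ i₀)) ^ h i₀ with hp
  have hlin : ∀ (q : E[X]) (f : D), f ∈ P → ∀ x, aeval T q (f * x) = f * aeval T q x := by
    intro q f hf
    induction q using Polynomial.induction_on' with
    | add p q hp hq => intro x; simp [hp, hq, mul_add]
    | monomial n e =>
      intro x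
      rw [aeval_monomial]
      have : ∀ (n : ℕ) x, (T ^ n) (f * x) = f * (T ^ n) x := by
        intro n
        induction n with
        | zero => simp
        | succ n ih => intro x; rw [pow_succ, Module.End.mul_apply, hT f hf, ih]; rfl
      simp [this, Algebra.algebraMap_eq_smul_one]
  have hkill : ∀ j ∈ s', j ≠ i₀ → aeval T p (w j) = 0 := by
    intro j hj hne'
    have hdvd : (X - C (κ j)) ^ (h j + 1) ∣ p := by
      by_cases hκ : κ j = κ i₀
      · rw [hκ]
        refine Dvd.dvd.mul_left (pow_dvd_pow _ ?_) _
        have h1 := hmax j hj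
        have h2 : h j ≠ h i₀ := fun h2 => hne' (hinj (Prod.ext hκ h2))
        omega
      · exact Dvd.dvd.mul_right
          (Finset.dvd_prod_of_mem (fun j => (X - C (κ j)) ^ (h j + 1))
            (Finset.mem_filter.2 ⟨hj, hκ⟩)) _
    obtain ⟨q, hq⟩ := hdvd
    rw [hq, mul_comm, map_mul, Module.End.mul_apply, hz, map_zero]
  have heig : aeval T p (w i₀) = r.eval (κ i₀) • aeval T ((X - C (κ i₀)) ^ h i₀) (w i₀) := by
    rw [hp, map_mul, Module.End.mul_apply]
    have hev : Module.End.HasEigenvector T (κ i₀)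
        (aeval T ((X - C (κ i₀)) ^ h i₀) (w i₀)) := by
      refine ⟨Module.End.mem_eigenspace_iff.2 (sub_eq_zero.1 ?_), hne i₀⟩
      rw [← hz i₀, pow_succ', map_mul, Module.End.mul_apply]
      simp [Algebra.algebraMap_eq_smul_one]
    exact Module.End.aeval_apply_of_hasEigenvector hev
  have hfin := congrArg (aeval T p) hsum'
  rw [map_zero, map_sum, Finset.sum_eq_single_of_mem i₀ hi₀ fun j hj hne' => by
    rw [hlin _ _ (hc j), hkill j hj hne', mul_zero], hlin _ _ (hc i₀), heig] at hfin
  have hreval : r.eval (κ i₀) ≠ 0 := by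
    rw [hr, eval_prod]
    refine Finset.prod_ne_zero_iff.2 fun j hj => ?_
    rw [eval_pow]
    refine pow_ne_zero _ ?_
    simpa [sub_eq_zero] using (Finset.mem_filter.1 hj).2.symm
  exact mul_ne_zero (Finset.mem_filter.1 hi₀).2 (smul_ne_zero hreval (hne i₀)) hfin

end Operators

/-- Dedekind's independence of characters: the `w i` act by distinct conjugations on the commutative
centralizer of `b`, and they are semilinear with respect to these. -/
lemma indep_of_distinct_conjugations {b : D}
    (hb : ∀ f g, Commute b f → Commute b g → Commute f g) {ι : Type*} {w : ι → D}
    (hw : ∀ i, w i ≠ 0) (hnorm : ∀ i f, Commute b f → Commute b (w i * f * (w i)⁻¹))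
    (hdist : ∀ i j, (∀ f, Commute b f → w i * f * (w i)⁻¹ = w j * f * (w j)⁻¹) → i = j) :
    Indep (Subring.centralizer {b}) w := by
  classical
  have hmem : ∀ {x : D}, x ∈ Subring.centralizer {b} ↔ Commute b x := by
    intro x
    rw [Subring.mem_centralizer_iff]
    simp [Commute, SemiconjBy]
  intro s
  induction s using Finset.induction_on with
  | empty => intro c _ _ i hi; simp at hi
  | insert i₀ s hi₀ ih =>
    intro c hc hsum
    have hzero : ∀ i ∈ s, c i = 0 := by
      intro i hi
      obtain ⟨g, hg, hne⟩ : ∃ g, Commute b g ∧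
          w i * g * (w i)⁻¹ ≠ w i₀ * g * (w i₀)⁻¹ := by
        by_contra! hcon
        exact hi₀ (hdist i i₀ hcon ▸ hi)
      -- The relation multiplied by `g` on the right, minus its left multiple by the conjugate of
      -- `g` under `w i₀`. The term of `i₀` drops out, and the new coefficients still commute with
      -- `b`.
      have hrel : ∑ i ∈ s, (c i * (w i * g * (w i)⁻¹ - w i₀ * g * (w i₀)⁻¹)) * w i = 0 := by
        have hterm : ∀ i, (c i * (w i * g * (w i)⁻¹ - w i₀ * g * (w i₀)⁻¹)) * w i =
            c i * w i * g - w i₀ * g * (w i₀)⁻¹ * (c i * w i) := by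
          intro i
          have h1 := (hb _ _ (hmem.1 (hc i)) (hnorm i₀ g hg)).eq
          rw [mul_sub, sub_mul, h1]
          congr 1
          · simp only [mul_assoc]
            rw [inv_mul_cancel₀ (hw i), mul_one]
          · simp only [mul_assoc]
        have h2 : ∑ i ∈ insert i₀ s,
            (c i * (w i * g * (w i)⁻¹ - w i₀ * g * (w i₀)⁻¹)) * w i = 0 := by
          simp only [hterm, Finset.sum_sub_distrib, ← Finset.sum_mul, ← Finset.mul_sum]
          rw [hsum, zero_mul, mul_zero, sub_zero]
        rw [Finset.sum_insert hi₀, sub_self, mul_zero, zero_mul, zero_add] at h2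
        exact h2
      have := ih _ (fun i => (Subring.centralizer {b}).mul_mem (hc i)
        ((Subring.centralizer {b}).sub_mem (hmem.2 (hnorm i g hg)) (hmem.2 (hnorm i₀ g hg))))
        hrel i hi
      exact (mul_eq_zero.1 this).resolve_right (sub_ne_zero.2 hne)
    have h0 : c i₀ = 0 := by
      rw [Finset.sum_insert hi₀, Finset.sum_eq_zero fun i hi => by rw [hzero i hi, zero_mul],
        add_zero] at hsum
      exact (mul_eq_zero.1 hsum).resolve_right (hw i₀)
    intro i hi
    rcases Finset.mem_insert.1 hi with rfl | hi
    · exact h0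
    · exact hzero i hi

end Independence

/-! ### A lower bound for the Gelfand-Kirillov dimension. -/

section Growth

variable {K E A : Type*} [Field K] [Field E] [Algebra K E] [Ring A] [Algebra K A]

lemma exists_fg_mem_baseChange (t : E ⊗[K] A) :
    ∃ V : Submodule K A, V.FG ∧ t ∈ V.baseChange E := by
  induction t using TensorProduct.induction_on with
  | zero => exact ⟨⊥, Submodule.fg_bot, Submodule.zero_mem _⟩
  | tmul e a =>
    exact ⟨Submodule.span K {a}, Submodule.fg_span_singleton a,
      Submodule.tmul_mem_baseChange_of_mem e (Submodule.mem_span_singleton_self a)⟩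
  | add x y hx hy =>
    obtain ⟨V, hV, hx⟩ := hx
    obtain ⟨W, hW, hy⟩ := hy
    exact ⟨V ⊔ W, hV.sup hW, Submodule.add_mem _ (Submodule.baseChange_mono _ le_sup_left hx)
      (Submodule.baseChange_mono _ le_sup_right hy)⟩

lemma mul_mem_baseChange {P Q : Submodule K A} {x y : E ⊗[K] A} (hx : x ∈ P.baseChange E)
    (hy : y ∈ Q.baseChange E) : x * y ∈ (P * Q).baseChange E := by
  rw [Submodule.baseChange_eq_span] at hx hy
  have hP : ∀ x ∈ (P.map (TensorProduct.mk K E A 1) : Set (E ⊗[K] A)),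
      ∀ y ∈ (Q.map (TensorProduct.mk K E A 1) : Set (E ⊗[K] A)),
        x * y ∈ (P * Q).baseChange E := by
    rintro _ ⟨p, hp, rfl⟩ _ ⟨q, hq, rfl⟩
    simp only [TensorProduct.mk_apply, Algebra.TensorProduct.tmul_mul_tmul, mul_one]
    exact Submodule.tmul_mem_baseChange_of_mem _ (Submodule.mul_mem_mul hp hq)
  have := Submodule.mul_mem_mul hx hy
  rw [Submodule.span_mul_span] at this
  refine Submodule.span_le.2 ?_ this
  rintro _ ⟨x, hx, y, hy, rfl⟩
  exact hP x hx y hy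

lemma pow_mem_baseChange {V : Submodule K A} {x : E ⊗[K] A} (hx : x ∈ V.baseChange E)
    {i n : ℕ} (hin : i ≤ n) : x ^ i ∈ ((1 ⊔ V) ^ n).baseChange E := by
  have h1 : (1 : E ⊗[K] A) ∈ (1 ⊔ V).baseChange E :=
    Submodule.tmul_mem_baseChange_of_mem 1 (le_sup_left (a := (1 : Submodule K A))
      (Submodule.one_le.1 le_rfl))
  induction n generalizing i with
  | zero =>
    obtain rfl : i = 0 := by omega
    rw [pow_zero, pow_zero]
    exact Submodule.tmul_mem_baseChange_of_mem 1 (Submodule.one_le.1 le_rfl)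
  | succ n ih =>
    rw [pow_succ (1 ⊔ V)]
    rcases Nat.lt_or_ge i (n + 1) with h | h
    · rw [← mul_one (x ^ i)]
      exact mul_mem_baseChange (ih (by omega)) h1
    · obtain rfl : i = n + 1 := by omega
      rw [pow_succ]
      exact mul_mem_baseChange (ih le_rfl) (Submodule.baseChange_mono _ le_sup_right hx)

lemma finrank_baseChange_le {P : Submodule K A} (hP : P.FG) :
    Module.Finite E (P.baseChange E) ∧
      Module.finrank E (P.baseChange E) ≤ Module.finrank K P := by
  have : Module.Finite K P := Module.Finite.iff_fg.2 hP
  have hsurj : Function.Surjective (P.toBaseChange E) := P.toBaseChange_surjective E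
  refine ⟨Module.Finite.of_surjective _ hsurj, ?_⟩
  rw [← Module.finrank_baseChange (R := E) (S := K) (M' := P)]
  exact LinearMap.finrank_le_finrank_of_surjective hsurj

/-- The four elements come from the scalar extension of one finite-dimensional `V`. The `m ^ 4`
monomials with exponents below `m` lie in that of `(1 ⊔ V) ^ (4 * m)`, whose dimension over `E` is
at most the one over `K`. The quotient `4 log m / log (4 m)` tends to `4`. -/
lemma four_le_gkDim {z a y x : E ⊗[K] A}
    (h : LinearIndependent E fun q : ℕ × ℕ × ℕ × ℕ =>
      z ^ q.1 * (a ^ q.2.1 * (y ^ q.2.2.1 * x ^ q.2.2.2))) : 4 ≤ gkDim K A := by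
  obtain ⟨V₁, hV₁, hz⟩ := exists_fg_mem_baseChange z
  obtain ⟨V₂, hV₂, ha⟩ := exists_fg_mem_baseChange a
  obtain ⟨V₃, hV₃, hy⟩ := exists_fg_mem_baseChange y
  obtain ⟨V₄, hV₄, hx⟩ := exists_fg_mem_baseChange x
  set V := V₁ ⊔ V₂ ⊔ V₃ ⊔ V₄ with hVdef
  have hV : V.FG := ((hV₁.sup hV₂).sup hV₃).sup hV₄
  replace hz : z ∈ V.baseChange E := Submodule.baseChange_mono _
    (le_sup_left.trans (le_sup_left.trans le_sup_left)) hz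
  replace ha : a ∈ V.baseChange E := Submodule.baseChange_mono _
    (le_sup_right.trans (le_sup_left.trans le_sup_left)) ha
  replace hy : y ∈ V.baseChange E := Submodule.baseChange_mono _
    (le_sup_right.trans le_sup_left) hy
  replace hx : x ∈ V.baseChange E := Submodule.baseChange_mono _ le_sup_right hx
  have hcard : ∀ m : ℕ, m ^ 4 ≤ Module.finrank K ((1 ⊔ V) ^ (4 * m) : Submodule K A) := by
    intro m
    have hfg : ((1 ⊔ V) ^ (4 * m) : Submodule K A).FG :=
      Submodule.FG.pow (Submodule.FG.sup (by
        rw [Submodule.one_eq_span]; exact Submodule.fg_span_singleton 1) hV) _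
    obtain ⟨hfin, hle⟩ := finrank_baseChange_le (E := E) hfg
    refine le_trans ?_ hle
    let f : Fin m × Fin m × Fin m × Fin m → ℕ × ℕ × ℕ × ℕ :=
      fun q => (q.1, q.2.1, q.2.2.1, q.2.2.2)
    have hf : Function.Injective f := by
      rintro ⟨a, b, c, d⟩ ⟨a', b', c', d'⟩ hq
      simp only [f, Prod.mk.injEq, Fin.val_inj] at hq
      simp [hq]
    have hmem : ∀ q, z ^ (f q).1 * (a ^ (f q).2.1 * (y ^ (f q).2.2.1 * x ^ (f q).2.2.2)) ∈
        ((1 ⊔ V) ^ (4 * m)).baseChange E := by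
      intro q
      rw [show 4 * m = m + (m + (m + m)) by ring, pow_add, pow_add, pow_add]
      exact mul_mem_baseChange (pow_mem_baseChange hz q.1.2.le)
        (mul_mem_baseChange (pow_mem_baseChange ha q.2.1.2.le)
          (mul_mem_baseChange (pow_mem_baseChange hy q.2.2.1.2.le)
            (pow_mem_baseChange hx q.2.2.2.2.le)))
    have hli : LinearIndependent E fun q => (⟨_, hmem q⟩ : ((1 ⊔ V) ^ (4 * m)).baseChange E) :=
      LinearIndependent.of_comp (Submodule.subtype _) (h.comp f hf)
    have := hli.fintype_card_le_finrank
    simp only [Fintype.card_prod, Fintype.card_fin] at this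
    calc m ^ 4 = m * (m * (m * m)) := by ring
      _ ≤ _ := this
  have hlim : Filter.Tendsto (fun m : ℕ => 4 * Real.log m / Real.log ((4 * m : ℕ) : ℝ))
      Filter.atTop (nhds 4) := by
    have hlog : Filter.Tendsto (fun m : ℕ => Real.log m) Filter.atTop Filter.atTop :=
      Real.tendsto_log_atTop.comp tendsto_natCast_atTop_atTop
    have h1 : Filter.Tendsto (fun m : ℕ => 4 / (Real.log 4 / Real.log m + 1))
        Filter.atTop (nhds (4 / (0 + 1))) :=
      tendsto_const_nhds.div ((hlog.const_div_atTop (Real.log 4)).add_const 1) (by norm_num)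
    rw [zero_add, div_one] at h1
    refine h1.congr' ?_
    filter_upwards [hlog.eventually_gt_atTop 0, Filter.eventually_gt_atTop 0] with m hm hm0
    have hm0' : (m : ℝ) ≠ 0 := by positivity
    push_cast
    rw [Real.log_mul (by norm_num) hm0']
    have : Real.log 4 > 0 := Real.log_pos (by norm_num)
    field_simp
  refine le_trans ?_ (le_iSup _ (⟨V, hV⟩ : {V : Submodule K A // V.FG}))
  refine le_of_forall_lt fun c hc => ?_
  obtain ⟨c', hcc', hc'⟩ := EReal.lt_iff_exists_real_btwn.1 hc
  refine hcc'.trans_le (Filter.le_limsup_of_frequently_le ?_)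
  have hev : ∀ᶠ m : ℕ in Filter.atTop, (c' : EReal) ≤
      ((Real.log (Module.finrank K ((1 ⊔ V) ^ (4 * m) : Submodule K A)) /
        Real.log ((4 * m : ℕ) : ℝ) : ℝ) : EReal) := by
    have hc4 : c' < 4 := EReal.coe_lt_coe_iff.1 hc'
    filter_upwards [hlim.eventually_const_lt hc4, Filter.eventually_gt_atTop 0] with m hm hm0
    refine EReal.coe_le_coe_iff.2 (hm.le.trans ?_)
    have hlog0 : 0 ≤ Real.log ((4 * m : ℕ) : ℝ) := Real.log_natCast_nonneg _
    gcongr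
    have h4 : (4 : ℝ) * Real.log m = Real.log ((m ^ 4 : ℕ) : ℝ) := by
      push_cast
      rw [Real.log_pow]
      norm_num
    rw [h4]
    refine Real.log_le_log (by positivity) ?_
    exact_mod_cast hcard m
  -- For an upper limit the indices `4 * m` suffice.
  have ht : Filter.Tendsto (fun m : ℕ => 4 * m) Filter.atTop Filter.atTop :=
    Filter.tendsto_id.const_mul_atTop' (by norm_num)
  exact ht.frequently hev.frequently

end Growth

end DixmierTypes

/-! ### Eigenvalue and torsion algebras of an endomorphism. -/

namespace DixmierTypes

section LinearAlgebra

open Polynomial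

/-- The span is the cyclic `k[X]`-module on `y`. If nothing kills `y`, it is a copy of `k[X]`;
otherwise it is spanned by remainders modulo `p`. -/
lemma finiteDimensional_span_iterates_iff {k M : Type*} [Field k] [AddCommGroup M] [Module k M]
    (T : Module.End k M) (y : M) :
    FiniteDimensional k (Submodule.span k (Set.range fun n : ℕ => (T ^ n) y)) ↔
      ∃ p : k[X], p ≠ 0 ∧ aeval T p y = 0 := by
  let φ : k[X] →ₗ[k] M := (LinearMap.applyₗ y).comp (aeval T).toLinearMap
  have hφ : ∀ p, φ p = aeval T p y := fun p => rfl
  have hrange : LinearMap.range φ = Submodule.span k (Set.range fun n : ℕ => (T ^ n) y) := by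
    apply le_antisymm
    · rintro _ ⟨p, rfl⟩
      rw [hφ, aeval_endomorphism, sum_def]
      exact Submodule.sum_mem _ fun n _ =>
        Submodule.smul_mem _ _ (Submodule.subset_span ⟨n, rfl⟩)
    · rw [Submodule.span_le]
      rintro _ ⟨n, rfl⟩
      exact ⟨X ^ n, by rw [hφ]; simp⟩
  rw [← hrange]
  constructor
  · intro hfin
    by_contra! hcon
    have hinj : Function.Injective φ := by
      rw [← LinearMap.ker_eq_bot, LinearMap.ker_eq_bot']
      intro p hp
      by_contra h0
      exact hcon p h0 hp
    have : Module.Finite k k[X] :=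
      Module.Finite.equiv (LinearEquiv.ofInjective φ hinj).symm
    exact Polynomial.not_finite this
  · rintro ⟨p, hp0, hp⟩
    have hle : LinearMap.range φ ≤ (degreeLT k p.natDegree).map φ := by
      rintro _ ⟨q, rfl⟩
      refine ⟨q % p, ?_, ?_⟩
      · rw [SetLike.mem_coe, mem_degreeLT, ← degree_eq_natDegree hp0]
        exact degree_mod_lt q hp0
      · conv_rhs => rw [← EuclideanDomain.mod_add_div q p]
        rw [map_add, hφ (p * _), mul_comm, map_mul, Module.End.mul_apply, hp, map_zero, add_zero]
    have : Module.Finite k ((degreeLT k p.natDegree).map φ) := by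
      have : Module.Finite k (degreeLT k p.natDegree) :=
        Module.Finite.equiv (degreeLTEquiv k p.natDegree).symm
      infer_instance
    exact Submodule.finiteDimensional_of_le hle

/-- The hypothesis `hss` says that `(T - μ)² v = 0` implies `(T - μ) v = 0`. The linear factors of
`p` can then be removed one at a time. -/
lemma mem_iSup_eigenspace_of_aeval_eq_zero {k M : Type*} [Field k] [IsAlgClosed k]
    [AddCommGroup M] [Module k M] (T : Module.End k M)
    (hss : ∀ (μ : k) v, T (T v - μ • v) = μ • (T v - μ • v) → T v = μ • v)
    {p : k[X]} (hp0 : p ≠ 0) {v : M} (hp : aeval T p v = 0) :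
    v ∈ ⨆ μ, T.eigenspace μ := by
  have key : ∀ (s : Multiset k) (v : M), aeval T (s.map fun r => X - C r).prod v = 0 →
      v ∈ ⨆ μ, T.eigenspace μ := by
    intro s
    induction s using Multiset.induction_on with
    | empty => intro v hv; simp at hv; simp [hv]
    | cons r s ih =>
      intro v hv
      rw [Multiset.map_cons, Multiset.prod_cons, mul_comm, map_mul, Module.End.mul_apply] at hv
      have h1 := ih _ hv
      -- On the eigenspaces for `μ ≠ r` the map `T - r` is invertible. So `(T - r) v` agrees with
      -- some `(T - r) w` up to an `r`-eigenvector, and `v - w` is killed by `(T - r)²`.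
      have h2 : ∀ u ∈ ⨆ μ, T.eigenspace μ, ∃ w ∈ ⨆ μ, T.eigenspace μ,
          u - (T w - r • w) ∈ T.eigenspace r := by
        intro u hu
        induction hu using Submodule.iSup_induction' with
        | mem μ x hx =>
          by_cases hμ : μ = r
          · exact ⟨0, Submodule.zero_mem _, by simpa [← hμ] using hx⟩
          · refine ⟨(μ - r)⁻¹ • x, Submodule.smul_mem _ _ (Submodule.mem_iSup_of_mem μ hx), ?_⟩
            rw [Module.End.mem_eigenspace_iff] at hx
            rw [map_smul, hx, smul_comm r, ← smul_sub, ← sub_smul, smul_smul,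
              inv_mul_cancel₀ (sub_ne_zero.2 hμ), one_smul, sub_self]
            exact Submodule.zero_mem _
        | zero => exact ⟨0, Submodule.zero_mem _, by simp⟩
        | add x y hx hy hx' hy' =>
          obtain ⟨w, hw, hxw⟩ := hx'
          obtain ⟨w', hw', hyw⟩ := hy'
          refine ⟨w + w', Submodule.add_mem _ hw hw', ?_⟩
          have := Submodule.add_mem _ hxw hyw
          convert this using 1
          rw [map_add, smul_add]
          abel
      obtain ⟨w, hw, hvw⟩ := h2 _ h1
      have hsub : v - w ∈ T.eigenspace r := by
        rw [Module.End.mem_eigenspace_iff] at hvw ⊢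
        refine hss r _ ?_
        convert hvw using 1
        · congr 1
          simp [Algebra.algebraMap_eq_smul_one, smul_sub]
          abel
        · congr 1
          simp [Algebra.algebraMap_eq_smul_one, smul_sub]
          abel
      have := Submodule.add_mem _ (Submodule.mem_iSup_of_mem r hsub) hw
      rwa [sub_add_cancel] at this
  refine key p.roots v ?_
  rw [(IsAlgClosed.splits p).eq_prod_roots, map_mul, aeval_C, Module.End.mul_apply,
    Algebra.algebraMap_eq_smul_one] at hp
  simpa [hp0] using hp

variable {K : Type*} [Field K] {A : Type*} [Ring A] [Algebra K A]

/-- A functional on `A` that does not vanish at `v` exhibits `e` as a quotient of elements of `K`.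
This brings scalars found over the algebraic closure back to `K`. -/
lemma one_tmul_eq_tmul {u v : A} {e : AlgebraicClosure K} (hv : v ≠ 0)
    (h : (1 : AlgebraicClosure K) ⊗ₜ[K] u = e ⊗ₜ[K] v) :
    ∃ k : K, algebraMap K (AlgebraicClosure K) k = e ∧ u = k • v := by
  obtain ⟨f, hf⟩ : ∃ f : Module.Dual K A, f v ≠ 0 := by
    by_contra! hcon
    exact hv ((Module.forall_dual_apply_eq_zero_iff K v).1 hcon)
  have h1 := congrArg (fun t => TensorProduct.rid K (AlgebraicClosure K) (f.lTensor _ t)) h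
  simp only [LinearMap.lTensor_tmul, TensorProduct.rid_tmul] at h1
  have he : algebraMap K (AlgebraicClosure K) (f u / f v) = e := by
    rw [Algebra.smul_def, Algebra.smul_def, mul_one] at h1
    have : algebraMap K (AlgebraicClosure K) (f v) ≠ 0 := by simpa using hf
    rw [map_div₀, h1]
    field_simp
  refine ⟨_, he, ?_⟩
  rw [← he, Algebra.algebraMap_eq_smul_one, TensorProduct.smul_tmul] at h
  exact Algebra.TensorProduct.includeRight_injective (R := K) (A := AlgebraicClosure K) (B := A)
    (algebraMap K (AlgebraicClosure K)).injective h

/-- By flatness the kernel of the extended map is the extension of the kernel. -/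
lemma baseChange_eq_zero_of_ker_le {f g : A →ₗ[K] A} (h : LinearMap.ker f ≤ LinearMap.ker g)
    {v : AlgebraicClosure K ⊗[K] A} (hv : f.baseChange (AlgebraicClosure K) v = 0) :
    g.baseChange (AlgebraicClosure K) v = 0 := by
  have h1 := Module.Flat.ker_lTensor_eq (AlgebraicClosure K) (AlgebraicClosure K) f
  have h2 : v ∈ LinearMap.ker (TensorProduct.AlgebraTensorModule.lTensor (AlgebraicClosure K)
      (AlgebraicClosure K) f) := hv
  rw [h1] at h2
  obtain ⟨w, rfl⟩ := h2
  induction w using TensorProduct.induction_on with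
  | zero => simp
  | tmul e x =>
    have : g x = 0 := h x.2
    simp [this]
  | add x y hx hy =>
    rw [map_add, map_add, hx ?_, hy ?_, add_zero]
    · have : TensorProduct.AlgebraTensorModule.lTensor (AlgebraicClosure K)
        (AlgebraicClosure K) (LinearMap.ker f).subtype y ∈ LinearMap.ker
          (TensorProduct.AlgebraTensorModule.lTensor (AlgebraicClosure K)
            (AlgebraicClosure K) f) := by rw [h1]; exact ⟨y, rfl⟩
      exact this
    · have : TensorProduct.AlgebraTensorModule.lTensor (AlgebraicClosure K)
        (AlgebraicClosure K) (LinearMap.ker f).subtype x ∈ LinearMap.ker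
          (TensorProduct.AlgebraTensorModule.lTensor (AlgebraicClosure K)
            (AlgebraicClosure K) f) := by rw [h1]; exact ⟨x, rfl⟩
      exact this

variable (δ : A →ₗ[K] A)

lemma baseChange_pow_one_tmul (n : ℕ) (y : A) :
    ((δ.baseChange (AlgebraicClosure K) : Module.End (AlgebraicClosure K) _) ^ n)
      ((1 : AlgebraicClosure K) ⊗ₜ[K] y) = 1 ⊗ₜ[K] ((δ ^ n) y) := by
  induction n with
  | zero => simp
  | succ n ih => rw [pow_succ', Module.End.mul_apply, ih, pow_succ']; simp

lemma kerAlg_le_nilAlg : kerAlg δ ≤ nilAlg δ := by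
  refine le_trans ?_ (le_iSup _ 0)
  rw [zero_add, pow_one]
  exact le_rfl

lemma mem_kerAlg {y : A} : y ∈ kerAlg δ ↔ δ y = 0 := LinearMap.mem_ker

lemma kerAlg_le_eigAlg : kerAlg δ ≤ eigAlg δ := by
  intro y hy
  refine Submodule.mem_iSup_of_mem (0 : AlgebraicClosure K) ?_
  rw [Module.End.mem_eigenspace_iff, zero_smul]
  rw [mem_kerAlg] at hy
  simp [hy]

lemma exists_of_nilAlg_ne_kerAlg (h : nilAlg δ ≠ kerAlg δ) : ∃ y, δ (δ y) = 0 ∧ δ y ≠ 0 := by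
  by_contra! hcon
  refine h (le_antisymm (iSup_le fun i => ?_) (kerAlg_le_nilAlg δ))
  induction i with
  | zero => rw [zero_add, pow_one]; exact le_rfl
  | succ i ih =>
    intro y hy
    rw [mem_kerAlg]
    rw [LinearMap.mem_ker, pow_succ, Module.End.mul_apply] at hy
    exact hcon y ((mem_kerAlg δ).1 (ih hy))

lemma exists_eigenvector_of_eigAlg_ne_kerAlg (h : eigAlg δ ≠ kerAlg δ) :
    ∃ μ : AlgebraicClosure K, μ ≠ 0 ∧ ∃ x, x ≠ 0 ∧
      δ.baseChange (AlgebraicClosure K) x = μ • x := by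
  by_contra! hcon
  refine h (le_antisymm (fun y hy => ?_) (kerAlg_le_eigAlg δ))
  have hle : eigAlgClosure δ ≤ Module.End.eigenspace
      (δ.baseChange (AlgebraicClosure K) : Module.End (AlgebraicClosure K) _) 0 := by
    refine iSup_le fun μ x hx => ?_
    by_cases hμ : μ = 0
    · rwa [← hμ]
    · rw [Module.End.mem_eigenspace_iff] at hx
      by_cases hx0 : x = 0
      · rw [hx0]; exact Submodule.zero_mem _
      · exact absurd hx (hcon μ hμ x hx0)
  have h1 : (1 : AlgebraicClosure K) ⊗ₜ[K] y ∈ eigAlgClosure δ := hy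
  have h2 := Module.End.mem_eigenspace_iff.1 (hle h1)
  rw [zero_smul, LinearMap.baseChange_tmul] at h2
  rw [mem_kerAlg]
  refine Algebra.TensorProduct.includeRight_injective (R := K) (A := AlgebraicClosure K) (B := A)
    (algebraMap K (AlgebraicClosure K)).injective ?_
  simpa using h2

/-- A sum of eigenvectors is killed by a product of linear factors over the algebraic closure. If
the iterates of `y` were independent over `K`, they would remain so over the closure. -/
lemma eigAlg_subset_torsionSet : (eigAlg δ : Set A) ⊆ torsionSet δ := by
  intro y hy
  have h1 : (1 : AlgebraicClosure K) ⊗ₜ[K] y ∈ eigAlgClosure δ := hy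
  set T : Module.End (AlgebraicClosure K) (AlgebraicClosure K ⊗[K] A) :=
    δ.baseChange (AlgebraicClosure K) with hT
  have h2 : ∀ x ∈ eigAlgClosure δ, ∃ p : (AlgebraicClosure K)[X], p ≠ 0 ∧ aeval T p x = 0 := by
    intro x hx
    induction hx using Submodule.iSup_induction' with
    | mem μ x hx =>
      refine ⟨X - C μ, X_sub_C_ne_zero μ, ?_⟩
      rw [Module.End.mem_eigenspace_iff] at hx
      simp [hT, hx, Algebra.algebraMap_eq_smul_one]
    | zero => exact ⟨1, one_ne_zero, map_zero _⟩
    | add x y _ _ hx hy =>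
      obtain ⟨p, hp0, hp⟩ := hx
      obtain ⟨q, hq0, hq⟩ := hy
      refine ⟨p * q, mul_ne_zero hp0 hq0, ?_⟩
      rw [map_add]
      nth_rw 1 [mul_comm p q]
      rw [map_mul, map_mul, Module.End.mul_apply, Module.End.mul_apply, hp, hq, map_zero,
        map_zero, add_zero]
  have h3 := (finiteDimensional_span_iterates_iff T _).2 (h2 _ h1)
  by_contra hcon
  have h4 : LinearIndependent K fun n : ℕ => (δ ^ n) y := by
    rw [linearIndependent_iff']
    intro s g hg i hi
    by_contra hgi
    refine hcon ((finiteDimensional_span_iterates_iff δ y).2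
      ⟨∑ j ∈ s, monomial j (g j), fun h0 => hgi ?_, ?_⟩)
    · have := congrArg (fun p => Polynomial.coeff p i) h0
      simp only [Polynomial.finsetSum_coeff, coeff_monomial, Polynomial.coeff_zero] at this
      rwa [Finset.sum_ite_eq' s i, if_pos hi] at this
    · rw [map_sum, LinearMap.sum_apply, ← hg]
      exact Finset.sum_congr rfl fun j _ => by
        simp [aeval_monomial, Algebra.algebraMap_eq_smul_one]
  have h5 := Module.Flat.linearIndependent_one_tmul (S := AlgebraicClosure K) h4
  have h6 : LinearIndependent (AlgebraicClosure K) fun n : ℕ =>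
      (⟨(T ^ n) (1 ⊗ₜ[K] y), Submodule.subset_span ⟨n, rfl⟩⟩ : Submodule.span
        (AlgebraicClosure K) (Set.range fun n : ℕ => (T ^ n) (1 ⊗ₜ[K] y))) := by
    refine LinearIndependent.of_comp (Submodule.subtype _) ?_
    convert h5 using 2 with n
    exact baseChange_pow_one_tmul δ n y
  exact not_finite_iff_infinite.2 inferInstance (h6.finite)

lemma torsionSet_subset_eigAlg
    (hss : ∀ (μ : AlgebraicClosure K) v,
      δ.baseChange (AlgebraicClosure K) (δ.baseChange (AlgebraicClosure K) v - μ • v) =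
        μ • (δ.baseChange (AlgebraicClosure K) v - μ • v) →
      δ.baseChange (AlgebraicClosure K) v = μ • v) :
    torsionSet δ ⊆ (eigAlg δ : Set A) := by
  intro y hy
  obtain ⟨p, hp0, hp⟩ := (finiteDimensional_span_iterates_iff δ y).1 hy
  refine mem_iSup_eigenspace_of_aeval_eq_zero _ hss
    (p := p.map (algebraMap K (AlgebraicClosure K))) (by simpa using hp0) ?_
  have h1 := congrArg (fun t => (1 : AlgebraicClosure K) ⊗ₜ[K] t) hp
  rw [TensorProduct.tmul_zero, aeval_eq_sum_range, LinearMap.sum_apply,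
    TensorProduct.tmul_sum] at h1
  rw [aeval_map_algebraMap, aeval_eq_sum_range, LinearMap.sum_apply, TensorProduct.mk_apply]
  rw [← h1]
  refine Finset.sum_congr rfl fun i _ => ?_
  rw [LinearMap.smul_apply, LinearMap.smul_apply, baseChange_pow_one_tmul,
    TensorProduct.tmul_smul]

lemma pow_smul_apply {M : Type*} [AddCommGroup M] [Module K M] (T : M →ₗ[K] M) (η : K) (n : ℕ)
    (y : M) : ((η • T : M →ₗ[K] M) ^ n) y = η ^ n • (T ^ n) y := by
  rw [_root_.smul_pow]; rfl

variable {η : K}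

/-- Invariance under scaling is what makes the type constant on `K^* b + Z(A)`, where `ad` changes
only by a nonzero factor. -/
lemma kerAlg_smul (hη : η ≠ 0) : kerAlg (η • δ) = kerAlg δ := by
  ext y
  simp [mem_kerAlg, hη]

lemma nilAlg_smul (hη : η ≠ 0) : nilAlg (η • δ) = nilAlg δ := by
  refine iSup_congr fun i => ?_
  ext y
  simp [pow_smul_apply, hη]

lemma eigAlg_le_smul (η : K) : eigAlg δ ≤ eigAlg (η • δ) := by
  intro y hy
  have h1 : eigAlgClosure δ ≤ eigAlgClosure (η • δ) := by
    refine iSup_le fun μ x hx => ?_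
    refine Submodule.mem_iSup_of_mem (algebraMap K (AlgebraicClosure K) η * μ) ?_
    rw [Module.End.mem_eigenspace_iff] at hx ⊢
    rw [LinearMap.baseChange_smul, LinearMap.smul_apply, hx, mul_smul, algebraMap_smul]
  exact h1 hy

lemma eigAlg_smul (hη : η ≠ 0) : eigAlg (η • δ) = eigAlg δ := by
  refine le_antisymm ?_ (eigAlg_le_smul δ η)
  have := eigAlg_le_smul (η • δ) η⁻¹
  rwa [smul_smul, inv_mul_cancel₀ hη, one_smul] at this

lemma torsionSet_subset_smul (η : K) : torsionSet δ ⊆ torsionSet (η • δ) := by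
  intro y hy
  have : FiniteDimensional K (Submodule.span K (Set.range fun n : ℕ => (δ ^ n) y)) := hy
  refine Submodule.finiteDimensional_of_le
    (S₂ := Submodule.span K (Set.range fun n : ℕ => (δ ^ n) y)) ?_
  rw [Submodule.span_le]
  rintro _ ⟨n, rfl⟩
  simp only [pow_smul_apply]
  exact Submodule.smul_mem _ _ (Submodule.subset_span ⟨n, rfl⟩)

lemma torsionSet_smul (hη : η ≠ 0) : torsionSet (η • δ) = torsionSet δ := by
  refine (torsionSet_subset_smul δ η).antisymm' ?_
  have := torsionSet_subset_smul (η • δ) η⁻¹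
  rwa [smul_smul, inv_mul_cancel₀ hη, one_smul] at this

end LinearAlgebra

end DixmierTypes

/-! ### Heights of monomials under derivations and translations. -/

namespace DixmierTypes

section Heights

open Polynomial

variable {E D : Type*} [Field E] [DivisionRing D] [Algebra E D]

lemma aeval_X_sub_C_pow_succ (T : Module.End E D) (κ : E) (n : ℕ) (v : D) :
    aeval T ((X - C κ) ^ (n + 1)) v =
      T (aeval T ((X - C κ) ^ n) v) - κ • aeval T ((X - C κ) ^ n) v := by
  rw [pow_succ', map_mul, Module.End.mul_apply]
  simp [Algebra.algebraMap_eq_smul_one]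

/-- Iterated Leibniz rule for a derivation and a factor of height one. -/
lemma leibniz_height_one {T : Module.End E D} (hT : ∀ u v, T (u * v) = T u * v + u * T v)
    {y s : D} {ν : E} (hy : T y = ν • y + s) (hs : T s = ν • s) (κ : E) (v : D) (n : ℕ) :
    aeval T ((X - C (ν + κ)) ^ (n + 1)) (y * v) =
      y * aeval T ((X - C κ) ^ (n + 1)) v + (n + 1) • (s * aeval T ((X - C κ) ^ n) v) := by
  induction n with
  | zero =>
    simp only [aeval_X_sub_C_pow_succ, pow_zero, map_one, Module.End.one_apply, hT, hy]
    simp only [add_smul, mul_sub, add_mul, smul_mul_assoc, mul_smul_comm]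
    simp
    abel
  | succ n ih =>
    rw [aeval_X_sub_C_pow_succ, ih, aeval_X_sub_C_pow_succ T κ (n + 1)]
    have h1 := aeval_X_sub_C_pow_succ T κ n v
    generalize aeval T ((X - C κ) ^ (n + 1)) v = v₁ at h1 ⊢
    generalize aeval T ((X - C κ) ^ n) v = v₀ at h1 ⊢
    have h2 : T v₀ = v₁ + κ • v₀ := by rw [h1]; abel
    rw [map_add, map_nsmul, hT, hT, hy, hs, h2, succ_nsmul (s * v₁) (n + 1)]
    simp only [add_smul, mul_sub, mul_add, add_mul, smul_mul_assoc, mul_smul_comm,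
      smul_add, smul_comm (n + 1) ν, smul_comm (n + 1) κ]
    abel

/-- Iterated twisted Leibniz rule for an endomorphism and a factor which it translates. -/
lemma leibniz_translation {T : Module.End E D} (hT : ∀ u v, T (u * v) = T u * T v)
    {b : D} {ν : E} (hb : T b = b + algebraMap E D ν) (v : D) (n : ℕ) :
    aeval T ((X - C (1 : E)) ^ (n + 1)) (b * v) =
      b * aeval T ((X - C (1 : E)) ^ (n + 1)) v + ((n + 1 : ℕ) * ν) •
        (aeval T ((X - C (1 : E)) ^ (n + 1)) v + aeval T ((X - C (1 : E)) ^ n) v) := by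
  induction n with
  | zero =>
    rw [aeval_X_sub_C_pow_succ, aeval_X_sub_C_pow_succ]
    simp only [pow_zero, map_one, Module.End.one_apply, hT, hb]
    simp only [add_mul, mul_sub, ← Algebra.smul_def, one_smul]
    simp
    abel
  | succ n ih =>
    rw [aeval_X_sub_C_pow_succ, ih, aeval_X_sub_C_pow_succ T 1 (n + 1)]
    have h1 := aeval_X_sub_C_pow_succ T 1 n v
    rw [one_smul] at h1
    generalize aeval T ((X - C (1 : E)) ^ (n + 1)) v = v₁ at h1 ⊢
    generalize aeval T ((X - C (1 : E)) ^ n) v = v₀ at h1 ⊢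
    have h2 : T v₀ = v₁ + v₀ := by rw [h1]; abel
    have h3 : (((n + 1 + 1 : ℕ) : E) * ν) = ((n + 1 : ℕ) : E) * ν + ν := by push_cast; ring
    rw [map_add, map_smul, map_add, hT, hb, h2, h3]
    simp only [one_smul, add_smul, mul_sub, add_mul, smul_add, ← Algebra.smul_def, smul_sub]
    abel

lemma derivation_pow_eigenvector {T : Module.End E D} (hT : ∀ u v, T (u * v) = T u * v + u * T v)
    {x : D} {μ : E} (hx : T x = μ • x) (l : ℕ) : T (x ^ l) = ((l : E) * μ) • x ^ l := by
  induction l with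
  | zero => simpa using hT 1 1
  | succ l ih =>
    rw [pow_succ, hT, ih, hx]
    simp only [smul_mul_assoc, mul_smul_comm, ← add_smul]
    congr 1
    push_cast; ring

lemma ad_apply (a x : D) : ad E a x = a * x - x * a := rfl

lemma ad_leibniz (a u v : D) : ad E a (u * v) = ad E a u * v + u * ad E a v := by
  simp only [ad_apply, sub_mul, mul_sub, mul_assoc]
  abel

lemma ad_mul_of_mem_centralizer {a f : D} (hf : f ∈ Subring.centralizer {a}) (x : D) :
    ad E a (f * x) = f * ad E a x := by
  have : a * f = f * a := Subring.mem_centralizer_iff.1 hf a rfl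
  rw [ad_leibniz, ad_apply a f, this, sub_self, zero_mul, zero_add]

variable [CharZero E]

/-- By the iterated Leibniz rule each factor `y` raises the height by exactly one: the top value
picks up a factor `(j + 1) s`, nonzero in characteristic zero. -/
lemma pow_height {T : Module.End E D} (hT : ∀ u v, T (u * v) = T u * v + u * T v)
    {y s x : D} {ν μ : E} (hy : T y = ν • y + s) (hs : T s = ν • s) (hs0 : s ≠ 0)
    (hx : T x = μ • x) (hx0 : x ≠ 0) (j l : ℕ) :
    aeval T ((X - C (j * ν + l * μ)) ^ j) (y ^ j * x ^ l) ≠ 0 ∧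
      aeval T ((X - C (j * ν + l * μ)) ^ (j + 1)) (y ^ j * x ^ l) = 0 := by
  have : CharZero D := charZero_of_injective_algebraMap (FaithfulSMul.algebraMap_injective E D)
  induction j with
  | zero =>
    refine ⟨by simp [hx0], ?_⟩
    rw [aeval_X_sub_C_pow_succ]
    simp [derivation_pow_eigenvector hT hx]
  | succ j ih =>
    have hκ : ((j + 1 : ℕ) : E) * ν + l * μ = ν + (j * ν + l * μ) := by push_cast; ring
    rw [hκ, pow_succ' y, mul_assoc, leibniz_height_one hT hy hs, leibniz_height_one hT hy hs]
    have h3 : aeval T ((X - C (j * ν + l * μ)) ^ (j + 1 + 1)) (y ^ j * x ^ l) = 0 := by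
      rw [aeval_X_sub_C_pow_succ, ih.2]; simp
    rw [ih.2, h3, mul_zero, zero_add, zero_add, mul_zero, nsmul_zero]
    refine ⟨?_, rfl⟩
    rw [nsmul_eq_mul]
    exact mul_ne_zero (by exact_mod_cast Nat.succ_ne_zero j) (mul_ne_zero hs0 ih.1)

lemma pow_height_translation {T : Module.End E D} (hT : ∀ u v, T (u * v) = T u * T v)
    (hT1 : T 1 = 1) {b : D} {ν : E} (hν : ν ≠ 0) (hb : T b = b + algebraMap E D ν) (j : ℕ) :
    aeval T ((X - C (1 : E)) ^ j) (b ^ j) ≠ 0 ∧ aeval T ((X - C (1 : E)) ^ (j + 1)) (b ^ j) = 0 := by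
  induction j with
  | zero =>
    rw [aeval_X_sub_C_pow_succ]
    simp [hT1]
  | succ j ih =>
    rw [pow_succ' b, leibniz_translation hT hb, leibniz_translation hT hb]
    have h3 : aeval T ((X - C (1 : E)) ^ (j + 1 + 1)) (b ^ j) = 0 := by
      rw [aeval_X_sub_C_pow_succ, ih.2]; simp
    rw [ih.2, h3]
    refine ⟨?_, by simp⟩
    rw [mul_zero, zero_add, zero_add]
    exact smul_ne_zero (mul_ne_zero (by exact_mod_cast Nat.succ_ne_zero j) hν) ih.1

/-- The monomial `y ^ j * x ^ l` has height `j` and eigenvalue `j ν + l μ`; as `μ ≠ 0`, this pair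
determines `j` and `l`. -/
lemma indep_pow_mul_pow {a y s x : D} {ν μ : E} (hy : ad E a y = ν • y + s)
    (hs : ad E a s = ν • s) (hs0 : s ≠ 0) (hx : ad E a x = μ • x) (hx0 : x ≠ 0) (hμ : μ ≠ 0) :
    Indep (Subring.centralizer {a}) fun q : ℕ × ℕ => y ^ q.1 * x ^ q.2 := by
  refine indep_of_heights (ad E a) (fun f hf x => ad_mul_of_mem_centralizer hf x)
    (κ := fun q => q.1 * ν + q.2 * μ) (h := fun q => q.1) ?_
    (fun q => (pow_height (ad_leibniz a) hy hs hs0 hx hx0 q.1 q.2).1)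
    (fun q => (pow_height (ad_leibniz a) hy hs hs0 hx hx0 q.1 q.2).2)
  rintro ⟨j, l⟩ ⟨j', l'⟩ h
  simp only [Prod.mk.injEq] at h
  obtain ⟨h1, rfl⟩ := h
  have := mul_right_cancel₀ hμ (add_left_cancel h1)
  simpa using this

lemma indep_pow_of_eigenvector {a x : D} {μ : E} (hx : ad E a x = μ • x) (hx0 : x ≠ 0)
    (hμ : μ ≠ 0) : Indep (Subring.centralizer {a}) fun l : ℕ => x ^ l := by
  refine indep_of_heights (ad E a) (fun f hf x => ad_mul_of_mem_centralizer hf x)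
    (κ := fun l => l * μ) (h := fun q => 0) ?_ (fun l => by simp [hx0]) (fun l => ?_)
  · intro l l' h
    simp only [Prod.mk.injEq, and_true] at h
    simpa using mul_right_cancel₀ hμ h
  · rw [aeval_X_sub_C_pow_succ]
    simp [derivation_pow_eigenvector (ad_leibniz a) hx]

/-- Conjugation by `X'` translates `b`, so `b ^ j` has exact height `j` for its eigenvalue `1`. -/
lemma indep_pow_of_translation {X' b : D} {ν : E} (hν : ν ≠ 0) (hX : X' ≠ 0)
    (hb : X' * b * X'⁻¹ = b + algebraMap E D ν) :
    Indep (Subring.centralizer {X'}) fun j : ℕ => b ^ j := by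
  let T : Module.End E D := LinearMap.mulLeft E X' * LinearMap.mulRight E X'⁻¹
  have hTa : ∀ x, T x = X' * x * X'⁻¹ := fun x => by simp [T, mul_assoc]
  have hT : ∀ u v, T (u * v) = T u * T v := fun u v => by
    simp only [hTa, mul_assoc]
    rw [inv_mul_cancel_left₀ hX]
  have hT1 : T 1 = 1 := by rw [hTa, mul_one, mul_inv_cancel₀ hX]
  refine indep_of_heights T (fun f hf x => ?_) (κ := fun _ => 1) (h := fun j => j) ?_
    (fun j => (pow_height_translation hT hT1 hν ((hTa b).trans hb) j).1)
    (fun j => (pow_height_translation hT hT1 hν ((hTa b).trans hb) j).2)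
  · have : X' * f = f * X' := Subring.mem_centralizer_iff.1 hf X' rfl
    rw [hTa, hTa, ← mul_assoc, this]
    simp only [mul_assoc]
  · intro i j h
    simpa using h

end Heights

end DixmierTypes

/-! ### Consequences of dimension less than four. -/

namespace DixmierTypes

section Embedding

open Polynomial

variable {K : Type*} [Field K] {A : Type*} [Ring A] [Algebra K A]
  {D : Type*} [DivisionRing D] [Algebra (AlgebraicClosure K) D]

/-- An embedding of `A`, after extension of scalars to the algebraic closure, into a division ring
in which noncentral elements have commutative centralizers and are transcendental over the centre,
for a noncommutative algebra `A` of Gelfand-Kirillov dimension less than four that contains a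
nonscalar element which is central in the division ring. -/
structure SmallEmbedding (J : AlgebraicClosure K ⊗[K] A →ₐ[AlgebraicClosure K] D) : Prop where
  injective : Function.Injective J
  ccc : ∀ a, a ∉ Subring.center D → ∀ b c, Commute a b → Commute a c → Commute b c
  transcendental : ∀ a, a ∉ Subring.center D → Transcendental (Subring.center D) a
  noncommutative : Noncommutative A
  gkDim_lt : gkDim K A < 4
  exists_central : ∃ z : A, z ∉ (⊥ : Subalgebra K A) ∧ J (1 ⊗ₜ z) ∈ Subring.center D

/-- A polynomial splits into linear factors, none of which vanishes at `ζ`, and a division ring has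
no zero divisors. -/
lemma transcendental_of_not_mem_range {E : Type*} [Field E] [IsAlgClosed E] [Algebra E D] {ζ : D}
    (h : ∀ r, ζ ≠ algebraMap E D r) : Transcendental E ζ := by
  have key : ∀ s : Multiset E, aeval ζ (s.map fun r => X - C r).prod ≠ 0 := by
    intro s
    induction s using Multiset.induction_on with
    | empty => simp
    | cons r s ih =>
      rw [Multiset.map_cons, Multiset.prod_cons, map_mul]
      refine mul_ne_zero ?_ ih
      simpa [sub_eq_zero] using h r
  rw [transcendental_iff]
  intro p hp
  rw [(IsAlgClosed.splits p).eq_prod_roots, map_mul, aeval_C] at hp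
  simpa using (mul_eq_zero.1 hp).resolve_right (key _)

namespace SmallEmbedding

variable {J : AlgebraicClosure K ⊗[K] A →ₐ[AlgebraicClosure K] D} (hJ : SmallEmbedding J)

include hJ

/-- A nonscalar central `z` is transcendental over the algebraic closure. Its powers provide a
fourth exponent, and dimension at least four would follow. Every later restriction on `A` comes from
a family excluded here. -/
lemma not_indep (a y x : AlgebraicClosure K ⊗[K] A) :
    ¬ Indep (Subring.center D) fun q : ℕ × ℕ × ℕ => J a ^ q.1 * (J y ^ q.2.1 * J x ^ q.2.2) := by
  intro hind
  obtain ⟨z, hz, hzc⟩ := hJ.exists_central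
  have hζ : Transcendental (AlgebraicClosure K) (J (1 ⊗ₜ z)) := by
    refine transcendental_of_not_mem_range fun r hr => hz ?_
    rw [← J.commutes, Algebra.TensorProduct.algebraMap_apply] at hr
    have h1 := hJ.injective hr
    have : Nontrivial A := by
      obtain ⟨x, y, hxy⟩ := hJ.noncommutative
      exact ⟨_, _, hxy⟩
    obtain ⟨k, -, hk⟩ := one_tmul_eq_tmul one_ne_zero h1
    rw [Algebra.mem_bot]
    exact ⟨k, by rw [hk, Algebra.algebraMap_eq_smul_one]⟩
  have hle : (algebraMap (AlgebraicClosure K) D).range ≤ Subring.center D := by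
    rintro _ ⟨r, rfl⟩
    exact Subring.mem_center_iff.2 fun g => (Algebra.commutes r g).symm
  have h2 := Indep.mul hle (fun i => (Subring.center D).pow_mem hzc i)
    (indep_pow_of_transcendental hζ) hind
  refine absurd hJ.gkDim_lt (not_lt.2 (four_le_gkDim (z := 1 ⊗ₜ z) (a := a) (y := y) (x := x) ?_))
  rw [linearIndependent_iff']
  intro s g hg i hi
  have h3 := h2 s (fun i => algebraMap _ D (g i)) (fun i => ⟨g i, rfl⟩) (by
    have := congrArg J hg
    rw [map_sum, map_zero] at this
    rw [← this]
    exact Finset.sum_congr rfl fun j _ => by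
      rw [map_smul, Algebra.smul_def]
      simp only [map_mul, map_pow]) i hi
  simpa using h3

lemma indep_pow_center {a : D} (ha : a ∉ Subring.center D) :
    Indep (Subring.center D) fun i : ℕ => a ^ i := by
  have := indep_pow_of_transcendental (hJ.transcendental a ha)
  rwa [range_algebraMap_center] at this

omit hJ in
lemma ad_map (a x : AlgebraicClosure K ⊗[K] A) :
    ad (AlgebraicClosure K) (J a) (J x) = J (ad (AlgebraicClosure K) a x) := by
  change J a * J x - J x * J a = J (a * x - x * a)
  rw [map_sub, map_mul, map_mul]

variable [CharZero K]

/-- Powers of `a` are independent over the centre and lie in `C(a)`, over which the `yʲ xˡ` are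
independent. With `ν = 0` this separates nilpotent from semisimple behaviour; with `ν = μ` it
excludes Jordan blocks at nonzero eigenvalues. -/
lemma not_height_one {a y s x : AlgebraicClosure K ⊗[K] A} {ν μ : AlgebraicClosure K}
    (hy : ad (AlgebraicClosure K) a y = ν • y + s) (hs : ad (AlgebraicClosure K) a s = ν • s)
    (hs0 : s ≠ 0) (hx : ad (AlgebraicClosure K) a x = μ • x) (hx0 : x ≠ 0) (hμ : μ ≠ 0) :
    False := by
  have hx0' : J x ≠ 0 := (map_ne_zero_iff J hJ.injective).2 hx0
  have hx' : ad (AlgebraicClosure K) (J a) (J x) = μ • J x := by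
    rw [ad_map, hx, map_smul]
  have ha : J a ∉ Subring.center D := fun h => by
    rw [ad_apply, Subring.mem_center_iff.1 h, sub_self] at hx'
    exact smul_ne_zero hμ hx0' hx'.symm
  refine hJ.not_indep a y x (Indep.mul (Q := Subring.centralizer {J a})
    (Subring.center_le_centralizer _)
    (fun i => (Subring.centralizer {J a}).pow_mem ?_ i) (hJ.indep_pow_center ha)
    (indep_pow_mul_pow (E := AlgebraicClosure K) (ν := ν) (s := J s) (μ := μ) ?_ ?_
      ((map_ne_zero_iff J hJ.injective).2 hs0) hx' hx0' hμ))
  · rw [Subring.mem_centralizer_iff]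
    rintro _ rfl
    rfl
  · rw [ad_map, hy, map_add, map_smul]
  · rw [ad_map, hs, map_smul]

/-- For noncentral `w` three layers would be stacked: powers of `w` over the centre, powers of `b`
over `C(b) ∩ C(T)`, which contains `w`, and powers of `x` over `C(b)`, which contains both. -/
lemma mem_center_of_commute_translation {b w x : AlgebraicClosure K ⊗[K] A}
    {μ ν : AlgebraicClosure K} {T : D} (hx : ad (AlgebraicClosure K) b x = μ • x) (hx0 : x ≠ 0)
    (hμ : μ ≠ 0) (hbw : Commute b w) (hT : T ≠ 0) (hν : ν ≠ 0)
    (hTb : T * J b * T⁻¹ = J b + algebraMap _ D ν) (hTw : Commute T (J w)) :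
    J w ∈ Subring.center D := by
  by_contra hw
  have hx0' : J x ≠ 0 := (map_ne_zero_iff J hJ.injective).2 hx0
  have hx' : ad (AlgebraicClosure K) (J b) (J x) = μ • J x := by
    rw [ad_map, hx, map_smul]
  have hbc : J b ∈ Subring.centralizer {J b} := by
    rw [Subring.mem_centralizer_iff]
    rintro _ rfl
    rfl
  have hwQ : J w ∈ Subring.centralizer {J b} ⊓ Subring.centralizer {T} := by
    refine ⟨?_, ?_⟩
    · rw [SetLike.mem_coe, Subring.mem_centralizer_iff]
      rintro _ rfl
      exact (hbw.map J).eq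
    · rw [SetLike.mem_coe, Subring.mem_centralizer_iff]
      rintro _ rfl
      exact hTw.eq
  have h1 : Indep (Subring.centralizer {J b} ⊓ Subring.centralizer {T}) fun j : ℕ => J b ^ j :=
    fun s c hc => indep_pow_of_translation hν hT hTb s c fun i => (hc i).2
  have h2 := Indep.mul inf_le_left (fun i => (Subring.centralizer {J b}).pow_mem hbc i) h1
    (indep_pow_of_eigenvector hx' hx0' hμ)
  exact hJ.not_indep w b x (Indep.mul
    (le_inf (Subring.center_le_centralizer _) (Subring.center_le_centralizer _))
    (fun i => Subring.pow_mem _ hwQ i) (hJ.indep_pow_center hw) h2)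

omit hJ in
omit [CharZero K] in
lemma semiconjBy_of_ad {b x : AlgebraicClosure K ⊗[K] A} {μ : AlgebraicClosure K}
    (hx : ad (AlgebraicClosure K) b x = μ • x) :
    SemiconjBy (J x) (J b) (J b - algebraMap _ D μ) := by
  have h : b * x - x * b = μ • x := hx
  have h' := congrArg J h
  rw [map_sub, map_mul, map_mul, map_smul, Algebra.smul_def] at h'
  rw [SemiconjBy, sub_mul, ← h', sub_sub_cancel]

omit hJ in
omit [CharZero K] in
lemma semiconjBy_zpow {x b : D} {μ : AlgebraicClosure K}
    (h : SemiconjBy x b (b - algebraMap _ D μ)) (n : ℤ) :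
    SemiconjBy (x ^ n) b (b - algebraMap _ D (n * μ)) := by
  have hn : ∀ (n : ℕ) (e : AlgebraicClosure K), SemiconjBy (x ^ n) (b + algebraMap _ D e)
      (b + algebraMap _ D (e - n * μ)) := by
    intro n
    induction n with
    | zero => intro e; simp
    | succ n ih =>
      intro e
      rw [pow_succ]
      have h1 : SemiconjBy x (b + algebraMap _ D e) (b + algebraMap _ D (e - μ)) := by
        have h2 : SemiconjBy x (algebraMap _ D e) (algebraMap _ D e) :=
          (Algebra.commutes e x).symm
        convert h.add_right h2 using 1
        rw [map_sub]; abel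
      have h2 : e - ((n + 1 : ℕ) : AlgebraicClosure K) * μ = e - μ - n * μ := by push_cast; ring
      rw [h2]
      exact (ih _).mul_left h1
  obtain ⟨k, rfl | rfl⟩ := n.eq_nat_or_neg
  · convert hn k 0 using 1
    · rw [zpow_natCast]
    · simp
    · simp [sub_eq_add_neg]
  · rw [zpow_neg, zpow_natCast]
    have h5 := (hn k (k * μ)).inv_symm_left₀
    rw [sub_self, map_zero, add_zero] at h5
    rwa [Int.cast_neg, Int.cast_natCast, neg_mul, map_neg, sub_neg_eq_add]

omit hJ in
omit [CharZero K] in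
lemma commute_conj {u c f : D} {e : AlgebraicClosure K}
    (h : SemiconjBy u c (c - algebraMap _ D e)) (hf : Commute c f) :
    Commute c (u * f * u⁻¹) := by
  have h1 : SemiconjBy u⁻¹ (c - algebraMap _ D e) c := h.inv_symm_left₀
  have h2 : SemiconjBy (u * f * u⁻¹) (c - algebraMap _ D e) (c - algebraMap _ D e) :=
    (h.mul_left hf.symm).mul_left h1
  have h3 : Commute (u * f * u⁻¹) (algebraMap _ D e) := (Algebra.commutes e _).symm
  have h4 := Commute.add_right h2 h3
  rw [sub_add_cancel] at h4
  exact h4.symm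

/-- Two commuting elements with eigenvectors for nonzero eigenvalues are affinely dependent
modulo the centre. -/
lemma exists_sub_smul_mem_center {b c x x' : AlgebraicClosure K ⊗[K] A}
    {μ μ' : AlgebraicClosure K} (hbc : Commute b c)
    (hx : ad (AlgebraicClosure K) b x = μ • x) (hx0 : x ≠ 0) (hμ : μ ≠ 0)
    (hx' : ad (AlgebraicClosure K) c x' = μ' • x') (hx0' : x' ≠ 0) (hμ' : μ' ≠ 0) :
    ∃ η : AlgebraicClosure K, J (c - η • b) ∈ Subring.center D := by
  have hX0 : J x ≠ 0 := (map_ne_zero_iff J hJ.injective).2 hx0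
  have hX0' : J x' ≠ 0 := (map_ne_zero_iff J hJ.injective).2 hx0'
  have hb : J b ∉ Subring.center D := fun h => by
    have h1 : ad (AlgebraicClosure K) (J b) (J x) = μ • J x := by rw [ad_map, hx, map_smul]
    rw [ad_apply, Subring.mem_center_iff.1 h, sub_self] at h1
    exact smul_ne_zero hμ hX0 h1.symm
  have hc : J c ∉ Subring.center D := fun h => by
    have h1 : ad (AlgebraicClosure K) (J c) (J x') = μ' • J x' := by
      rw [ad_map, hx', map_smul]
    rw [ad_apply, Subring.mem_center_iff.1 h, sub_self] at h1
    exact smul_ne_zero hμ' hX0' h1.symm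
  have hBC : Commute (J b) (J c) := hbc.map J
  have hsx := fun n => semiconjBy_zpow (semiconjBy_of_ad (J := J) hx) n
  have hsx' := fun n => semiconjBy_zpow (semiconjBy_of_ad (J := J) hx') n
  have hiff : ∀ f, Commute (J b) f ↔ Commute (J c) f := fun f =>
    ⟨fun h => hJ.ccc _ hb _ _ hBC h, fun h => hJ.ccc _ hc _ _ hBC.symm h⟩
  have hN : ∀ (n : ℤ) f, Commute (J b) f → Commute (J b) (J x ^ n * f * (J x ^ n)⁻¹) :=
    fun n f hf => commute_conj (hsx n) hf
  have hN' : ∀ (n : ℤ) f, Commute (J b) f → Commute (J b) (J x' ^ n * f * (J x' ^ n)⁻¹) :=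
    fun n f hf => (hiff _).2 (commute_conj (hsx' n) ((hiff _).1 hf))
  -- Together with the powers of `b`, such a family would give three independent exponents over the
  -- centre.
  have hnot : ¬ Indep (Subring.centralizer {J b}) fun q : ℕ × ℕ => J x ^ q.1 * J x' ^ q.2 := by
    intro hind
    refine hJ.not_indep b x x' (Indep.mul (Q := Subring.centralizer {J b})
      (Subring.center_le_centralizer _) (fun i => (Subring.centralizer {J b}).pow_mem ?_ i)
      (hJ.indep_pow_center hb) hind)
    rw [Subring.mem_centralizer_iff]
    rintro _ rfl
    rfl
  obtain ⟨m, n, hmn, hconj⟩ : ∃ m n : ℤ, (m ≠ 0 ∨ n ≠ 0) ∧ ∀ g, Commute (J b) g →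
      J x ^ m * g * (J x ^ m)⁻¹ = J x' ^ n * g * (J x' ^ n)⁻¹ := by
    by_contra! hcon
    refine hnot (indep_of_distinct_conjugations (fun f g hf hg => hJ.ccc _ hb f g hf hg)
      (fun q => mul_ne_zero (pow_ne_zero _ hX0) (pow_ne_zero _ hX0')) (fun q f hf => ?_) ?_)
    · have := hN q.1 _ (hN' q.2 f hf)
      rw [zpow_natCast, zpow_natCast] at this
      simpa only [mul_inv_rev, mul_assoc] using this
    · rintro ⟨j, l⟩ ⟨j', l'⟩ heq
      by_contra hne
      obtain ⟨g, hg, hgne⟩ := hcon (j - j') (l' - l) (by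
        by_contra! h
        exact hne (Prod.ext (by dsimp only; omega) (by dsimp only; omega)))
      apply hgne
      -- Applying the equality to a conjugate of `g` under `x' ^ (-l)` allows the powers of `x` to
      -- be gathered on one side and those of `x'` on the other.
      have h1 := heq _ (hN' (-l) g hg)
      simp only [← zpow_natCast] at h1
      have e1 : J x ^ ((j : ℤ) - j') = (J x ^ (j' : ℤ))⁻¹ * J x ^ (j : ℤ) := by
        rw [← zpow_neg, ← zpow_add₀ hX0]; congr 1; ring
      have e2 : J x' ^ ((l' : ℤ) - l) = J x' ^ (l' : ℤ) * (J x' ^ (l : ℤ))⁻¹ := by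
        rw [← zpow_neg, ← zpow_add₀ hX0']; congr 1
      have hne1 : J x ^ (j : ℤ) ≠ 0 := zpow_ne_zero _ hX0
      have hne2 : J x ^ (j' : ℤ) ≠ 0 := zpow_ne_zero _ hX0
      have hne3 : J x' ^ (l : ℤ) ≠ 0 := zpow_ne_zero _ hX0'
      rw [e1, e2]
      rw [zpow_neg] at h1
      generalize J x ^ (j : ℤ) = p at *
      generalize J x ^ (j' : ℤ) = p' at *
      generalize J x' ^ (l : ℤ) = q at *
      generalize J x' ^ (l' : ℤ) = q' at *
      simp only [mul_inv_rev, inv_inv, mul_assoc] at h1 ⊢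
      rw [mul_inv_cancel_left₀ hne3, mul_inv_cancel_left₀ hne3] at h1
      have h2 : p'⁻¹ * (p * (g * (p⁻¹ * p'))) = p'⁻¹ * (p * (g * p⁻¹)) * p' := by
        simp only [mul_assoc]
      rw [h2, h1, inv_mul_cancel_left₀ hne2]
      simp only [mul_assoc]
      rw [inv_mul_cancel₀ hne2, mul_one]
  have hcx : ∀ {u f f' : D}, u ≠ 0 → SemiconjBy u f f' → u * f * u⁻¹ = f' := by
    intro u f f' hu h
    rw [h.eq, mul_inv_cancel_right₀ hu]
  have inj : Function.Injective (algebraMap (AlgebraicClosure K) D) :=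
    FaithfulSMul.algebraMap_injective _ D
  -- Conjugation by `x' ^ n` shifts `c` by `n μ'` and conjugation by `x ^ m` shifts `b` by `m μ`, so
  -- neither exponent can vanish alone.
  have hm : m ≠ 0 := by
    rintro rfl
    have h1 := hconj (J c) hBC
    rw [hcx (zpow_ne_zero n hX0') (hsx' n), zpow_zero, one_mul, inv_one, mul_one,
      eq_comm, sub_eq_self, map_eq_zero] at h1
    have : n = 0 := by simpa [hμ'] using h1
    simp [this] at hmn
  have hn : n ≠ 0 := by
    rintro rfl
    have h1 := hconj (J b) (Commute.refl _)
    rw [hcx (zpow_ne_zero m hX0) (hsx m), zpow_zero, one_mul, inv_one, mul_one,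
      sub_eq_self, map_eq_zero] at h1
    exact hm (by simpa [hμ] using h1)
  have hmE : (m : AlgebraicClosure K) ≠ 0 := by exact_mod_cast hm
  -- On `C(b)` the conjugations by `x ^ m` and `x' ^ n` agree, so the first lowers `b` by `m μ` and
  -- `c` by `n μ'`. This value of `η` makes `c - η b` invariant.
  refine ⟨n * μ' / (m * μ), ?_⟩
  refine hJ.mem_center_of_commute_translation (b := b) (x := x) (μ := μ) (ν := -(m * μ))
    (T := J x ^ m) hx hx0 hμ (hbc.sub_right ((Commute.refl b).smul_right _))
    (zpow_ne_zero m hX0) (neg_ne_zero.2 (mul_ne_zero hmE hμ)) ?_ ?_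
  · rw [hcx (zpow_ne_zero m hX0) (hsx m), map_neg, sub_eq_add_neg]
  · have h1 : SemiconjBy (J x ^ m) (J c) (J c - algebraMap _ D (n * μ')) := by
      have := hconj (J c) hBC
      rw [hcx (zpow_ne_zero n hX0') (hsx' n)] at this
      rw [SemiconjBy, ← this, inv_mul_cancel_right₀ (zpow_ne_zero m hX0)]
    have h2 : SemiconjBy (J x ^ m) ((n * μ' / (m * μ)) • J b)
        ((n * μ' / (m * μ)) • (J b - algebraMap _ D (m * μ))) := by
      have := (hsx m).eq
      rw [SemiconjBy, mul_smul_comm, this, smul_mul_assoc]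
    have h3 := h1.sub_right h2
    rw [Commute, map_sub, map_smul]
    convert h3 using 1
    rw [smul_sub, Algebra.smul_def _ (algebraMap _ D _), ← map_mul,
      div_mul_cancel₀ _ (mul_ne_zero hmE hμ)]
    abel

end SmallEmbedding

end Embedding

end DixmierTypes

/-! ### The Dixmier partition and the homogeneous centralizer condition. -/

namespace DixmierTypes

section Types

variable {K : Type*} [Field K] {A : Type*} [Ring A] [Algebra K A]

lemma mem_center_of_kerAlg_eq_top {a : A} (h : kerAlg (ad K a) = ⊤) :
    a ∈ Subalgebra.center K A := by
  refine Subalgebra.mem_center_iff.2 fun b => ?_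
  have : b ∈ kerAlg (ad K a) := h ▸ Submodule.mem_top
  exact (sub_eq_zero.1 ((mem_kerAlg _).1 this)).symm

lemma kerAlg_ne_top {a : A} (ha : a ∈ nonCentral K A) : kerAlg (ad K a) ≠ ⊤ :=
  fun h => ha (mem_center_of_kerAlg_eq_top h)

lemma mem_kerAlg_ad {a y : A} : y ∈ kerAlg (ad K a) ↔ Commute a y := by
  rw [mem_kerAlg]
  exact sub_eq_zero

variable (K A) in
/-- The five classes of noncentral elements as an indexed family. -/
def delta : Fin 5 → Set A := ![Delta1 K A, Delta2 K A, Delta3 K A, Delta4 K A, Delta5 K A]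

-- The class of an element is determined by comparing `N(a)` and `D(a)` with `C(a)` and `A`; hence
-- the five classes are disjoint.
open Classical in
lemma index_eq_of_mem_delta {a : A} {i : Fin 5} (hi : a ∈ delta K A i) :
    i = if nilAlg (ad K a) = kerAlg (ad K a) then
        if eigAlg (ad K a) = kerAlg (ad K a) then 4 else if eigAlg (ad K a) = ⊤ then 2 else 3
      else if nilAlg (ad K a) = ⊤ then 0 else 1 := by
  have ht : a ∈ nonCentral K A → kerAlg (ad K a) ≠ ⊤ := kerAlg_ne_top
  fin_cases i
  · obtain ⟨h, h1, -⟩ : a ∈ Delta1 K A := hi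
    rw [if_neg fun h3 => ht h (h3.symm.trans h1), if_pos h1]
    rfl
  · obtain ⟨h, h1, h2, -⟩ : a ∈ Delta2 K A := hi
    rw [if_neg h1.symm, if_neg h2]
    rfl
  · obtain ⟨h, h1, h2⟩ : a ∈ Delta3 K A := hi
    rw [if_pos h1, if_neg fun h3 => ht h (h3.symm.trans h2), if_pos h2]
    rfl
  · obtain ⟨h, h1, h2, h3, h4⟩ : a ∈ Delta4 K A := hi
    rw [if_pos h1, if_neg h2.symm, if_neg fun h5 => h4 (by rw [← h3, h5]; rfl)]
    rfl
  · obtain ⟨h, h1, h2⟩ : a ∈ Delta5 K A := hi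
    rw [if_pos (h1.trans h2), if_pos h2]
    rfl

lemma eq_of_mem_delta {a : A} {i j : Fin 5} (hi : a ∈ delta K A i) (hj : a ∈ delta K A j) :
    i = j :=
  (index_eq_of_mem_delta hi).trans (index_eq_of_mem_delta hj).symm

/-- A set of type `i` has an element of class `i`, and all its elements are of class `i` or generic.
For two types `i` and `j`, either they share a class or both equal the generic one. -/
lemma HasHomogeneousType.unique {S : Set A} (hS : S.Nonempty) {i j : Fin 5}
    (hi : HasHomogeneousType K A S i) (hj : HasHomogeneousType K A S j) : i = j := by
  have key : ∀ i, HasHomogeneousType K A S i →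
      (∃ b ∈ S, b ∈ delta K A i) ∧ ∀ b ∈ S, b ∈ delta K A i ∨ b ∈ delta K A 4 := by
    obtain ⟨a, ha⟩ := hS
    have hself : ∀ b : A, b ∈ scaledCoset K A b := fun b =>
      ⟨1, one_ne_zero, 0, Subalgebra.zero_mem _, by simp⟩
    intro i hi
    fin_cases i
    · exact ⟨⟨a, ha, hi ha⟩, fun b hb => Or.inl (hi hb)⟩
    · exact ⟨⟨a, ha, hi ha⟩, fun b hb => Or.inl (hi hb)⟩
    · obtain ⟨b, hb, h1, h2, h3⟩ := hi
      exact ⟨⟨b, h1 (hself b), hb⟩, fun c hc =>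
        (em (c ∈ scaledCoset K A b)).imp (fun h => h2 h) fun h => h3 ⟨hc, h⟩⟩
    · obtain ⟨b, hb, h1, h2, h3⟩ := hi
      exact ⟨⟨b, h1 (hself b), hb⟩, fun c hc =>
        (em (c ∈ scaledCoset K A b)).imp (fun h => h2 h) fun h => h3 ⟨hc, h⟩⟩
    · exact ⟨⟨a, ha, hi ha⟩, fun b hb => Or.inl (hi hb)⟩
  obtain ⟨⟨b, hb, hbi⟩, hi'⟩ := key i hi
  obtain ⟨⟨c, hc, hcj⟩, hj'⟩ := key j hj
  rcases hj' b hb with h | h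
  · exact eq_of_mem_delta hbi h
  rcases hi' c hc with h' | h'
  · exact eq_of_mem_delta h' hcj
  rw [eq_of_mem_delta hbi h, eq_of_mem_delta hcj h']

variable {D : Type*} [DivisionRing D] [Algebra (AlgebraicClosure K) D]
  {J : AlgebraicClosure K ⊗[K] A →ₐ[AlgebraicClosure K] D}

lemma baseChange_ad (a : A) : (ad K a).baseChange (AlgebraicClosure K) =
    ad (AlgebraicClosure K) ((1 : AlgebraicClosure K) ⊗ₜ[K] a) := by
  ext x
  simp [ad]

lemma one_tmul_injective : Function.Injective fun a : A => (1 : AlgebraicClosure K) ⊗ₜ[K] a :=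
  Algebra.TensorProduct.includeRight_injective (R := K) (A := AlgebraicClosure K) (B := A)
    (algebraMap K (AlgebraicClosure K)).injective

namespace SmallEmbedding

variable (hJ : SmallEmbedding J)

include hJ

lemma commute_iff {a b : A} : Commute (J (1 ⊗ₜ a)) (J (1 ⊗ₜ b)) ↔ Commute a b := by
  rw [Commute, SemiconjBy, ← map_mul, ← map_mul, hJ.injective.eq_iff,
    Algebra.TensorProduct.tmul_mul_tmul, Algebra.TensorProduct.tmul_mul_tmul, mul_one,
    one_tmul_injective.eq_iff]
  rfl

/-- If the image of a central `a` were noncentral, its commutative centralizer would contain the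
image of `A`. -/
lemma mem_center_iff {a : A} :
    a ∈ Subalgebra.center K A ↔ J (1 ⊗ₜ a) ∈ Subring.center D := by
  constructor
  · intro ha
    by_contra hc
    obtain ⟨x, y, hxy⟩ := hJ.noncommutative
    refine hxy (hJ.commute_iff.1 (hJ.ccc _ hc _ _ (hJ.commute_iff.2 ?_) (hJ.commute_iff.2 ?_)))
    · exact (Subalgebra.mem_center_iff.1 ha x).symm
    · exact (Subalgebra.mem_center_iff.1 ha y).symm
  · intro ha
    exact Subalgebra.mem_center_iff.2 fun b =>
      (hJ.commute_iff.1 (Subring.mem_center_iff.1 ha (J (1 ⊗ₜ b))))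

lemma commute_of_commute {a b c : A} (ha : a ∈ nonCentral K A) (hb : Commute a b)
    (hc : Commute a c) : Commute b c :=
  hJ.commute_iff.1 (hJ.ccc _ (hJ.mem_center_iff.not.1 ha) _ _ (hJ.commute_iff.2 hb)
    (hJ.commute_iff.2 hc))

theorem satisfiesCCC : SatisfiesCCC K A := by
  refine ⟨hJ.noncommutative, fun a ha x hx y hy => ?_⟩
  rw [Subalgebra.mem_centralizer_iff] at hx hy
  exact hJ.commute_of_commute ha (hx a rfl) (hy a rfl)

lemma kerAlg_eq {a b : A} (ha : a ∈ nonCentral K A) (hb : b ∈ nonCentral K A)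
    (h : Commute a b) : kerAlg (ad K b) = kerAlg (ad K a) := by
  ext y
  rw [mem_kerAlg_ad, mem_kerAlg_ad]
  exact ⟨hJ.commute_of_commute hb h.symm, hJ.commute_of_commute ha h⟩

/-- `ad a` and `ad b` commute, and the ccc gives `ker (ad a) ≤ ker (ad b)`. Induction extends the
inclusion to powers. -/
lemma nilAlg_le {a b : A} (ha : a ∈ nonCentral K A) (h : Commute a b) :
    nilAlg (ad K a) ≤ nilAlg (ad K b) := by
  refine iSup_mono fun n => ?_
  have hcomm : Commute (ad K a) (ad K b) := by
    ext y
    have h' : a * b = b * a := h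
    simp only [Module.End.mul_apply, ad, LinearMap.sub_apply, LinearMap.mulLeft_apply,
      LinearMap.mulRight_apply, mul_sub, sub_mul]
    simp only [← mul_assoc, h']
    simp only [mul_assoc, h']
    abel
  have hker : ∀ y, ad K a y = 0 → ad K b y = 0 := fun y hy =>
    mem_kerAlg_ad.2 (hJ.commute_of_commute ha h (mem_kerAlg_ad.1 hy))
  induction n with
  | zero =>
    intro y hy
    rw [LinearMap.mem_ker, zero_add, pow_one] at *
    exact hker y hy
  | succ n ih =>
    intro y hy
    rw [LinearMap.mem_ker] at hy
    have h1 : (ad K a ^ (n + 1)) (ad K b y) = 0 := by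
      have := congrArg (fun f : Module.End K A => f y) (hcomm.pow_left (n + 1)).eq
      simp only [Module.End.mul_apply] at this
      rw [this]
      refine hker _ ?_
      rw [← hy, pow_succ' _ (n + 1), Module.End.mul_apply]
    have h2 := ih h1
    rw [LinearMap.mem_ker] at h2 ⊢
    rw [pow_succ, Module.End.mul_apply, h2]

lemma nilAlg_eq {a b : A} (ha : a ∈ nonCentral K A) (hb : b ∈ nonCentral K A)
    (h : Commute a b) : nilAlg (ad K b) = nilAlg (ad K a) :=
  le_antisymm (hJ.nilAlg_le hb h.symm) (hJ.nilAlg_le ha h)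

variable [CharZero K]

lemma eigAlg_eq_kerAlg {a : A} (h : nilAlg (ad K a) ≠ kerAlg (ad K a)) :
    eigAlg (ad K a) = kerAlg (ad K a) := by
  by_contra hcon
  obtain ⟨y, hy, hy'⟩ := exists_of_nilAlg_ne_kerAlg _ h
  obtain ⟨μ, hμ, x, hx0, hx⟩ := exists_eigenvector_of_eigAlg_ne_kerAlg _ hcon
  rw [baseChange_ad] at hx
  refine hJ.not_height_one (a := 1 ⊗ₜ a) (y := 1 ⊗ₜ y) (s := 1 ⊗ₜ (ad K a y)) (ν := 0) ?_ ?_ ?_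
    hx hx0 hμ
  · rw [← baseChange_ad, LinearMap.baseChange_tmul, zero_smul, zero_add]
  · rw [← baseChange_ad, LinearMap.baseChange_tmul, hy, zero_smul, TensorProduct.tmul_zero]
  · intro h0
    exact hy' (one_tmul_injective (K := K) (h0.trans (TensorProduct.tmul_zero _ _).symm))

/-- Semisimplicity over the algebraic closure has two sources: for `μ = 0` it is the hypothesis
`N(a) = C(a)`, transferred by flatness, and for `μ ≠ 0` it is `not_height_one`, with the image `s =
ad a v - μ v` also in the role of `x`. -/
lemma eigAlg_eq_torsionSet {a : A} (h : nilAlg (ad K a) = kerAlg (ad K a)) :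
    (eigAlg (ad K a) : Set A) = torsionSet (ad K a) := by
  refine (eigAlg_subset_torsionSet _).antisymm (torsionSet_subset_eigAlg _ fun μ v hv => ?_)
  by_cases hμ : μ = 0
  · subst hμ
    simp only [zero_smul, sub_zero] at hv ⊢
    refine baseChange_eq_zero_of_ker_le (f := ad K a ^ (1 + 1)) (g := ad K a) ?_ ?_
    · change _ ≤ kerAlg (ad K a)
      rw [← h]
      exact le_iSup (fun i => LinearMap.ker (ad K a ^ (i + 1))) 1
    · rw [pow_succ, pow_one, LinearMap.baseChange_mul]
      exact hv
  · by_contra hne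
    rw [baseChange_ad] at hv hne
    exact hJ.not_height_one (y := v) (ν := μ) (by abel) hv (sub_ne_zero.2 hne) hv
      (sub_ne_zero.2 hne) hμ

lemma mem_delta_of_nilAlg_ne {a : A} (ha : a ∈ nonCentral K A)
    (h : nilAlg (ad K a) ≠ kerAlg (ad K a)) :
    (nilAlg (ad K a) = ⊤ → a ∈ Delta1 K A) ∧ (nilAlg (ad K a) ≠ ⊤ → a ∈ Delta2 K A) :=
  ⟨fun h1 => ⟨ha, h1, hJ.eigAlg_eq_kerAlg h⟩, fun h1 => ⟨ha, h.symm, h1, hJ.eigAlg_eq_kerAlg h⟩⟩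

lemma mem_delta_of_eigAlg_ne {a : A} (ha : a ∈ nonCentral K A)
    (h : nilAlg (ad K a) = kerAlg (ad K a)) (h' : eigAlg (ad K a) ≠ kerAlg (ad K a)) :
    (eigAlg (ad K a) = ⊤ → a ∈ Delta3 K A) ∧ (eigAlg (ad K a) ≠ ⊤ → a ∈ Delta4 K A) := by
  refine ⟨fun h1 => ⟨ha, h, h1⟩, fun h1 => ⟨ha, h, h'.symm, hJ.eigAlg_eq_torsionSet h, ?_⟩⟩
  rw [← hJ.eigAlg_eq_torsionSet h]
  exact fun h2 => h1 (SetLike.coe_injective h2)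

theorem admitsDixmierPartition : AdmitsDixmierPartition K A := by
  apply Set.Subset.antisymm
  · intro a ha
    by_cases h : nilAlg (ad K a) = kerAlg (ad K a)
    · by_cases h' : eigAlg (ad K a) = kerAlg (ad K a)
      · exact Or.inr ⟨ha, h.trans h'.symm, h'⟩
      · have := hJ.mem_delta_of_eigAlg_ne ha h h'
        by_cases h1 : eigAlg (ad K a) = ⊤
        · exact Or.inl (Or.inl (Or.inr (this.1 h1)))
        · exact Or.inl (Or.inr (this.2 h1))
    · have := hJ.mem_delta_of_nilAlg_ne ha h
      by_cases h1 : nilAlg (ad K a) = ⊤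
      · exact Or.inl (Or.inl (Or.inl (Or.inl (this.1 h1))))
      · exact Or.inl (Or.inl (Or.inl (Or.inr (this.2 h1))))
  · rintro a ((((h | h) | h) | h) | h) <;> exact h.1

lemma mem_scaledCoset {b c : A} (hbc : Commute b c)
    (hc : c ∈ nonCentral K A) (hb' : eigAlg (ad K b) ≠ kerAlg (ad K b))
    (hc' : eigAlg (ad K c) ≠ kerAlg (ad K c)) : c ∈ scaledCoset K A b := by
  obtain ⟨μ, hμ, x, hx0, hx⟩ := exists_eigenvector_of_eigAlg_ne_kerAlg _ hb'
  obtain ⟨μ', hμ', x', hx0', hx'⟩ := exists_eigenvector_of_eigAlg_ne_kerAlg _ hc'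
  rw [baseChange_ad] at hx hx'
  have hcomm : Commute ((1 : AlgebraicClosure K) ⊗ₜ[K] b) ((1 : AlgebraicClosure K) ⊗ₜ[K] c) :=
    hbc.map (Algebra.TensorProduct.includeRight : A →ₐ[K] AlgebraicClosure K ⊗[K] A)
  obtain ⟨η, hη⟩ := hJ.exists_sub_smul_mem_center hcomm hx hx0 hμ hx' hx0' hμ'
  have hb : b ∉ Subalgebra.center K A := fun h => hb' (by
    have h1 : kerAlg (ad K b) = ⊤ := by
      rw [eq_top_iff]
      intro y _
      exact mem_kerAlg_ad.2 (Subalgebra.mem_center_iff.1 h y).symm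
    exact le_antisymm (h1 ▸ le_top) (kerAlg_le_eigAlg _))
  obtain ⟨x₀, hx₀⟩ : ∃ x₀, b * x₀ - x₀ * b ≠ 0 := by
    by_contra! hcon
    exact hb (Subalgebra.mem_center_iff.2 fun y => (sub_eq_zero.1 (hcon y)).symm)
  have h1 : (1 : AlgebraicClosure K) ⊗ₜ[K] (c * x₀ - x₀ * c) = η ⊗ₜ[K] (b * x₀ - x₀ * b) := by
    have h2 := Subring.mem_center_iff.1 hη (J (1 ⊗ₜ x₀))
    rw [← map_mul, ← map_mul] at h2
    have h3 := hJ.injective h2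
    simp only [mul_sub, sub_mul, Algebra.TensorProduct.tmul_mul_tmul, mul_one, one_mul,
      TensorProduct.smul_tmul', smul_eq_mul] at h3
    rw [TensorProduct.tmul_sub, TensorProduct.tmul_sub]
    rw [sub_eq_sub_iff_add_eq_add] at h3 ⊢
    rw [← h3, add_comm]
  -- Commutators with one `x₀` that does not commute with `b` show that `η` lies in `K`.
  obtain ⟨k, rfl, -⟩ := one_tmul_eq_tmul hx₀ h1
  have hz : c - k • b ∈ Subalgebra.center K A := by
    rw [hJ.mem_center_iff, TensorProduct.tmul_sub, TensorProduct.tmul_smul]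
    rwa [algebraMap_smul] at hη
  refine ⟨k, ?_, c - k • b, hz, by abel⟩
  rintro rfl
  rw [zero_smul, sub_zero] at hz
  exact hc hz

omit hJ [CharZero K] in
lemma ad_of_mem_scaledCoset {b c : A} (h : c ∈ scaledCoset K A b) :
    ∃ k : K, k ≠ 0 ∧ ad K c = k • ad K b := by
  obtain ⟨k, hk, z, hz, rfl⟩ := h
  refine ⟨k, hk, ?_⟩
  ext y
  have := Subalgebra.mem_center_iff.1 hz y
  simp only [ad, LinearMap.sub_apply, LinearMap.mulLeft_apply, LinearMap.mulRight_apply,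
    LinearMap.smul_apply, add_mul, mul_add, this, smul_mul_assoc, mul_smul_comm, smul_sub]
  abel

omit hJ [CharZero K] in
lemma scaledCoset_subset {a b : A} (hb : b ∈ noncentralCentralizer K A a) :
    scaledCoset K A b ⊆ noncentralCentralizer K A a := by
  rintro _ ⟨k, hk, z, hz, rfl⟩
  refine ⟨fun h => hb.1 ?_, ?_⟩
  · have h1 := Subalgebra.smul_mem _ ((Subalgebra.center K A).sub_mem h hz) k⁻¹
    rwa [add_sub_cancel_right, smul_smul, inv_mul_cancel₀ hk, one_smul] at h1
  · rw [mul_add, add_mul, mul_smul_comm, smul_mul_assoc, hb.2, Subalgebra.mem_center_iff.1 hz a]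

omit hJ [CharZero K] in
lemma mem_delta_three_of_mem_scaledCoset {b c : A} (hb : b ∈ Delta3 K A)
    (hcn : c ∈ nonCentral K A) (hc : c ∈ scaledCoset K A b) : c ∈ Delta3 K A := by
  obtain ⟨k, hk, h⟩ := ad_of_mem_scaledCoset hc
  obtain ⟨-, h1, h2⟩ := hb
  refine ⟨hcn, ?_, ?_⟩
  · rw [h, nilAlg_smul _ hk, kerAlg_smul _ hk, h1]
  · rw [h, eigAlg_smul _ hk, h2]

omit hJ [CharZero K] in
lemma mem_delta_four_of_mem_scaledCoset {b c : A} (hb : b ∈ Delta4 K A)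
    (hcn : c ∈ nonCentral K A) (hc : c ∈ scaledCoset K A b) : c ∈ Delta4 K A := by
  obtain ⟨k, hk, h⟩ := ad_of_mem_scaledCoset hc
  obtain ⟨-, h1, h2, h3, h4⟩ := hb
  refine ⟨hcn, ?_, ?_, ?_, ?_⟩
  · rw [h, nilAlg_smul _ hk, kerAlg_smul _ hk, h1]
  · rwa [h, eigAlg_smul _ hk, kerAlg_smul _ hk]
  · rw [h, eigAlg_smul _ hk, torsionSet_smul _ hk, h3]
  · rwa [h, torsionSet_smul _ hk]

/-- On `C(a) \ Z(A)` both `N` and `C` are constant. If they differ, all elements are nilpotent of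
the same kind. If they agree, any two nongeneric elements lie in one coset by `mem_scaledCoset`. -/
lemma exists_hasHomogeneousType {a : A} (ha : a ∈ nonCentral K A) :
    ∃ i, HasHomogeneousType K A (noncentralCentralizer K A a) i := by
  by_cases h : nilAlg (ad K a) = kerAlg (ad K a)
  · have hall : ∀ b ∈ noncentralCentralizer K A a, nilAlg (ad K b) = kerAlg (ad K b) :=
      fun b hb => by rw [hJ.nilAlg_eq ha hb.1 hb.2, hJ.kerAlg_eq ha hb.1 hb.2, h]
    by_cases hex : ∃ b ∈ noncentralCentralizer K A a, eigAlg (ad K b) ≠ kerAlg (ad K b)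
    · obtain ⟨b, hb, hbe⟩ := hex
      have hcos := scaledCoset_subset hb
      have hrest : noncentralCentralizer K A a \ scaledCoset K A b ⊆ Delta5 K A := by
        rintro c ⟨hc, hcb⟩
        have hce : eigAlg (ad K c) = kerAlg (ad K c) := by
          by_contra hce
          exact hcb (hJ.mem_scaledCoset (hJ.commute_of_commute ha hb.2 hc.2) hc.1 hbe hce)
        exact ⟨hc.1, (hall c hc).trans hce.symm, hce⟩
      have hd := hJ.mem_delta_of_eigAlg_ne hb.1 (hall b hb) hbe
      by_cases ht : eigAlg (ad K b) = ⊤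
      · exact ⟨2, b, hd.1 ht, hcos, fun c hc =>
          mem_delta_three_of_mem_scaledCoset (hd.1 ht) (hcos hc).1 hc, hrest⟩
      · exact ⟨3, b, hd.2 ht, hcos, fun c hc =>
          mem_delta_four_of_mem_scaledCoset (hd.2 ht) (hcos hc).1 hc, hrest⟩
    · push Not at hex
      exact ⟨4, fun b hb => ⟨hb.1, (hall b hb).trans (hex b hb).symm, hex b hb⟩⟩
  · have hall : ∀ b ∈ noncentralCentralizer K A a, nilAlg (ad K b) ≠ kerAlg (ad K b) :=
      fun b hb => by rw [hJ.nilAlg_eq ha hb.1 hb.2, hJ.kerAlg_eq ha hb.1 hb.2]; exact h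
    by_cases ht : nilAlg (ad K a) = ⊤
    · refine ⟨0, fun b hb => (hJ.mem_delta_of_nilAlg_ne hb.1 (hall b hb)).1 ?_⟩
      rw [hJ.nilAlg_eq ha hb.1 hb.2, ht]
    · refine ⟨1, fun b hb => (hJ.mem_delta_of_nilAlg_ne hb.1 (hall b hb)).2 ?_⟩
      rwa [hJ.nilAlg_eq ha hb.1 hb.2]

theorem satisfiesHCC : SatisfiesHCC K A := by
  refine ⟨hJ.noncommutative, hJ.admitsDixmierPartition, fun a ha => ?_⟩
  obtain ⟨i, hi⟩ := hJ.exists_hasHomogeneousType ha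
  have hne : (noncentralCentralizer K A a).Nonempty := ⟨a, ha, rfl⟩
  exact ⟨i, hi, fun j hj => HasHomogeneousType.unique hne hj hi⟩

end SmallEmbedding

end Types

end DixmierTypes

/-! ### Rational functions with a shift. -/

namespace SkewLaurent

open Polynomial

section RationalFunctions

lemma zpow_apply_of_map_eq_sub_one {E F : Type*} [Field E] [Field F] [Algebra E F] {σ : F ≃ₐ[E] F}
    {h : F} (hh : σ h = h - 1) (m : ℤ) : (σ ^ m) h = h - m := by
  have hh' : σ⁻¹ h = h + 1 := by
    apply σ.injective
    rw [map_add, map_one, hh, sub_add_cancel, ← AlgEquiv.mul_apply, mul_inv_cancel]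
    rfl
  induction m using Int.induction_on with
  | zero => simp
  | succ n ih => rw [zpow_add_one, AlgEquiv.mul_apply, hh, map_sub, ih, map_one]; push_cast; ring
  | pred n ih => rw [zpow_sub_one, AlgEquiv.mul_apply, hh', map_add, ih, map_one]; push_cast; ring

lemma linearIndependent_pow_of_transcendental {E F : Type*} [Field E] [Field F] [Algebra E F]
    {c : F} (hc : Transcendental E c) : LinearIndependent E fun n : ℕ => c ^ n := by
  have := (Polynomial.basisMonomials E).linearIndependent.map' (aeval (R := E) c).toLinearMap
    (LinearMap.ker_eq_bot.2 (transcendental_iff_injective.1 hc))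
  have heq : (fun n : ℕ => c ^ n) =
      (aeval (R := E) c).toLinearMap ∘ Polynomial.basisMonomials E := by
    ext n
    simp
  rw [heq]
  exact this

lemma algebraMap_eq_aeval {E F : Type*} [Field E] [Field F] [Algebra E F] [Algebra E[X] F]
    [IsScalarTower E E[X] F] (p : E[X]) :
    algebraMap E[X] F p = aeval (algebraMap E[X] F X) p := by
  rw [aeval_algebraMap_apply, aeval_X_left_apply]

lemma transcendental_algebraMap_X (E : Type*) [Field E] :
    Transcendental E (algebraMap E[X] (FractionRing E[X]) X) := by
  rw [transcendental_iff]
  intro p hp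
  rw [← algebraMap_eq_aeval] at hp
  exact (IsFractionRing.injective E[X] (FractionRing E[X])) (hp.trans (map_zero _).symm)

variable (k : Type*) [Field k]

/-- The automorphism of the field of rational functions with `X ↦ X - 1`. -/
def shift : FractionRing k[X] ≃ₐ[k] FractionRing k[X] :=
  IsFractionRing.fieldEquivOfAlgEquiv (A := k) k (FractionRing k[X]) (FractionRing k[X]) (taylorEquiv (-1))

lemma shift_X : shift k (algebraMap k[X] _ X) = algebraMap k[X] _ X - 1 := by
  rw [shift, IsFractionRing.fieldEquivOfAlgEquiv_algebraMap]
  have : taylorEquiv (-1 : k) X = X - 1 := by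
    change taylor _ _ = _
    rw [taylor_X, map_neg, map_one, sub_eq_add_neg]
  rw [this, map_sub, map_one]

lemma shift_zpow_X (m : ℤ) :
    (shift k ^ m) (algebraMap k[X] _ X) = algebraMap k[X] _ X - (m : FractionRing k[X]) :=
  zpow_apply_of_map_eq_sub_one (shift_X k) m

variable {k}

lemma shift_zpow_algebraMap (m : ℤ) (p : k[X]) :
    (shift k ^ m) (algebraMap k[X] _ p) = algebraMap k[X] _ (taylor (-m : k) p) := by
  have h : ((shift k ^ m : FractionRing k[X] ≃ₐ[k] FractionRing k[X]) :
      FractionRing k[X] →ₐ[k] FractionRing k[X]).comp (Algebra.algHom k k[X] (FractionRing k[X])) =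
      (Algebra.algHom k k[X] (FractionRing k[X])).comp (taylorAlgHom (-m : k)) := by
    ext
    change (shift k ^ m) (algebraMap k[X] _ X) = algebraMap k[X] _ (taylor (-m : k) X)
    rw [shift_zpow_X, taylor_X, map_add, map_neg, map_neg, sub_eq_add_neg, map_intCast, map_intCast]
  exact congrArg (fun f : k[X] →ₐ[k] FractionRing k[X] => f p) h

/-- The polynomial takes one value at all the points `n t`, which are infinitely many in
characteristic zero. -/
lemma eq_C_of_taylor_eq [CharZero k] {t : k} (ht : t ≠ 0) {p : k[X]} (h : taylor t p = p) :
    p = C (p.eval 0) := by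
  have h1 : ∀ n : ℕ, p.eval (n * t) = p.eval 0 := by
    intro n
    induction n with
    | zero => simp
    | succ n ih =>
      rw [← ih]
      conv_rhs => rw [← h, taylor_eval]
      congr 1
      push_cast
      ring
  refine eq_of_infinite_eval_eq _ _ (Set.Infinite.mono (s := Set.range fun n : ℕ => (n : k) * t)
    ?_ (Set.infinite_range_of_injective fun m n hmn => ?_))
  · rintro _ ⟨n, rfl⟩
    simp [h1 n]
  · exact_mod_cast mul_right_cancel₀ ht hmn

/-- For a reduced fraction `p / q`, invariance makes `q` divide its translate, which has the same
degree and leading coefficient. So `q`, and then `p`, is translation invariant, hence constant. -/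
lemma mem_range_of_shift_zpow_eq [CharZero k] {m : ℤ} (hm : m ≠ 0) {f : FractionRing k[X]}
    (hf : (shift k ^ m) f = f) : f ∈ Set.range (algebraMap k (FractionRing k[X])) := by
  obtain ⟨p, q, hpq, rfl⟩ := IsFractionRing.exists_reduced_fraction (A := k[X]) f
  have hq0 : (q : k[X]) ≠ 0 := nonZeroDivisors.ne_zero q.2
  have ht : (-m : k) ≠ 0 := neg_ne_zero.2 (Int.cast_ne_zero.2 hm)
  have hinj := IsFractionRing.injective k[X] (FractionRing k[X])
  rw [IsFractionRing.mk'_eq_div, map_div₀, shift_zpow_algebraMap, shift_zpow_algebraMap,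
    div_eq_div_iff, ← map_mul, ← map_mul, hinj.eq_iff] at hf
  rotate_left
  · rw [Ne, hinj.eq_iff' (map_zero _)]
    exact fun h => hq0 (taylor_injective _ (h.trans (map_zero _).symm))
  · rwa [Ne, hinj.eq_iff' (map_zero _)]
  have hcop : IsCoprime (q : k[X]) p := (isRelPrime_iff_isCoprime.1 hpq).symm
  have hdvd : (q : k[X]) ∣ taylor (-m : k) (q : k[X]) :=
    hcop.dvd_of_dvd_mul_left (by rw [← hf]; exact dvd_mul_left _ _)
  have hq : taylor (-m : k) (q : k[X]) = q :=
    (eq_of_dvd_of_natDegree_le_of_leadingCoeff hdvd (natDegree_taylor _ _).le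
      (leadingCoeff_taylor _ _).symm).symm
  rw [hq] at hf
  have hp := mul_right_cancel₀ hq0 hf
  refine ⟨p.eval 0 / (q : k[X]).eval 0, ?_⟩
  rw [IsFractionRing.mk'_eq_div, eq_C_of_taylor_eq ht hp, eq_C_of_taylor_eq ht hq, map_div₀]
  simp only [eval_C]
  rfl

end RationalFunctions

/-- The field `F` consists of the rational functions in `c` and `h` over `E`, as far as the
automorphism `σ` of `F` with `σ c = c` and `σ h = h - 1` is concerned. -/
structure IsShift {E F : Type*} [Field E] [Field F] [Algebra E F] (σ : F ≃ₐ[E] F) (c h : F) :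
    Prop where
  linearIndependent : LinearIndependent E fun p : ℕ × ℕ => c ^ p.1 * h ^ p.2
  map_left : σ c = c
  map_right : σ h = h - 1
  fixed : ∀ m : ℤ, m ≠ 0 → ∀ f, (σ ^ m) f = f → ∃ p q : E[X], f = aeval c p / aeval c q

variable (E : Type u) [Field E] [CharZero E]

/-- Take `F = k(X)` over `k = E(c)` with the shift `X ↦ X - 1`: the elements fixed by a nontrivial
power form `k`. -/
theorem exists_isShift : ∃ (F : Type u) (_ : Field F) (_ : Algebra E F) (σ : F ≃ₐ[E] F) (c h : F),
    IsShift σ c h := by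
  let k := FractionRing E[X]
  let F := FractionRing k[X]
  have : CharZero k := charZero_of_injective_algebraMap (algebraMap E k).injective
  let σ : F ≃ₐ[E] F := AlgEquiv.restrictScalarsHom E (shift k)
  have hσ : ∀ m : ℤ, ∀ f, (σ ^ m) f = (shift k ^ m) f := fun m f => by
    rw [← map_zpow (AlgEquiv.restrictScalarsHom E) (shift k) m]
    rfl
  let c' : k := algebraMap E[X] k X
  refine ⟨F, inferInstance, inferInstance, σ, algebraMap k F c', algebraMap k[X] F X, ?_, ?_, ?_,
    ?_⟩
  · have := linearIndependent_smul
      (linearIndependent_pow_of_transcendental (transcendental_algebraMap_X E))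
      (linearIndependent_pow_of_transcendental (transcendental_algebraMap_X k))
    simpa only [Algebra.smul_def, map_pow] using this
  · exact (shift k).commutes _
  · exact shift_X k
  · intro m hm f hf
    rw [hσ] at hf
    obtain ⟨z, rfl⟩ := mem_range_of_shift_zpow_eq hm hf
    obtain ⟨p, q, -, rfl⟩ := IsFractionRing.div_surjective (A := E[X]) z
    refine ⟨p, q, ?_⟩
    rw [map_div₀, algebraMap_eq_aeval p, algebraMap_eq_aeval q]
    exact (congrArg₂ (· / ·) (aeval_algebraMap_apply F c' p) (aeval_algebraMap_apply F c' q)).symm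

end SkewLaurent

/-! ### The enveloping algebra by generators and relations. -/

namespace DixmierTypes

attribute [local instance 100] LieRing.ofAssociativeRing LieAlgebra.ofAssociativeAlgebra

section Relations

variable (K : Type*) [Field K]

lemma genH_mul_genX [CharZero K] : genH K * genX K = genX K * genH K + genX K := by
  rw [← sub_eq_iff_eq_add', genH, genX, ← LieRing.of_associative_ring_bracket, ← LieHom.map_lie]
  congr 1
  ext i j
  rw [LieAlgebra.SpecialLinear.sl_bracket]
  fin_cases i <;> fin_cases j <;> simp [Matrix.mul_apply, Matrix.single]
  norm_num

lemma genH_mul_genY [CharZero K] : genH K * genY K = genY K * genH K + -genY K := by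
  rw [← sub_eq_iff_eq_add', genH, genY, ← LieRing.of_associative_ring_bracket, ← LieHom.map_lie,
    ← map_neg]
  congr 1
  ext i j
  rw [LieAlgebra.SpecialLinear.sl_bracket]
  fin_cases i <;> fin_cases j <;> simp [Matrix.mul_apply, Matrix.single]
  norm_num

lemma genX_mul_genY [CharZero K] : genX K * genY K = genY K * genX K + (2 : K) • genH K := by
  rw [← sub_eq_iff_eq_add', genH, genX, genY, ← LieRing.of_associative_ring_bracket,
    ← LieHom.map_lie, ← map_smul]
  congr 1
  ext i j
  rw [LieAlgebra.SpecialLinear.sl_bracket]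
  fin_cases i <;> fin_cases j <;> simp [Matrix.mul_apply, Matrix.single]

variable {K} {B : Type*} [Ring B] [Algebra K B]

lemma apply_one_one (a : LieAlgebra.SpecialLinear.sl (Fin 2) K) : a.1 1 1 = -a.1 0 0 := by
  have h : Matrix.trace a.1 = 0 := a.2
  rw [Matrix.trace_fin_two] at h
  exact eq_neg_of_add_eq_zero_right h

/-- The Lie algebra map from `sl(2)` given by three elements with the relations of `X, Y, H`. -/
def slHom {x y h : B} (hx : h * x = x * h + x) (hy : h * y = y * h + -y)
    (hxy : x * y = y * x + (2 : K) • h) : LieAlgebra.SpecialLinear.sl (Fin 2) K →ₗ⁅K⁆ B where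
  -- The factor `2` is due to `H` having diagonal entry `1 / 2`.
  toFun a := (a.1 0 1) • x + (a.1 1 0) • y + (2 * a.1 0 0) • h
  map_add' a b := by
    simp [add_smul, mul_add]
    abel
  map_smul' r a := by
    simp [mul_smul, smul_add, smul_comm (2 : K) r]
  map_lie' {a b} := by
    rw [LieAlgebra.SpecialLinear.sl_bracket]
    simp only [Matrix.sub_apply, Matrix.mul_apply, Fin.sum_univ_two, apply_one_one,
      LieRing.of_associative_ring_bracket, add_mul, mul_add, smul_mul_assoc, mul_smul_comm,
      hx, hy, hxy]
    module

/-- The algebra map from `U(sl(2))` given by three elements with the relations of `X, Y, H`. -/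
def usl2Hom {x y h : B} (hx : h * x = x * h + x) (hy : h * y = y * h + -y)
    (hxy : x * y = y * x + (2 : K) • h) : Usl2 K →ₐ[K] B :=
  UniversalEnvelopingAlgebra.lift K (slHom hx hy hxy)

section

variable {x y h : B} (hx : h * x = x * h + x) (hy : h * y = y * h + -y)
  (hxy : x * y = y * x + (2 : K) • h)

lemma usl2Hom_genX : usl2Hom hx hy hxy (genX K) = x := by
  rw [usl2Hom, genX, UniversalEnvelopingAlgebra.lift_ι_apply]
  simp [slHom, Matrix.single]

lemma usl2Hom_genY : usl2Hom hx hy hxy (genY K) = y := by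
  rw [usl2Hom, genY, UniversalEnvelopingAlgebra.lift_ι_apply]
  simp [slHom, Matrix.single]

lemma usl2Hom_genH [CharZero K] : usl2Hom hx hy hxy (genH K) = h := by
  rw [usl2Hom, genH, UniversalEnvelopingAlgebra.lift_ι_apply]
  simp [slHom, Matrix.single]

end

lemma ι_mem [CharZero K] (S : Subalgebra K (Usl2 K)) (hX : genX K ∈ S) (hY : genY K ∈ S)
    (hH : genH K ∈ S) (a : LieAlgebra.SpecialLinear.sl (Fin 2) K) :
    UniversalEnvelopingAlgebra.ι K a ∈ S := by
  have h : a = a.1 0 1 • LieAlgebra.SpecialLinear.single (0 : Fin 2) (1 : Fin 2) (by decide) (1 : K)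
      + a.1 1 0 • LieAlgebra.SpecialLinear.single (1 : Fin 2) (0 : Fin 2) (by decide) (1 : K)
      + (2 * a.1 0 0) •
        LieAlgebra.SpecialLinear.singleSubSingle (0 : Fin 2) (1 : Fin 2) (1 / 2 : K) := by
    ext i j
    have := apply_one_one a
    fin_cases i <;> fin_cases j <;> simp [Matrix.single] <;> grind
  rw [h, map_add, map_add, map_smul, map_smul, map_smul]
  exact S.add_mem (S.add_mem (S.smul_mem hX _) (S.smul_mem hY _)) (S.smul_mem hH _)

/-- The universal property lifts the corestricted `ι` to a map `U → S` which, followed by the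
inclusion, is the identity. -/
theorem eq_top_of_generators_mem [CharZero K] (S : Subalgebra K (Usl2 K)) (hX : genX K ∈ S)
    (hY : genY K ∈ S) (hH : genH K ∈ S) : S = ⊤ := by
  let f : LieAlgebra.SpecialLinear.sl (Fin 2) K →ₗ⁅K⁆ S :=
    { ((UniversalEnvelopingAlgebra.ι K : LieAlgebra.SpecialLinear.sl (Fin 2) K →ₗ⁅K⁆ Usl2 K) :
        LieAlgebra.SpecialLinear.sl (Fin 2) K →ₗ[K] Usl2 K).codRestrict (Subalgebra.toSubmodule S)
        (ι_mem S hX hY hH) with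
      map_lie' := fun {a b} => Subtype.ext (LieHom.map_lie _ a b) }
  have h : S.val.comp (UniversalEnvelopingAlgebra.lift K f) = AlgHom.id K _ := by
    refine UniversalEnvelopingAlgebra.hom_ext K (LieHom.ext fun a => ?_)
    change S.val (UniversalEnvelopingAlgebra.lift K f (UniversalEnvelopingAlgebra.ι K a)) = _
    rw [UniversalEnvelopingAlgebra.lift_ι_apply]
    rfl
  refine eq_top_iff.2 fun u _ => ?_
  have hu : S.val (UniversalEnvelopingAlgebra.lift K f u) = u :=
    congrArg (fun g : Usl2 K →ₐ[K] Usl2 K => g u) h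
  rw [← hu]
  exact (UniversalEnvelopingAlgebra.lift K f u).2

end Relations

end DixmierTypes

/-! ### The Casimir element and a filtration of cubic growth. -/

namespace DixmierTypes

open Polynomial

section Filtration

lemma mul_aeval_eq_aeval_taylor_mul {K B : Type*} [Field K] [Ring B] [Algebra K B] {x h : B} {r : K}
    (hx : x * h = (h + algebraMap K B r) * x) (p : K[X]) :
    x * aeval h p = aeval h (taylor r p) * x := by
  induction p using Polynomial.induction_on with
  | C a => rw [aeval_C, taylor_C, aeval_C, Algebra.commutes]
  | add p q hp hq => rw [map_add, map_add, map_add, mul_add, add_mul, hp, hq]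
  | monomial n a ih =>
    have ht : taylor r (C a * X ^ n * X) = taylor r (C a * X ^ n) * (X + C r) := by
      rw [taylor_mul, taylor_X]
    rw [pow_succ, ← mul_assoc, map_mul, aeval_X, ← mul_assoc, ih, ht, map_mul (aeval h), map_add,
      aeval_X, aeval_C, mul_assoc, hx, mul_assoc]

variable (K : Type*) [Field K] [CharZero K]

/-- The commutator equals, identically in a free ring, a combination of multiples of the defining
relations; likewise for `H` and `Y`. -/
lemma casimir_commute_genX : Commute (casimir K) (genX K) := by
  have h1 := sub_eq_zero.2 (genH_mul_genX K)
  have h3 := sub_eq_zero.2 (genX_mul_genY K)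
  rw [Commute, SemiconjBy, ← sub_eq_zero, casimir]
  have : (genY K * genX K + genH K * (genH K + 1)) * genX K -
      genX K * (genY K * genX K + genH K * (genH K + 1)) =
      genH K * (genH K * genX K - (genX K * genH K + genX K)) +
      (genH K * genX K - (genX K * genH K + genX K)) * genH K -
      (genX K * genY K - (genY K * genX K + (2 : K) • genH K)) * genX K := by
    rw [two_smul]
    noncomm_ring
  rw [this, h1, h3]
  simp

lemma casimir_commute_genH : Commute (casimir K) (genH K) := by
  have h1 := sub_eq_zero.2 (genH_mul_genX K)
  have h2 := sub_eq_zero.2 (genH_mul_genY K)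
  rw [Commute, SemiconjBy, eq_comm, ← sub_eq_zero, casimir]
  have : genH K * (genY K * genX K + genH K * (genH K + 1)) -
      (genY K * genX K + genH K * (genH K + 1)) * genH K =
      (genH K * genY K - (genY K * genH K + -genY K)) * genX K +
      genY K * (genH K * genX K - (genX K * genH K + genX K)) := by
    noncomm_ring
  rw [this, h1, h2]
  simp

lemma casimir_commute_genY : Commute (casimir K) (genY K) := by
  have h2 := sub_eq_zero.2 (genH_mul_genY K)
  have h3 := sub_eq_zero.2 (genX_mul_genY K)
  rw [Commute, SemiconjBy, ← sub_eq_zero, casimir]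
  have : (genY K * genX K + genH K * (genH K + 1)) * genY K -
      genY K * (genY K * genX K + genH K * (genH K + 1)) =
      genH K * (genH K * genY K - (genY K * genH K + -genY K)) +
      (genH K * genY K - (genY K * genH K + -genY K)) * genH K +
      genY K * (genX K * genY K - (genY K * genX K + (2 : K) • genH K)) := by
    rw [two_smul]
    noncomm_ring
  rw [this, h2, h3]
  simp

theorem casimir_commute (u : Usl2 K) : Commute (casimir K) u := by
  have h := eq_top_of_generators_mem (Subalgebra.centralizer K {casimir K})
    (Subalgebra.mem_centralizer_iff K |>.2 fun _ h => h ▸ casimir_commute_genX K)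
    (Subalgebra.mem_centralizer_iff K |>.2 fun _ h => h ▸ casimir_commute_genY K)
    (Subalgebra.mem_centralizer_iff K |>.2 fun _ h => h ▸ casimir_commute_genH K)
  have hu : u ∈ Subalgebra.centralizer K {casimir K} := by
    rw [h]
    exact Algebra.mem_top
  exact (Subalgebra.mem_centralizer_iff K).1 hu _ rfl

/-- The powers of `X`, and those of `Y` with negative exponents. -/
def genPow : ℤ → Usl2 K
  | Int.ofNat n => genX K ^ n
  | Int.negSucc n => genY K ^ (n + 1)

lemma genX_mul_genY_eq : genX K * genY K = casimir K - genH K * (genH K - 1) := by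
  rw [genX_mul_genY, casimir, two_smul]
  noncomm_ring

omit [CharZero K] in
lemma genY_mul_genX_eq : genY K * genX K = casimir K - genH K * (genH K + 1) := by
  rw [casimir]
  noncomm_ring

/-- Multiplication by `X` either lengthens a power of `X` or cancels one `Y`, at the cost of the
factor `X Y = C - H (H - 1)`. The drop of `natAbs` by one offsets part of that factor's degree two.
-/
lemma genX_mul_genPow (n : ℤ) : genX K * genPow K n = genPow K (n + 1) ∨
    (genX K * genPow K n = (casimir K - genH K * (genH K - 1)) * genPow K (n + 1) ∧
      n.natAbs = (n + 1).natAbs + 1) := by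
  cases n with
  | ofNat n => exact Or.inl (pow_succ' _ n).symm
  | negSucc n =>
    refine Or.inr ⟨?_, by omega⟩
    cases n with
    | zero =>
      change genX K * genY K ^ (0 + 1) = _ * genX K ^ 0
      rw [zero_add, pow_one, pow_zero, mul_one, genX_mul_genY_eq]
    | succ n =>
      change genX K * genY K ^ (n + 1 + 1) = _ * genY K ^ (n + 1)
      rw [pow_succ' _ (n + 1), ← mul_assoc, genX_mul_genY_eq]

omit [CharZero K] in
lemma genY_mul_genPow (n : ℤ) : genY K * genPow K n = genPow K (n - 1) ∨
    (genY K * genPow K n = (casimir K - genH K * (genH K + 1)) * genPow K (n - 1) ∧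
      n.natAbs = (n - 1).natAbs + 1) := by
  cases n with
  | ofNat n =>
    cases n with
    | zero =>
      refine Or.inl ?_
      change genY K * genX K ^ 0 = genY K ^ (0 + 1)
      simp
    | succ n =>
      rw [show Int.ofNat (n + 1) - 1 = Int.ofNat n by simp]
      refine Or.inr ⟨?_, rfl⟩
      change genY K * genX K ^ (n + 1) = _ * genX K ^ n
      rw [pow_succ' _ n, ← mul_assoc, genY_mul_genX_eq]
  | negSucc n => exact Or.inl (pow_succ' _ (n + 1)).symm

/-- The elements of degree at most `N`, where `C` has degree `2` and `X, Y, H` have degree `1`. -/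
def filtration (N : ℕ) : Submodule K (Usl2 K) :=
  Submodule.span K {u | ∃ (a : ℕ) (p : K[X]) (n : ℤ), 2 * a + p.natDegree + n.natAbs ≤ N ∧
    u = casimir K ^ a * (aeval (genH K) p * genPow K n)}

variable {K}

omit [CharZero K] in
lemma mem_filtration {N a : ℕ} {p : K[X]} {n : ℤ} (h : 2 * a + p.natDegree + n.natAbs ≤ N) :
    casimir K ^ a * (aeval (genH K) p * genPow K n) ∈ filtration K N :=
  Submodule.subset_span ⟨a, p, n, h, rfl⟩

omit [CharZero K] in
lemma filtration_mono {M N : ℕ} (h : M ≤ N) : filtration K M ≤ filtration K N :=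
  Submodule.span_mono fun _ ⟨a, p, n, h1, h2⟩ => ⟨a, p, n, h1.trans h, h2⟩

omit [CharZero K] in
lemma one_mem_filtration : (1 : Usl2 K) ∈ filtration K 0 := by
  have := mem_filtration (K := K) (N := 0) (a := 0) (p := 1) (n := 0) (by simp)
  simpa [genPow] using this

omit [CharZero K] in
lemma mul_mem_filtration_of_forall {g : Usl2 K} {M N : ℕ}
    (h : ∀ (a : ℕ) (p : K[X]) (n : ℤ), 2 * a + p.natDegree + n.natAbs ≤ N →
      g * (casimir K ^ a * (aeval (genH K) p * genPow K n)) ∈ filtration K M)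
    {v : Usl2 K} (hv : v ∈ filtration K N) : g * v ∈ filtration K M := by
  have : filtration K N ≤ (filtration K M).comap (LinearMap.mulLeft K g) :=
    Submodule.span_le.2 fun _ ⟨a, p, n, h1, h2⟩ => h2 ▸ h a p n h1
  exact this hv

omit [CharZero K] in
lemma casimir_mul_mem {N : ℕ} {v : Usl2 K} (hv : v ∈ filtration K N) :
    casimir K * v ∈ filtration K (N + 2) :=
  mul_mem_filtration_of_forall (fun a p n h => by
    rw [← mul_assoc, ← pow_succ']
    exact mem_filtration (by omega)) hv

lemma genH_mul_mem {N : ℕ} {v : Usl2 K} (hv : v ∈ filtration K N) :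
    genH K * v ∈ filtration K (N + 1) :=
  mul_mem_filtration_of_forall (fun a p n h => by
    have h1 : genH K * (casimir K ^ a * (aeval (genH K) p * genPow K n)) =
        casimir K ^ a * (aeval (genH K) (X * p) * genPow K n) := by
      rw [← mul_assoc, ← ((casimir_commute K (genH K)).pow_left a).eq, map_mul, aeval_X]
      simp only [mul_assoc]
    rw [h1]
    have : (X * p).natDegree ≤ 1 + p.natDegree := natDegree_mul_le.trans (by simp)
    exact mem_filtration (by omega)) hv

/-- The common argument for `X` and `Y`: moving `g` past a polynomial in `H` only translates it.
When a cancellation occurs, the degree rises by `2` through `C` or `q` and falls by `1` through the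
power, so it grows by one in total. -/
lemma mul_generator_mem {g : Usl2 K} {r : K} {m n : ℤ}
    (hg : g * genH K = (genH K + algebraMap K _ r) * g)
    (hn : g * genPow K n = genPow K m ∨ ∃ q : K[X], q.natDegree ≤ 2 ∧
      g * genPow K n = (casimir K - aeval (genH K) q) * genPow K m ∧ n.natAbs = m.natAbs + 1)
    (hmn : m.natAbs ≤ n.natAbs + 1) {a N : ℕ} {p : K[X]}
    (h : 2 * a + p.natDegree + n.natAbs ≤ N) :
    g * (casimir K ^ a * (aeval (genH K) p * genPow K n)) ∈ filtration K (N + 1) := by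
  have h1 : g * (casimir K ^ a * (aeval (genH K) p * genPow K n)) =
      casimir K ^ a * (aeval (genH K) (taylor r p) * (g * genPow K n)) := by
    rw [← mul_assoc, ← ((casimir_commute K g).pow_left a).eq, mul_assoc, ← mul_assoc g,
      mul_aeval_eq_aeval_taylor_mul hg, mul_assoc]
  have hd := natDegree_taylor p r
  rw [h1]
  rcases hn with hn | ⟨q, hq, hn, hm⟩
  · rw [hn]
    exact mem_filtration (by omega)
  · have h2 : casimir K ^ a * (aeval (genH K) (taylor r p) * (g * genPow K n)) =
        casimir K ^ (a + 1) * (aeval (genH K) (taylor r p) * genPow K m) -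
        casimir K ^ a * (aeval (genH K) (taylor r p * q) * genPow K m) := by
      rw [hn, sub_mul, mul_sub, mul_sub, pow_succ, map_mul, mul_assoc (casimir K ^ a),
        ← mul_assoc (casimir K), (casimir_commute K (aeval (genH K) (taylor r p))).eq]
      simp only [mul_assoc]
    rw [h2]
    have := natDegree_mul_le (p := taylor r p) (q := q)
    exact Submodule.sub_mem _ (mem_filtration (by omega)) (mem_filtration (by omega))

lemma genX_mul_mem {N : ℕ} {v : Usl2 K} (hv : v ∈ filtration K N) :
    genX K * v ∈ filtration K (N + 1) :=
  mul_mem_filtration_of_forall (fun a p n h => by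
    refine mul_generator_mem (r := -1) (m := n + 1) ?_ ?_ (by omega) h
    · rw [map_neg, map_one, add_mul, genH_mul_genX]
      noncomm_ring
    · refine (genX_mul_genPow K n).imp_right fun ⟨h1, h2⟩ => ⟨X * (X - 1), ?_, ?_, h2⟩
      · compute_degree
      · simpa using h1) hv

lemma genY_mul_mem {N : ℕ} {v : Usl2 K} (hv : v ∈ filtration K N) :
    genY K * v ∈ filtration K (N + 1) :=
  mul_mem_filtration_of_forall (fun a p n h => by
    refine mul_generator_mem (r := 1) (m := n - 1) ?_ ?_ (by omega) h
    · rw [map_one, add_mul, genH_mul_genY]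
      noncomm_ring
    · refine (genY_mul_genPow K n).imp_right fun ⟨h1, h2⟩ => ⟨X * (X + 1), ?_, ?_, h2⟩
      · compute_degree
      · simpa using h1) hv

omit [CharZero K] in
lemma pow_mul_mem_filtration {g : Usl2 K} {d : ℕ}
    (hg : ∀ N, ∀ v ∈ filtration K N, g * v ∈ filtration K (N + d)) {N : ℕ} {v : Usl2 K}
    (hv : v ∈ filtration K N) (n : ℕ) : g ^ n * v ∈ filtration K (N + d * n) := by
  induction n with
  | zero => simpa using hv
  | succ n ih =>
    rw [pow_succ', mul_assoc, mul_add, mul_one, ← add_assoc]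
    exact hg _ _ ih

theorem mul_mem_filtration {M N : ℕ} {u v : Usl2 K} (hu : u ∈ filtration K M)
    (hv : v ∈ filtration K N) : u * v ∈ filtration K (M + N) := by
  have key : filtration K M ≤ (filtration K (M + N)).comap (LinearMap.mulRight K v) := by
    refine Submodule.span_le.2 ?_
    rintro _ ⟨a, p, n, h, rfl⟩
    change casimir K ^ a * (aeval (genH K) p * genPow K n) * v ∈ filtration K (M + N)
    have h1 : genPow K n * v ∈ filtration K (N + n.natAbs) := by
      cases n with
      | ofNat n =>
        have := pow_mul_mem_filtration (fun _ _ h => genX_mul_mem h) hv n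
        rwa [one_mul] at this
      | negSucc n =>
        have := pow_mul_mem_filtration (fun _ _ h => genY_mul_mem h) hv (n + 1)
        rwa [one_mul] at this
    have h2 : aeval (genH K) p * (genPow K n * v) ∈
        filtration K (N + n.natAbs + p.natDegree) := by
      rw [aeval_eq_sum_range, Finset.sum_mul]
      refine Submodule.sum_mem _ fun i hi => ?_
      rw [smul_mul_assoc]
      refine Submodule.smul_mem _ _ (filtration_mono ?_
        (pow_mul_mem_filtration (fun _ _ h => genH_mul_mem h) h1 i))
      have := Finset.mem_range.1 hi
      omega
    have h3 := pow_mul_mem_filtration (fun _ _ h => casimir_mul_mem h) h2 a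
    rw [mul_assoc, mul_assoc]
    exact filtration_mono (by omega) h3
  exact key hu

theorem exists_mem_filtration (u : Usl2 K) : ∃ N, u ∈ filtration K N := by
  let S : Subalgebra K (Usl2 K) :=
    { carrier := {u | ∃ N, u ∈ filtration K N}
      mul_mem' := fun ⟨M, hM⟩ ⟨N, hN⟩ => ⟨M + N, mul_mem_filtration hM hN⟩
      add_mem' := fun ⟨M, hM⟩ ⟨N, hN⟩ => ⟨max M N, Submodule.add_mem _
        (filtration_mono (le_max_left _ _) hM) (filtration_mono (le_max_right _ _) hN)⟩
      algebraMap_mem' := fun r => ⟨0, by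
        rw [Algebra.algebraMap_eq_smul_one]
        exact Submodule.smul_mem _ _ one_mem_filtration⟩ }
  have h : S = ⊤ := eq_top_of_generators_mem S
    ⟨1, by simpa using genX_mul_mem one_mem_filtration⟩
    ⟨1, by simpa using genY_mul_mem one_mem_filtration⟩
    ⟨1, by simpa using genH_mul_mem one_mem_filtration⟩
  exact (h ▸ Algebra.mem_top : u ∈ S)

variable (K) in
/-- The monomials `C ^ a * H ^ b * X ^ n` and `C ^ a * H ^ b * Y ^ n`. -/
def monomials (i : ℤ × ℕ × ℕ) : Usl2 K :=
  casimir K ^ i.2.1 * (genH K ^ i.2.2 * genPow K i.1)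

omit [CharZero K] in
lemma filtration_le (N : ℕ) : filtration K N ≤ Submodule.span K (monomials K ''
    (Finset.Icc (-N : ℤ) N ×ˢ Finset.range (N + 1) ×ˢ Finset.range (N + 1) :
      Finset (ℤ × ℕ × ℕ))) := by
  refine Submodule.span_le.2 ?_
  rintro _ ⟨a, p, n, h, rfl⟩
  rw [aeval_eq_sum_range, Finset.sum_mul, Finset.mul_sum]
  refine Submodule.sum_mem _ fun i hi => ?_
  rw [smul_mul_assoc, mul_smul_comm]
  refine Submodule.smul_mem _ _ (Submodule.subset_span ⟨(n, a, i), ?_, rfl⟩)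
  have := Finset.mem_range.1 hi
  simp only [Finset.coe_product, Set.mem_prod, Finset.mem_coe, Finset.mem_Icc, Finset.mem_range]
  omega

theorem span_monomials : Submodule.span K (Set.range (monomials K)) = ⊤ := by
  refine eq_top_iff.2 fun u _ => ?_
  obtain ⟨N, hN⟩ := exists_mem_filtration u
  exact Submodule.span_mono (Set.image_subset_range _ _) (filtration_le N hN)

instance (N : ℕ) : FiniteDimensional K (filtration K N) :=
  have : FiniteDimensional K (Submodule.span K (monomials K ''
    (Finset.Icc (-N : ℤ) N ×ˢ Finset.range (N + 1) ×ˢ Finset.range (N + 1) :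
      Finset (ℤ × ℕ × ℕ)))) := FiniteDimensional.span_of_finite K (Set.toFinite _)
  Submodule.finiteDimensional_of_le (filtration_le N)

omit [CharZero K] in
lemma finrank_filtration_le (N : ℕ) :
    Module.finrank K (filtration K N) ≤ 2 * (N + 1) ^ 3 := by
  classical
  have : FiniteDimensional K (Submodule.span K (monomials K ''
    (Finset.Icc (-N : ℤ) N ×ˢ Finset.range (N + 1) ×ˢ Finset.range (N + 1) :
      Finset (ℤ × ℕ × ℕ)))) := FiniteDimensional.span_of_finite K (Set.toFinite _)
  refine (Submodule.finrank_mono (filtration_le N)).trans ?_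
  rw [← Finset.coe_image]
  refine (finrank_span_finset_le_card _).trans (Finset.card_image_le.trans ?_)
  rw [Finset.card_product, Finset.card_product, Int.card_Icc, Finset.card_range]
  have : ((N : ℤ) + 1 - -N).toNat ≤ 2 * (N + 1) := by omega
  calc _ ≤ 2 * (N + 1) * ((N + 1) * (N + 1)) := Nat.mul_le_mul_right _ this
    _ = _ := by ring

end Filtration

end DixmierTypes

/-! ### The dimension bound and the Ore conditions. -/

namespace DixmierTypes

section Growth

variable {K : Type*} [Field K] [CharZero K]

lemma exists_pow_le_filtration (V : Submodule K (Usl2 K)) (hV : V.FG) :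
    ∃ m : ℕ, ∀ n : ℕ, (1 ⊔ V) ^ n ≤ filtration K (m * n) := by
  obtain ⟨S, rfl⟩ := hV
  choose N hN using exists_mem_filtration (K := K)
  have hle : 1 ⊔ Submodule.span K (S : Set (Usl2 K)) ≤ filtration K (S.sup N) :=
    sup_le (Submodule.one_le.2 (filtration_mono (Nat.zero_le _) one_mem_filtration))
      (Submodule.span_le.2 fun u hu => filtration_mono (Finset.le_sup hu) (hN u))
  refine ⟨S.sup N, fun n => ?_⟩
  induction n with
  | zero =>
    rw [pow_zero]
    exact Submodule.one_le.2 one_mem_filtration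
  | succ n ih =>
    rw [pow_succ, mul_add, mul_one]
    exact (mul_le_mul' ih hle).trans
      (Submodule.mul_le.2 fun u hu v hv => mul_mem_filtration hu hv)

theorem gkDim_usl2_lt : gkDim K (Usl2 K) < 4 := by
  -- The dimensions are at most `A n³`. Using `7 / 2` instead of the limiting exponent `3` leaves
  -- room for `log A`, once `log n ≥ 2 log A`.
  have h4 : ((7 / 2 : ℝ) : EReal) < 4 := by
    have : ((7 / 2 : ℝ) : EReal) < ((4 : ℝ) : EReal) := EReal.coe_lt_coe_iff.2 (by norm_num)
    exact this.trans_eq rfl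
  refine lt_of_le_of_lt (iSup_le fun V => ?_) h4
  obtain ⟨m, hm⟩ := exists_pow_le_filtration V.1 V.2
  set A : ℝ := 2 * (m + 1) ^ 3 with hA
  have hev : ∀ᶠ n : ℕ in Filter.atTop, 2 * Real.log A + 1 ≤ Real.log n :=
    (Real.tendsto_log_atTop.comp tendsto_natCast_atTop_atTop).eventually_ge_atTop _
  have hA1 : 1 ≤ A := by
    have : (1 : ℝ) ≤ (m + 1) ^ 3 := one_le_pow₀ (by linarith [(Nat.cast_nonneg m : (0 : ℝ) ≤ m)])
    linarith
  have hA0 := Real.log_nonneg hA1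
  refine Filter.limsup_le_of_le (h := ?_)
  filter_upwards [hev, Filter.eventually_ge_atTop 1] with n hn hn1
  rw [EReal.coe_le_coe_iff, div_le_iff₀ (by linarith)]
  rcases Nat.eq_zero_or_pos (Module.finrank K ((1 ⊔ V.1) ^ n : Submodule K (Usl2 K))) with h0 | h0
  · rw [h0, Nat.cast_zero, Real.log_zero]
    linarith
  have h1 := (Submodule.finrank_mono (hm n)).trans (finrank_filtration_le (m * n))
  have hn1' : (1 : ℝ) ≤ n := by exact_mod_cast hn1
  have h2 : (Module.finrank K ((1 ⊔ V.1) ^ n : Submodule K (Usl2 K)) : ℝ) ≤ A * (n : ℝ) ^ 3 := by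
    calc (Module.finrank K ((1 ⊔ V.1) ^ n : Submodule K (Usl2 K)) : ℝ)
        ≤ 2 * ((m * n + 1 : ℝ)) ^ 3 := by exact_mod_cast h1
      _ ≤ 2 * ((m + 1) * n : ℝ) ^ 3 := by
        gcongr
        linarith
      _ = A * (n : ℝ) ^ 3 := by rw [hA]; ring
  have h3 := Real.log_le_log (by exact_mod_cast h0) h2
  rw [Real.log_mul (by linarith) (by positivity), Real.log_pow] at h3
  push_cast at h3
  linarith

lemma exists_lt_two_pow (d : ℕ) : ∃ j : ℕ, 2 * (j * d + 1) ^ 3 < 2 ^ j := by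
  have h := tendsto_pow_const_div_const_pow_of_one_lt 3 (r := (2 : ℝ)) one_lt_two
  have hpos : (0 : ℝ) < 1 / (2 * (d + 1) ^ 3) := by positivity
  obtain ⟨j, hj, hj1⟩ := ((h.eventually_lt_const hpos).and (Filter.eventually_ge_atTop 1)).exists
  refine ⟨j, ?_⟩
  rw [div_lt_div_iff₀ (by positivity) (by positivity), one_mul] at hj
  have hj1' : (1 : ℝ) ≤ j := by exact_mod_cast hj1
  have : (2 * (j * d + 1) ^ 3 : ℝ) < 2 ^ j := by
    calc (2 * (j * d + 1) ^ 3 : ℝ) ≤ 2 * (j * (d + 1)) ^ 3 := by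
          gcongr
          linarith
      _ = j ^ 3 * (2 * (d + 1) ^ 3) := by ring
      _ < _ := hj
  exact_mod_cast this

omit [CharZero K] in
/-- Two injective linear endomorphisms that raise degrees by a bounded amount have ranges with a
nonzero intersection, because the dimensions grow polynomially. -/
lemma exists_apply_eq_apply [Nontrivial (Usl2 K)] {f g : Usl2 K →ₗ[K] Usl2 K} {d : ℕ}
    (hf : Function.Injective f) (hg : Function.Injective g)
    (hfd : ∀ N, filtration K N ≤ (filtration K (N + d)).comap f)
    (hgd : ∀ N, filtration K N ≤ (filtration K (N + d)).comap g) :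
    ∃ u v, f u = g v ∧ f u ≠ 0 := by
  by_contra! hcon
  -- If the ranges met only in zero, the two images of each filtration step would form a direct sum
  -- in the step `N + d`. The dimension would double each time, against cubic growth.
  have hstep : ∀ N, 2 * Module.finrank K (filtration K N) ≤
      Module.finrank K (filtration K (N + d)) := by
    intro N
    have hinf : (filtration K N).map f ⊓ (filtration K N).map g = ⊥ := by
      refine eq_bot_iff.2 ?_
      rintro _ ⟨⟨u, -, rfl⟩, v, -, hv⟩
      exact hcon u v hv.symm
    have h1 := Submodule.finrank_sup_add_finrank_inf_eq ((filtration K N).map f)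
      ((filtration K N).map g)
    rw [hinf, finrank_bot, add_zero,
      ← (Submodule.equivMapOfInjective f hf (filtration K N)).finrank_eq,
      ← (Submodule.equivMapOfInjective g hg (filtration K N)).finrank_eq, ← two_mul] at h1
    rw [← h1]
    exact Submodule.finrank_mono (sup_le (Submodule.map_le_iff_le_comap.2 (hfd N))
      (Submodule.map_le_iff_le_comap.2 (hgd N)))
  have hpow : ∀ j, 2 ^ j ≤ Module.finrank K (filtration K (j * d)) := by
    intro j
    induction j with
    | zero =>
      rw [pow_zero, zero_mul, Nat.one_le_iff_ne_zero, Ne, Submodule.finrank_eq_zero]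
      intro h
      have h1 := one_mem_filtration (K := K)
      rw [h] at h1
      exact one_ne_zero ((Submodule.mem_bot K).1 h1)
    | succ j ih =>
      rw [pow_succ', add_mul, one_mul]
      exact (Nat.mul_le_mul_left 2 ih).trans (hstep _)
  obtain ⟨j, hj⟩ := exists_lt_two_pow d
  exact absurd ((hpow j).trans (finrank_filtration_le _)) (not_le.2 hj)

variable [NoZeroDivisors (Usl2 K)] [Nontrivial (Usl2 K)]

theorem exists_left_common_multiple {r s : Usl2 K} (hr : r ≠ 0) (hs : s ≠ 0) :
    ∃ u v, u * r = v * s ∧ u * r ≠ 0 := by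
  obtain ⟨M, hM⟩ := exists_mem_filtration r
  obtain ⟨N, hN⟩ := exists_mem_filtration s
  exact exists_apply_eq_apply (f := LinearMap.mulRight K r) (g := LinearMap.mulRight K s)
    (d := max M N) (mul_left_injective₀ hr) (mul_left_injective₀ hs)
    (fun n u hu => mul_mem_filtration hu (filtration_mono (le_max_left _ _) hM))
    (fun n u hu => mul_mem_filtration hu (filtration_mono (le_max_right _ _) hN))

theorem exists_right_common_multiple {r s : Usl2 K} (hr : r ≠ 0) (hs : s ≠ 0) :
    ∃ u v, r * u = s * v ∧ r * u ≠ 0 := by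
  obtain ⟨M, hM⟩ := exists_mem_filtration r
  obtain ⟨N, hN⟩ := exists_mem_filtration s
  exact exists_apply_eq_apply (f := LinearMap.mulLeft K r) (g := LinearMap.mulLeft K s)
    (d := max M N) (mul_right_injective₀ hr) (mul_right_injective₀ hs)
    (fun n u hu => add_comm n _ ▸ mul_mem_filtration (filtration_mono (le_max_left _ _) hM) hu)
    (fun n u hu => add_comm n _ ▸ mul_mem_filtration (filtration_mono (le_max_right _ _) hN) hu)

end Growth

end DixmierTypes

/-! ### The embedding of the enveloping algebra in the skew Laurent series. -/

namespace SkewLaurent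

variable {E F : Type*} [Field E] [Field F] [Algebra E F] {σ : F ≃ₐ[E] F}

lemma mono_add (n : ℤ) (a b : F) : mono σ n (a + b) = mono σ n a + mono σ n b := by
  ext m
  rw [map_add, coeff_mono, coeff_mono, coeff_mono]
  split_ifs <;> simp

lemma mono_smul (n : ℤ) (e : E) (a : F) : mono σ n (e • a) = e • mono σ n a := by
  ext m
  rw [map_smul, coeff_mono, coeff_mono]
  split_ifs <;> simp

variable (σ) in
/-- The elements of degree zero. -/
def monoZero : F →ₐ[E] alg σ :=
  AlgHom.ofLinearMap
    { toFun := mono σ 0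
      map_add' := mono_add 0
      map_smul' := fun e a => mono_smul 0 e a } mono_zero_one
    (fun a b => by simp [mono_mul_mono])

lemma monoZero_apply (a : F) : monoZero σ a = mono σ 0 a := rfl

namespace IsShift

variable [CharZero E] {c h : F} (hS : IsShift σ c h)

include hS

omit [CharZero E] in
lemma transcendental_left : Transcendental E c := by
  have hli : LinearIndependent E fun n : ℕ => c ^ n := by
    simpa [Function.comp_def] using hS.linearIndependent.comp (fun n : ℕ => (n, 0)) (Prod.mk_left_injective 0)
  rw [transcendental_iff]
  intro p hp
  rw [Polynomial.aeval_eq_sum_range] at hp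
  ext n
  rw [Polynomial.coeff_zero]
  by_contra hn
  exact hn (linearIndependent_iff'.1 hli _ p.coeff hp n
    (Finset.mem_range_succ_iff.2 (Polynomial.le_natDegree_of_ne_zero hn)))

omit [CharZero E] in
lemma fixedByPowers : FixedByPowers σ := by
  intro m a hm ha
  obtain ⟨p, q, rfl⟩ := hS.fixed m hm a ha
  rw [map_div₀, ← Polynomial.aeval_algHom_apply, ← Polynomial.aeval_algHom_apply, hS.map_left]

lemma zpow_right_ne (m : ℤ) (hm : m ≠ 0) : (σ ^ m) h ≠ h := by
  have : CharZero F := charZero_of_injective_algebraMap (algebraMap E F).injective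
  rw [zpow_apply_of_map_eq_sub_one hS.map_right, Ne, sub_eq_self]
  exact_mod_cast hm

/-- If `c - h (h + 1)` vanished, so would its image `c - (h - 1) h` under `σ`. The difference gives
`2 h = 0`, contrary to `σ h = h - 1`. -/
lemma weight_ne_zero : c - h * (h + 1) ≠ 0 := by
  have : CharZero F := charZero_of_injective_algebraMap (algebraMap E F).injective
  intro h0
  have h1 := congrArg σ h0
  rw [map_sub, map_mul, map_add, map_one, map_zero, hS.map_left, hS.map_right] at h1
  have h2 : 2 * h = 0 := by linear_combination h1 - h0
  have h3 : h = 0 := by simpa using h2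
  have h4 := hS.map_right
  rw [h3, map_zero] at h4
  exact one_ne_zero (zero_sub (1 : F) ▸ h4.symm |> neg_eq_zero.1)

end IsShift

end SkewLaurent

namespace DixmierTypes

open SkewLaurent

section ExtendScalars

variable (E : Type*) {K A D : Type*} [Field K] [Field E] [Algebra K E] [Ring A] [Algebra K A]
  [Ring D] [Algebra K D] [Algebra E D] [IsScalarTower K E D]

/-- The extension of an algebra map `A → D` to `E ⊗ A` when `D` is an algebra over `E`. -/
def extendScalars (f : A →ₐ[K] D) : E ⊗[K] A →ₐ[E] D :=
  Algebra.TensorProduct.lift (Algebra.ofId E D) f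
    fun e u => show Commute (Algebra.ofId E D e) _ by
      rw [Algebra.ofId_apply]
      exact Algebra.commute_algebraMap_left e _

lemma extendScalars_tmul (f : A →ₐ[K] D) (a : A) : extendScalars E f (1 ⊗ₜ a) = f a := by
  rw [extendScalars, Algebra.TensorProduct.lift_tmul, map_one, one_mul]

lemma extendScalars_comp {B : Type*} [Ring B] [Algebra K B] (f : A →ₐ[K] D) (g : B →ₐ[K] A)
    (z : E ⊗[K] B) : extendScalars E (f.comp g) z =
      extendScalars E f (Algebra.TensorProduct.map (AlgHom.id E E) g z) := by
  induction z with
  | zero => simp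
  | add x y hx hy => rw [map_add, map_add, map_add, hx, hy]
  | tmul e b => simp [extendScalars]

end ExtendScalars

section Representation

variable {E F : Type*} [Field E] [Field F] [Algebra E F] {σ : F ≃ₐ[E] F} {c h : F}
  (hS : IsShift σ c h) (K : Type*) [Field K] [Algebra K E] [Algebra K (alg σ)]
  [IsScalarTower K E (alg σ)]

/-- The embedding of `U(sl(2))` in the skew Laurent series. -/
def skewRep : Usl2 K →ₐ[K] alg σ :=
  -- The coefficient of `Y` is chosen so that `Y X = c - h (h + 1)`, which sends the Casimir element
  -- to `c`.
  usl2Hom (x := mono σ 1 1) (y := mono σ (-1) (c - h * (h + 1))) (h := mono σ 0 h)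
    (by
      rw [mono_mul_mono, mono_mul_mono, zpow_one, hS.map_right, zero_add, add_zero, ← mono_add]
      congr 1
      simp)
    (by
      rw [← neg_one_smul E (mono σ (-1) _), mono_mul_mono, mono_mul_mono, ← mono_smul, zero_add,
        add_zero, ← mono_add, zpow_apply_of_map_eq_sub_one hS.map_right]
      congr 1
      simp
      ring)
    (by
      rw [mono_mul_mono, mono_mul_mono, ← algebraMap_smul E (2 : K), ← mono_smul, map_ofNat]
      norm_num
      rw [← mono_add, hS.map_left, hS.map_right, ofNat_smul_eq_nsmul]
      congr 1
      ring)

lemma skewRep_genX : skewRep hS K (genX K) = mono σ 1 1 := usl2Hom_genX ..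

lemma skewRep_genY : skewRep hS K (genY K) = mono σ (-1) (c - h * (h + 1)) := usl2Hom_genY ..

variable [CharZero E] [CharZero K]

omit [CharZero E] in
lemma skewRep_genH : skewRep hS K (genH K) = mono σ 0 h := usl2Hom_genH ..

omit [CharZero E] in
lemma skewRep_casimir : skewRep hS K (casimir K) = mono σ 0 c := by
  rw [casimir, map_add, map_mul, map_mul, map_add, map_one, skewRep_genX, skewRep_genY,
    skewRep_genH, ← mono_zero_one, ← mono_add, mono_mul_mono, mono_mul_mono, map_one]
  norm_num
  rw [← mono_add, sub_add_cancel]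

omit [CharZero K] in
lemma exists_skewRep_genPow (n : ℤ) : ∃ w ≠ 0, skewRep hS K (genPow K n) = mono σ n w := by
  cases n with
  | ofNat n =>
    refine ⟨1, one_ne_zero, ?_⟩
    change skewRep hS K (genX K ^ n) = mono σ (n : ℤ) 1
    rw [map_pow, skewRep_genX]
    induction n with
    | zero => rw [pow_zero, Nat.cast_zero, mono_zero_one]
    | succ n ih =>
      rw [pow_succ, ih, mono_mul_mono, map_one, mul_one]
      rfl
  | negSucc n =>
    change ∃ w ≠ 0, skewRep hS K (genY K ^ (n + 1)) = _
    rw [map_pow, skewRep_genY, Int.negSucc_eq]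
    induction n with
    | zero => exact ⟨_, hS.weight_ne_zero, by simp⟩
    | succ n ih =>
      obtain ⟨w, hw, h⟩ := ih
      refine ⟨w * (σ ^ (-(n + 1 : ℤ))) (c - _), mul_ne_zero hw
        ((map_ne_zero _).2 hS.weight_ne_zero), ?_⟩
      rw [pow_succ, h, mono_mul_mono]
      congr 1

/-- Monomials with different powers of `X` are separated by degree; within one degree a common
nonzero coefficient `w` cancels and the independence of the `cᵃ hᵇ` remains. With the spanning
property this yields a basis of `U`. -/
theorem linearIndependent_skewRep :
    LinearIndependent E fun i => skewRep hS K (monomials K i) := by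
  classical
  choose w hw0 hw using exists_skewRep_genPow hS K
  have hmon : ∀ i, skewRep hS K (monomials K i) = mono σ i.1 (c ^ i.2.1 * h ^ i.2.2 * w i.1) := by
    intro i
    rw [monomials, map_mul, map_mul, map_pow, map_pow, skewRep_casimir, skewRep_genH, hw,
      ← monoZero_apply, ← monoZero_apply, ← map_pow, ← map_pow, monoZero_apply, monoZero_apply,
      mono_mul_mono, mono_mul_mono]
    simp [mul_assoc]
  rw [linearIndependent_iff']
  intro s g hsum i hi
  set T := s.filter fun j => j.1 = i.1 with hT
  have h1 : ∑ j ∈ T, g (i.1, j.2) • (c ^ j.2.1 * h ^ j.2.2) = 0 := by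
    have h2 := congrArg (coeff i.1) hsum
    rw [map_sum, map_zero] at h2
    refine (mul_eq_zero.1 (Eq.trans ?_ h2)).resolve_right (hw0 i.1)
    rw [hT, Finset.sum_filter, Finset.sum_mul]
    refine Finset.sum_congr rfl fun j _ => ?_
    rw [map_smul, hmon, coeff_mono]
    by_cases hj : j.1 = i.1
    · rw [if_pos hj, if_pos hj.symm, ← hj, smul_mul_assoc]
    · rw [if_neg hj, if_neg fun h => hj h.symm, zero_mul, smul_zero]
  have hinj : Set.InjOn Prod.snd (T : Set (ℤ × ℕ × ℕ)) := by
    intro a ha b hb hab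
    exact Prod.ext ((Finset.mem_filter.1 ha).2.trans (Finset.mem_filter.1 hb).2.symm) hab
  rw [← Finset.sum_image (f := fun q : ℕ × ℕ => g (i.1, q) • (c ^ q.1 * h ^ q.2)) hinj] at h1
  exact linearIndependent_iff'.1 hS.linearIndependent _ (fun q => g (i.1, q)) h1 i.2
    (Finset.mem_image_of_mem _ (Finset.mem_filter.2 ⟨hi, rfl⟩))

include hS in
variable (E) in
lemma linearIndependent_monomials : LinearIndependent K (monomials K) := by
  have h1 : LinearIndependent K fun i => skewRep hS K (monomials K i) :=
    (linearIndependent_skewRep hS K).restrict_scalars' K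
  exact LinearIndependent.of_comp (skewRep hS K).toLinearMap h1

/-- A basis of `U` goes to a family independent over `E`, not only over `K`. This stronger
injectivity is needed because eigenvectors live over the algebraic closure. -/
theorem extendScalars_skewRep_injective : Function.Injective (extendScalars E (skewRep hS K)) := by
  let b := Module.Basis.mk (linearIndependent_monomials E hS K) span_monomials.ge
  have hb : (extendScalars E (skewRep hS K)).toLinearMap =
      Finsupp.linearCombination E (fun i => skewRep hS K (monomials K i)) ∘ₗ
        ((Algebra.TensorProduct.basis E b).repr : E ⊗[K] Usl2 K →ₗ[E] _) := by
    refine (Algebra.TensorProduct.basis E b).ext fun i => ?_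
    change extendScalars E (skewRep hS K) (Algebra.TensorProduct.basis E b i) =
      Finsupp.linearCombination E _ ((Algebra.TensorProduct.basis E b).repr _)
    rw [Module.Basis.repr_self, Finsupp.linearCombination_single, one_smul,
      Algebra.TensorProduct.basis_apply, extendScalars_tmul, Module.Basis.mk_apply]
  have : Function.Injective (extendScalars E (skewRep hS K)).toLinearMap := by
    rw [hb, LinearMap.coe_comp]
    exact Function.Injective.comp (linearIndependent_skewRep hS K)
      (Algebra.TensorProduct.basis E b).repr.injective
  exact this

lemma skewRep_injective : Function.Injective (skewRep hS K) := by
  have : Function.Injective fun u : Usl2 K => (1 : E) ⊗ₜ[K] u :=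
    Algebra.TensorProduct.includeRight_injective (R := K) (A := E) (B := Usl2 K)
      (algebraMap K E).injective
  intro u v huv
  refine this (extendScalars_skewRep_injective hS K ?_)
  simpa only [extendScalars_tmul] using huv

end Representation

end DixmierTypes

/-! ### Division rings of quotients. -/

namespace DixmierTypes

namespace IsDivisionRingOfQuotients

variable {K : Type*} [Field K] {B Q D : Type*} [Ring B] [Algebra K B] [DivisionRing Q] [Algebra K Q]
  [DivisionRing D] [Algebra K D] {ι : B →ₐ[K] Q} (hι : IsDivisionRingOfQuotients ι)
  {f : B →ₐ[K] D} (hf : Function.Injective f)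

include hι

lemma map_ne_zero {s : B} (hs : s ≠ 0) : ι s ≠ 0 :=
  (map_ne_zero_iff ι hι.injective).2 hs

lemma mul_ne_zero {s t : B} (hs : s ≠ 0) (ht : t ≠ 0) : s * t ≠ 0 := fun h =>
  _root_.mul_ne_zero (hι.map_ne_zero hs) (hι.map_ne_zero ht) (by rw [← map_mul, h, map_zero])

lemma exists_mul_eq (q : Q) : ∃ s b : B, s ≠ 0 ∧ ι s * q = ι b := by
  obtain ⟨s, b, hs, rfl⟩ := hι.left_fraction q
  exact ⟨s, b, hs, mul_inv_cancel_left₀ (hι.map_ne_zero hs) _⟩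

/-- The Ore condition is recovered by writing `ι r * (ι s)⁻¹` as a left fraction. -/
lemma exists_left_ore (r : B) {s : B} (hs : s ≠ 0) : ∃ u v : B, v ≠ 0 ∧ v * r = u * s := by
  obtain ⟨v, u, hv, h⟩ := hι.exists_mul_eq (ι r * (ι s)⁻¹)
  refine ⟨u, v, hv, hι.injective ?_⟩
  rw [map_mul, map_mul, ← h, mul_assoc, mul_assoc, inv_mul_cancel₀ (hι.map_ne_zero hs), mul_one]

omit hι in
variable (ι f) in
/-- The fraction `q` and the element `d` are quotients of the same pair of elements of `B`. -/
def FractionRel (q : Q) (d : D) : Prop := ∃ s b : B, s ≠ 0 ∧ ι s * q = ι b ∧ f s * d = f b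

omit hι in
lemma fractionRel_map [Nontrivial B] (b : B) : FractionRel ι f (ι b) (f b) :=
  ⟨1, b, one_ne_zero, by rw [map_one, one_mul], by rw [map_one, one_mul]⟩

lemma fractionRel_add {q q' : Q} {d d' : D} (h : FractionRel ι f q d) (h' : FractionRel ι f q' d') :
    FractionRel ι f (q + q') (d + d') := by
  obtain ⟨s, b, hs, h1, h2⟩ := h
  obtain ⟨s', b', hs', h1', h2'⟩ := h'
  obtain ⟨u, v, hv, huv⟩ := hι.exists_left_ore s hs'
  refine ⟨v * s, v * b + u * b', hι.mul_ne_zero hv hs, ?_, ?_⟩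
  · rw [mul_add, map_mul, mul_assoc, h1, ← map_mul, ← map_mul, huv, map_mul ι u, mul_assoc, h1',
      ← map_mul, ← map_add]
  · rw [mul_add, map_mul, mul_assoc, h2, ← map_mul, ← map_mul, huv, map_mul f u, mul_assoc, h2',
      ← map_mul, ← map_add]

lemma fractionRel_mul {q q' : Q} {d d' : D} (h : FractionRel ι f q d) (h' : FractionRel ι f q' d') :
    FractionRel ι f (q * q') (d * d') := by
  obtain ⟨s, b, hs, h1, h2⟩ := h
  obtain ⟨s', b', hs', h1', h2'⟩ := h'
  obtain ⟨u, v, hv, huv⟩ := hι.exists_left_ore b hs'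
  refine ⟨v * s, u * b', hι.mul_ne_zero hv hs, ?_, ?_⟩
  · rw [map_mul, mul_assoc, ← mul_assoc _ q, h1, ← mul_assoc, ← map_mul, huv, map_mul, mul_assoc,
      h1', map_mul]
  · rw [map_mul, mul_assoc, ← mul_assoc _ d, h2, ← mul_assoc, ← map_mul, huv, map_mul, mul_assoc,
      h2', map_mul]

include hf

lemma exists_fractionRel (q : Q) : ∃ d, FractionRel ι f q d := by
  obtain ⟨s, b, hs, h⟩ := hι.exists_mul_eq q
  exact ⟨(f s)⁻¹ * f b, s, b, hs, h, mul_inv_cancel_left₀ ((map_ne_zero_iff f hf).2 hs) _⟩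

/-- Over a common left multiple of the two denominators the numerators agree in `B`, because they
agree in `Q`. -/
lemma fractionRel_unique {q : Q} {d d' : D} (h : FractionRel ι f q d) (h' : FractionRel ι f q d') :
    d = d' := by
  obtain ⟨s, b, hs, h1, h2⟩ := h
  obtain ⟨s', b', hs', h1', h2'⟩ := h'
  obtain ⟨u, v, hv, huv⟩ := hι.exists_left_ore s hs'
  have hb : v * b = u * b' := hι.injective (by
    rw [map_mul, ← h1, ← mul_assoc, ← map_mul, huv, map_mul, mul_assoc, h1', map_mul])
  refine mul_left_cancel₀ ((map_ne_zero_iff f hf).2 (hι.mul_ne_zero hv hs)) ?_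
  rw [map_mul, mul_assoc, h2, ← map_mul, hb, map_mul, ← h2', ← mul_assoc, ← map_mul, ← huv, map_mul]

/-- The division ring of quotients has the expected universal property. -/
theorem exists_lift [Nontrivial B] : ∃ j : Q →ₐ[K] D, ∀ b, j (ι b) = f b := by
  choose j hj using hι.exists_fractionRel hf
  have huniq : ∀ {q d}, FractionRel ι f q d → j q = d := fun h =>
    hι.fractionRel_unique hf (hj _) h
  have hmap : ∀ b, j (ι b) = f b := fun b => huniq (fractionRel_map b)
  refine ⟨
    { toFun := j
      map_one' := by rw [← map_one ι, hmap, map_one]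
      map_zero' := by rw [← map_zero ι, hmap, map_zero]
      map_add' := fun q q' => huniq (hι.fractionRel_add (hj q) (hj q'))
      map_mul' := fun q q' => huniq (hι.fractionRel_mul (hj q) (hj q'))
      commutes' := fun r => by rw [← ι.commutes, hmap, f.commutes] }, hmap⟩

omit hf

variable {E : Type*} [Field E] [Algebra K E] [Algebra E D] [IsScalarTower K E D]

-- The finitely many entries of a tensor have a common left denominator; `extendScalars_injective`
-- uses this to carry injectivity from `E ⊗ B` to `E ⊗ Q`.
omit [DivisionRing D] [Algebra K D] [Algebra E D] [IsScalarTower K E D] in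
lemma exists_mul_eq_map (hB : (1 : B) ≠ 0) (z : E ⊗[K] Q) : ∃ s : B, s ≠ 0 ∧ ∃ w : E ⊗[K] B,
    ((1 : E) ⊗ₜ[K] ι s) * z = Algebra.TensorProduct.map (AlgHom.id E E) ι w := by
  induction z with
  | zero => exact ⟨1, hB, 0, by simp⟩
  | tmul e q =>
    obtain ⟨s, b, hs, h⟩ := hι.exists_mul_eq q
    exact ⟨s, hs, e ⊗ₜ b, by simp [h]⟩
  | add x y hx hy =>
    obtain ⟨s, hs, w, hw⟩ := hx
    obtain ⟨s', hs', w', hw'⟩ := hy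
    obtain ⟨u, v, hv, huv⟩ := hι.exists_left_ore s hs'
    refine ⟨v * s, hι.mul_ne_zero hv hs, (1 ⊗ₜ v) * w + (1 ⊗ₜ u) * w', ?_⟩
    have hsplit : ∀ a b : B, (1 : E) ⊗ₜ[K] ι (a * b) = ((1 : E) ⊗ₜ[K] ι a) * (1 ⊗ₜ ι b) :=
      fun a b => by simp
    rw [mul_add]
    nth_rewrite 2 [huv]
    rw [hsplit, hsplit, mul_assoc, mul_assoc, hw, hw', map_add, map_mul, map_mul]
    simp

theorem extendScalars_injective (hB : (1 : B) ≠ 0) {j : Q →ₐ[K] D}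
    (hj : Function.Injective (extendScalars E (j.comp ι))) :
    Function.Injective (extendScalars E j) := by
  rw [injective_iff_map_eq_zero]
  intro z hz
  obtain ⟨s, hs, w, hw⟩ := hι.exists_mul_eq_map hB z
  have h1 : extendScalars E (j.comp ι) w = 0 := by
    rw [extendScalars_comp, ← hw, map_mul, hz, mul_zero]
  have h2 : w = 0 := hj (h1.trans (map_zero _).symm)
  have h3 : ((1 : E) ⊗ₜ[K] (ι s)⁻¹) * ((1 ⊗ₜ ι s) * z) = z := by
    rw [← mul_assoc, Algebra.TensorProduct.tmul_mul_tmul, one_mul,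
      inv_mul_cancel₀ (hι.map_ne_zero hs), ← Algebra.TensorProduct.one_def, one_mul]
  rw [← h3, hw, h2, map_zero, mul_zero]

end IsDivisionRingOfQuotients

open scoped nonZeroDivisors

/-- The division ring of quotients of a domain that satisfies both Ore conditions. -/
theorem exists_isDivisionRingOfQuotients {K : Type*} [Field K] (B : Type u) [Ring B] [Algebra K B]
    [Nontrivial B] [NoZeroDivisors B]
    (hl : ∀ r s : B, r ≠ 0 → s ≠ 0 → ∃ u v, u * r = v * s ∧ u * r ≠ 0)
    (hr : ∀ r s : B, r ≠ 0 → s ≠ 0 → ∃ u v, r * u = s * v ∧ r * u ≠ 0) :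
    ∃ (Q : Type u) (_ : DivisionRing Q) (_ : Algebra K Q) (ι : B →ₐ[K] Q),
      IsDivisionRingOfQuotients ι := by
  have hore : ∀ (r : B) (s : B⁰), ∃ (r' : B) (s' : B⁰), s' * r = r' * s := by
    intro r s
    by_cases hr0 : r = 0
    · exact ⟨0, 1, by simp [hr0]⟩
    · obtain ⟨u, v, huv, hne⟩ := hl r s hr0 (nonZeroDivisors.ne_zero s.2)
      exact ⟨v, ⟨u, mem_nonZeroDivisors_of_ne_zero (left_ne_zero_of_mul hne)⟩, huv⟩
  choose num den hnd using hore
  let _ : OreLocalization.OreSet B⁰ := OreLocalization.oreSetOfNoZeroDivisors num den hnd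
  let ι : B →ₐ[K] OreLocalization B⁰ B :=
    { (OreLocalization.numeratorRingHom : B →+* OreLocalization B⁰ B) with
      commutes' := fun r => rfl }
  have hinj : Function.Injective ι := OreLocalization.numeratorHom_inj inf_le_left
  have hne : ∀ {s : B}, s ≠ 0 → ι s ≠ 0 := fun hs => (map_ne_zero_iff ι hinj).2 hs
  have hleft : ∀ q : OreLocalization B⁰ B, ∃ s b : B, s ≠ 0 ∧ ι s * q = ι b := by
    intro q
    induction q with | _ b s
    exact ⟨s, b, nonZeroDivisors.ne_zero s.2, OreLocalization.mul_cancel⟩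
  refine ⟨OreLocalization B⁰ B, inferInstance, inferInstance, ι, hinj, fun q => ?_, fun q => ?_⟩
  · obtain ⟨s, b, hs, h⟩ := hleft q
    exact ⟨s, b, hs, by rw [← h, inv_mul_cancel_left₀ (hne hs)]⟩
  · obtain ⟨s, b, hs, h⟩ := hleft q
    by_cases hb : b = 0
    · refine ⟨1, 0, one_ne_zero, ?_⟩
      rw [hb, map_zero] at h
      rw [map_zero, zero_mul]
      exact (mul_eq_zero.1 h).resolve_left (hne hs)
    -- From `b u = s v` follows `s⁻¹ b = v u⁻¹`. Here `b ≠ 0` is needed to obtain a nonzero common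
    -- multiple.
    · obtain ⟨u, v, huv, hne'⟩ := hr b s hb hs
      have hu := right_ne_zero_of_mul hne'
      refine ⟨u, v, hu, ?_⟩
      rw [eq_mul_inv_iff_mul_eq₀ (hne hu)]
      refine mul_left_cancel₀ (hne hs) ?_
      rw [← mul_assoc, h, ← map_mul, huv, map_mul]

end DixmierTypes

/-! ### The enveloping algebra, its quotients and their subalgebras. -/

namespace DixmierTypes

open SkewLaurent

section Centralizers

variable {E F : Type*} [Field E] [CharZero E] [Field F] [Algebra E F] {σ : F ≃ₐ[E] F} {c h : F}
  (hS : IsShift σ c h)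

include hS

lemma mem_center_of_commute {d : alg σ} (h0 : Commute d (mono σ 0 h))
    (h1 : Commute d (mono σ 1 1)) : d ∈ Subring.center (alg σ) := by
  obtain ⟨hd, hd'⟩ := eq_mono_zero_of_commute hS.zpow_right_ne h0 h1
  rw [Subring.mem_center_iff]
  intro g
  rw [hd']
  exact (commute_mono_zero hd g).eq.symm

omit [CharZero E] in
lemma commute_of_commute_of_notMem_center {a b d : alg σ} (ha : a ∉ Subring.center (alg σ))
    (hb : Commute a b) (hd : Commute a d) : Commute b d :=
  commute_of_commute hS.fixedByPowers
    (fun hc => ha (Subring.mem_center_iff.2 fun g => (hc g).eq.symm)) hb hd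

end Centralizers

lemma smallEmbedding {K : Type*} [Field K] {F : Type*} [Field F] [Algebra (AlgebraicClosure K) F]
    {σ : F ≃ₐ[AlgebraicClosure K] F} {c h : F} [CharZero (AlgebraicClosure K)]
    (hS : IsShift σ c h) [Algebra K (alg σ)] [IsScalarTower K (AlgebraicClosure K) (alg σ)]
    {A : Type*} [Ring A] [Algebra K A] {j : A →ₐ[K] alg σ}
    (hj : Function.Injective (extendScalars (AlgebraicClosure K) j)) (hA : Noncommutative A)
    (hgk : gkDim K A < 4) {z : A} (hz : z ∉ (⊥ : Subalgebra K A))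
    (hz' : j z ∈ Subring.center (alg σ)) :
    SmallEmbedding (extendScalars (AlgebraicClosure K) j) where
  injective := hj
  ccc a ha b d hb hd := commute_of_commute_of_notMem_center hS ha hb hd
  transcendental a ha := transcendental_of_not_central hS.fixedByPowers hS.zpow_right_ne
    (fun hc => ha (Subring.mem_center_iff.2 fun g => (hc g).eq.symm))
  noncommutative := hA
  gkDim_lt := hgk
  exists_central := ⟨z, hz, by rwa [extendScalars_tmul]⟩

section

variable (K : Type u) [Field K] [CharZero K]

instance : Nontrivial (Usl2 K) := by
  obtain ⟨F, _, _, σ, c, h, hS⟩ := exists_isShift K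
  exact (skewRep hS K).toRingHom.domain_nontrivial

instance : NoZeroDivisors (Usl2 K) := by
  obtain ⟨F, _, _, σ, c, h, hS⟩ := exists_isShift K
  exact (skewRep_injective hS K).noZeroDivisors _ (map_zero _) (map_mul _)

lemma genH_mul_genX_ne : genH K * genX K ≠ genX K * genH K := by
  obtain ⟨F, _, _, σ, c, h, hS⟩ := exists_isShift K
  intro hcomm
  have h0 : genX K = 0 := by simpa [hcomm] using genH_mul_genX K
  have h1 := skewRep_genX hS K
  rw [h0, map_zero] at h1
  have h2 := congrArg (coeff 1) h1
  rw [coeff_mono_same, map_zero] at h2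
  exact zero_ne_one h2

theorem transcendental_casimir : Transcendental K (casimir K) := by
  obtain ⟨F, _, _, σ, c, h, hS⟩ := exists_isShift K
  have hinj : Function.Injective (monoZero σ) := (monoZero σ).toRingHom.injective
  rw [Transcendental, ← isAlgebraic_algHom_iff _ (skewRep_injective hS K), skewRep_casimir,
    ← monoZero_apply, isAlgebraic_algHom_iff _ hinj]
  exact hS.transcendental_left

lemma casimir_notMem_bot : casimir K ∉ (⊥ : Subalgebra K (Usl2 K)) := by
  rw [Algebra.mem_bot]
  rintro ⟨r, hr⟩
  exact transcendental_casimir K (hr ▸ isAlgebraic_algebraMap r)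

variable {K}

/-- The nonscalar central element is the Casimir element. -/
theorem exists_smallEmbedding_usl2 :
    ∃ (D : Type u) (_ : DivisionRing D) (_ : Algebra (AlgebraicClosure K) D)
      (J : AlgebraicClosure K ⊗[K] Usl2 K →ₐ[AlgebraicClosure K] D), SmallEmbedding J := by
  have : CharZero (AlgebraicClosure K) :=
    charZero_of_injective_algebraMap (algebraMap K (AlgebraicClosure K)).injective
  obtain ⟨F, _, _, σ, c, h, hS⟩ := exists_isShift (AlgebraicClosure K)
  let _ : Algebra K (alg σ) := Algebra.compHom _ (algebraMap K (AlgebraicClosure K))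
  have : IsScalarTower K (AlgebraicClosure K) (alg σ) := IsScalarTower.of_algebraMap_eq fun _ => rfl
  refine ⟨alg σ, inferInstance, inferInstance, _, smallEmbedding hS
    (extendScalars_skewRep_injective hS K) ⟨_, _, genH_mul_genX_ne K⟩ gkDim_usl2_lt
    (casimir_notMem_bot K) ?_⟩
  rw [skewRep_casimir, Subring.mem_center_iff]
  exact fun g => (commute_mono_zero hS.map_left g).eq.symm

namespace IsDivisionRingOfQuotients

variable {Q : Type v} [DivisionRing Q] [Algebra K Q] {ι : Usl2 K →ₐ[K] Q}
  (hι : IsDivisionRingOfQuotients ι)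

include hι

lemma commute_casimir (q : Q) : Commute (ι (casimir K)) q := by
  obtain ⟨s, b, -, rfl⟩ := hι.left_fraction q
  exact (((casimir_commute K s).map ι).inv_right₀).mul_right ((casimir_commute K b).map ι)

theorem satisfiesCCC : SatisfiesCCC K Q := by
  obtain ⟨F, _, _, σ, c, h, hS⟩ := exists_isShift K
  obtain ⟨j, -⟩ := hι.exists_lift (skewRep_injective hS K)
  have hj : Function.Injective j := j.toRingHom.injective
  refine ⟨⟨ι (genH K), ι (genX K), ?_⟩, fun a ha x hx y hy => ?_⟩
  · rw [← map_mul, ← map_mul, hι.injective.ne_iff]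
    exact genH_mul_genX_ne K
  · rw [Subalgebra.mem_centralizer_iff] at hx hy
    have hja : j a ∉ Subring.center (alg σ) := fun hc => ha (Subalgebra.mem_center_iff.2 fun b =>
      hj (by rw [map_mul, map_mul, Subring.mem_center_iff.1 hc]))
    have hx' : Commute (j a) (j x) := Commute.map (show Commute a x from hx a rfl) j
    have hy' : Commute (j a) (j y) := Commute.map (show Commute a y from hy a rfl) j
    exact hj (by
      rw [map_mul, map_mul, (commute_of_commute_of_notMem_center hS hja hx' hy').eq])

theorem transcendental_casimir : Transcendental K (ι (casimir K)) := by
  rw [Transcendental, isAlgebraic_algHom_iff _ hι.injective]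
  exact DixmierTypes.transcendental_casimir K

lemma generatedField_le_center : generatedField K (ι (casimir K)) ≤ Subalgebra.center K Q := by
  let Z : Subfield Q :=
    { Subring.center Q with
      inv_mem' := fun x hx => Set.inv_mem_center hx }
  have h : Subfield.closure (Set.range (algebraMap K Q) ∪ {ι (casimir K)}) ≤ Z := by
    rw [Subfield.closure_le]
    rintro _ (⟨r, rfl⟩ | rfl)
    · exact Subring.mem_center_iff.2 fun g => (Algebra.commutes r g).symm
    · exact Subring.mem_center_iff.2 fun g => (hι.commute_casimir g).eq.symm
  exact fun x hx => Subalgebra.mem_center_iff.2 (Subring.mem_center_iff.1 (h hx))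

theorem center_eq : Subalgebra.center K Q = generatedField K (ι (casimir K)) := by
  refine le_antisymm (fun q hq => ?_) hι.generatedField_le_center
  -- The skew series are taken over `K` itself, so that the image of a central element is a quotient
  -- of polynomials in `c` with coefficients in `K`, which can be pulled back to `K(C)`.
  obtain ⟨F, _, _, σ, c, h, hS⟩ := exists_isShift K
  obtain ⟨j, hj⟩ := hι.exists_lift (skewRep_injective hS K)
  have hcomm : ∀ u, Commute (j q) (skewRep hS K u) := fun u => by
    rw [← hj]
    exact Commute.map (show Commute q (ι u) from (Subalgebra.mem_center_iff.1 hq (ι u)).symm) j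
  obtain ⟨hd, hd'⟩ := eq_mono_zero_of_commute hS.zpow_right_ne
    (skewRep_genH hS K ▸ hcomm (genH K)) (skewRep_genX hS K ▸ hcomm (genX K))
  obtain ⟨p, r, hpr⟩ := hS.fixed 1 one_ne_zero _ (by rwa [zpow_one])
  have hC : monoZero σ c = j (ι (casimir K)) := by rw [hj, skewRep_casimir, monoZero_apply]
  have hmem : ι (casimir K) ∈ generatedField K (ι (casimir K)) :=
    Subfield.subset_closure (Set.mem_union_right _ rfl)
  have haeval : ∀ p : Polynomial K, Polynomial.aeval (ι (casimir K)) p ∈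
      generatedField K (ι (casimir K)) := fun p =>
    Algebra.adjoin_le (Set.singleton_subset_iff.2 hmem)
      (Polynomial.aeval_mem_adjoin_singleton K _)
  have hq' : q = Polynomial.aeval (ι (casimir K)) p * (Polynomial.aeval (ι (casimir K)) r)⁻¹ := by
    refine j.toRingHom.injective ?_
    change j q = j _
    rw [hd', ← monoZero_apply, hpr, map_div₀, ← Polynomial.aeval_algHom_apply,
      ← Polynomial.aeval_algHom_apply, hC, Polynomial.aeval_algHom_apply j,
      Polynomial.aeval_algHom_apply j, map_mul, map_inv₀, div_eq_mul_inv]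
  rw [hq']
  exact Subalgebra.mul_mem _ (haeval p) (Subfield.inv_mem _ (haeval r))

/-- After extension to the algebraic closure, `A` still embeds in the extension of `Q` by flatness,
and that embeds in the skew series. A nonscalar element of `A ∩ K(C)` commutes with the images of
`H` and `X`, hence is central there. -/
theorem exists_smallEmbedding (A : Subalgebra K Q) (hA : Noncommutative A) (hgk : gkDim K A < 4)
    (hAC : A ⊓ generatedField K (ι (casimir K)) ≠ ⊥) :
    ∃ (D : Type u) (_ : DivisionRing D) (_ : Algebra (AlgebraicClosure K) D)
      (J : AlgebraicClosure K ⊗[K] A →ₐ[AlgebraicClosure K] D), SmallEmbedding J := by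
  have : CharZero (AlgebraicClosure K) :=
    charZero_of_injective_algebraMap (algebraMap K (AlgebraicClosure K)).injective
  obtain ⟨F, _, _, σ, c, h, hS⟩ := exists_isShift (AlgebraicClosure K)
  let _ : Algebra K (alg σ) := Algebra.compHom _ (algebraMap K (AlgebraicClosure K))
  have : IsScalarTower K (AlgebraicClosure K) (alg σ) := IsScalarTower.of_algebraMap_eq fun _ => rfl
  obtain ⟨j, hj⟩ := hι.exists_lift (skewRep_injective hS K)
  have hjι : j.comp ι = skewRep hS K := AlgHom.ext hj
  have hjinj : Function.Injective (extendScalars (AlgebraicClosure K) j) :=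
    hι.extendScalars_injective one_ne_zero
      (by rw [hjι]; exact extendScalars_skewRep_injective hS K)
  have hAinj : Function.Injective (extendScalars (AlgebraicClosure K) (j.comp A.val)) := by
    intro x y hxy
    rw [extendScalars_comp, extendScalars_comp] at hxy
    exact Module.Flat.lTensor_preserves_injective_linearMap (M := AlgebraicClosure K)
      A.val.toLinearMap Subtype.val_injective (hjinj hxy)
  obtain ⟨z, ⟨hzA, hzC⟩, hz⟩ : ∃ z ∈ A ⊓ generatedField K (ι (casimir K)),
      z ∉ (⊥ : Subalgebra K Q) := by
    by_contra! hcon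
    exact hAC (eq_bot_iff.2 hcon)
  have hcomm : ∀ u, Commute (j z) (skewRep hS K u) := fun u => by
    rw [← hj]
    exact Commute.map (show Commute z (ι u) from
      (Subalgebra.mem_center_iff.1 (hι.generatedField_le_center hzC) (ι u)).symm) j
  refine ⟨alg σ, inferInstance, inferInstance, _, smallEmbedding hS hAinj hA hgk (z := ⟨z, hzA⟩)
    ?_ ?_⟩
  · rw [Algebra.mem_bot] at hz ⊢
    rintro ⟨r, hr⟩
    exact hz ⟨r, congrArg Subtype.val hr⟩
  · exact mem_center_of_commute hS (skewRep_genH hS K ▸ hcomm (genH K))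
      (skewRep_genX hS K ▸ hcomm (genX K))

end IsDivisionRingOfQuotients

end

end DixmierTypes

end

theorem mainTheorem9 (K : Type u) [Field K] [CharZero K] :
    -- the enveloping algebra itself
    (DixmierTypes.SatisfiesCCC K (DixmierTypes.Usl2 K) ∧
      DixmierTypes.AdmitsDixmierPartition K (DixmierTypes.Usl2 K) ∧
      DixmierTypes.SatisfiesHCC K (DixmierTypes.Usl2 K)) ∧
    -- the division ring of quotients exists
    (∃ (Q : Type u) (_ : DivisionRing Q) (_ : Algebra K Q) (ι : DixmierTypes.Usl2 K →ₐ[K] Q),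
      DixmierTypes.IsDivisionRingOfQuotients ι) ∧
    -- and every realization of it has the asserted properties
    ∀ (Q : Type v) [DivisionRing Q] [Algebra K Q] (ι : DixmierTypes.Usl2 K →ₐ[K] Q),
      DixmierTypes.IsDivisionRingOfQuotients ι →
        DixmierTypes.SatisfiesCCC K Q ∧
        Transcendental K (ι (DixmierTypes.casimir K)) ∧
        Subalgebra.center K Q =
          DixmierTypes.generatedField K (ι (DixmierTypes.casimir K)) ∧
        ∀ A : Subalgebra K Q,
          DixmierTypes.Noncommutative A →
          DixmierTypes.gkDim K A < 4 →
          A ⊓ DixmierTypes.generatedField K (ι (DixmierTypes.casimir K)) ≠ ⊥ →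
            DixmierTypes.AdmitsDixmierPartition K A ∧
            DixmierTypes.SatisfiesHCC K A ∧
            DixmierTypes.SatisfiesCCC K A := by
  refine ⟨?_, ?_, ?_⟩
  · obtain ⟨D, _, _, J, hJ⟩ := DixmierTypes.exists_smallEmbedding_usl2 (K := K)
    exact ⟨hJ.satisfiesCCC, hJ.admitsDixmierPartition, hJ.satisfiesHCC⟩
  · exact DixmierTypes.exists_isDivisionRingOfQuotients (DixmierTypes.Usl2 K)
      (fun _ _ => DixmierTypes.exists_left_common_multiple)
      (fun _ _ => DixmierTypes.exists_right_common_multiple)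
  · intro Q _ _ ι hι
    refine ⟨hι.satisfiesCCC, hι.transcendental_casimir, hι.center_eq, fun A hA hgk hAC => ?_⟩
    obtain ⟨D, _, _, J, hJ⟩ := hι.exists_smallEmbedding A hA hgk hAC
    exact ⟨hJ.admitsDixmierPartition, hJ.satisfiesHCC, hJ.satisfiesCCC⟩
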